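/- Multivalued functions of $z\neq 0$ are regarded as functions on the Riemann surface of the logarithm, so $\arg z$ may be any real number; $z^{1/2}=\exp(\tfrac12\log|z|+\tfrac i2\arg z)$. For $n\ge 0$ let $$a_n(\nu)=\frac{(4\nu^2-1^2)(4\nu^2-3^2)\cdots(4\nu^2-(2n-1)^2)}{8^n\, n!},\qquad a_0(\nu)=1,$$ and let $\omega=z-\frac{\pi}{2}\nu-\frac{\pi}{4}$. For non-negative integers $N, M$ (empty sums being zero), the remainder $R_N^{(K)}(z,\nu)$ of the large-argument expansion of the modified Bessel function $K_\nu$ is defined by $$K_\nu(z)=\Big(\frac{\pi}{2z}\Big)^{1/2}e^{-z}\Big(\sum_{n=0}^{N-1}\frac{a_n(\nu)}{z^n}+R_N^{(K)}(z,\nu)\Big),$$ and the remainders $R_{2N}^{(J)}(z,\nu)$, $R_{2M+1}^{(J)}(z,\nu)$ of the expansion of the Bessel function $J_\nu$ are defined by $J_\nu(z)=\left(\frac{2}{\pi z}\right)^{1/2}(P\cos\omega-Q\sin\omega)$ with $$P=\sum_{n=0}^{N-1}(-1)^n\frac{a_{2n}(\nu)}{z^{2n}}+R_{2N}^{(J)}(z,\nu),\qquad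 Q=\sum_{m=0}^{M-1}(-1)^m\frac{a_{2m+1}(\nu)}{z^{2m+1}}-R_{2M+1}^{(J)}(z,\nu),$$ where $P,Q$ are fixed by requiring also $Y_\nu(z)=\left(\frac{2}{\pi z}\right)^{1/2}(P\sin\omega+Q\cos\omega)$ for the Bessel function $Y_\nu$ of the second kind. Let $$\Lambda_p(w)=w^pe^w\,\Gamma(1-p,w),\qquad \Pi_p(w)=\tfrac12\big(\Lambda_p(we^{\frac{\pi}{2}i})+\Lambda_p(we^{-\frac{\pi}{2}i})\big)\qquad(w\ne0),$$ with $\Gamma(1-p,w)$ the upper incomplete gamma function, and let ${\bf F}$ be the regularized hypergeometric function, i.e. the analytic continuation of $${\bf F}(a,b;c;w)=\sum_{n=0}^\infty\frac{(a)_n(b)_n}{\Gamma(c+n)\,n!}w^n\quad(|w|<1),$$ where $(a)_n=a(a+1)\cdots(a+n-1)$, $(a)_0=1$, and $1/\Gamma$ is $0$ at the poles of $\Gamma$. Theorem. Let $N$ be a positive integer and let $\nu$ be a complex number with $|\Re(\nu)|<N+\frac12$. Then $$R_N^{(K)}(z,\nu)=(-1)^N\frac{\cos(\pi\nu)}{\pi}\frac{\Gamma(N)}{2^N}\frac1{z^N}\left(\Lambda_N(2z)+\int_0^{+\infty}\frac{t^{-1}}{(1+t)^N}{\bf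 F}\big(\nu+\tfrac12,-\nu+\tfrac12;0;-t\big)\Lambda_N(2z(1+t))\,dt\right),$$ provided $|\arg z|<\frac{3\pi}{2}$, and $$R_N^{(J)}(z,\nu)=(-1)^{\lfloor N/2\rfloor}\frac{\cos(\pi\nu)}{\pi}\frac{\Gamma(N)}{2^N}\frac1{z^N}\left(\Pi_N(2z)+\int_0^{+\infty}\frac{t^{-1}}{(1+t)^N}{\bf F}\big(\nu+\tfrac12,-\nu+\tfrac12;0;-t\big)\Pi_N(2z(1+t))\,dt\right),$$ provided $|\arg z|<\pi$. Both integrals converge absolutely. -/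

import Mathlib

open Complex Set Filter Topology MeasureTheory

/-!  Multivalued functions of a nonzero variable are functions on the Riemann surface of the
logarithm.  A point `z` of that surface is represented throughout by its logarithm
`ζ = log |z| + i arg z : ℂ`, where `arg z` may be any real number.  The underlying nonzero complex
number is `exp ζ`, the power `z ^ a` is `exp (a * ζ)`, the point `z * e ^ (i α)` is `ζ + α * I`,
and `r * z`, for `r > 0`, is `ζ + Real.log r`.  -/

/-- The modified Bessel function of the first kind `I_ν(z)`, by its power series. -/
noncomputable def besselI (ν ζ : ℂ) : ℂ :=
  exp (ν * (ζ - Real.log 2)) *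
    ∑' k : ℕ, (exp ζ ^ 2 / 4) ^ k / ((k.factorial : ℂ) * Gamma (ν + k + 1))

/-- The Bessel function of the first kind `J_ν(z)`, by its power series. -/
noncomputable def besselJ (ν ζ : ℂ) : ℂ :=
  exp (ν * (ζ - Real.log 2)) *
    ∑' k : ℕ, (-(exp ζ ^ 2 / 4)) ^ k / ((k.factorial : ℂ) * Gamma (ν + k + 1))

/-- The quotient defining `K_ν(z)` for nonintegral `ν`. -/
noncomputable def besselKQuot (ν ζ : ℂ) : ℂ :=
  Real.pi / 2 * ((besselI (-ν) ζ - besselI ν ζ) / sin (Real.pi * ν))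

/-- The quotient defining `Y_ν(z)` for nonintegral `ν`. -/
noncomputable def besselYQuot (ν ζ : ℂ) : ℂ :=
  (besselJ ν ζ * cos (Real.pi * ν) - besselJ (-ν) ζ) / sin (Real.pi * ν)

open Classical in
/-- The modified Bessel function of the second kind `K_ν(z)`; for integral `ν` it is the limiting
value of the quotient. -/
noncomputable def besselK (ν ζ : ℂ) : ℂ :=
  if ∃ n : ℤ, ν = n then limUnder (𝓝[≠] ν) (fun μ => besselKQuot μ ζ) else besselKQuot ν ζ

open Classical in
/-- The Bessel function of the second kind `Y_ν(z)`; for integral `ν` it is the limiting value of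
the quotient. -/
noncomputable def besselY (ν ζ : ℂ) : ℂ :=
  if ∃ n : ℤ, ν = n then limUnder (𝓝[≠] ν) (fun μ => besselYQuot μ ζ) else besselYQuot ν ζ

/-- The coefficients `a_n(ν) = (4ν² - 1²)(4ν² - 3²) ⋯ (4ν² - (2n - 1)²) / (8ⁿ n!)`. -/
noncomputable def hankelCoeff (n : ℕ) (ν : ℂ) : ℂ :=
  (∏ k ∈ Finset.range n, (4 * ν ^ 2 - (2 * (k : ℂ) + 1) ^ 2)) / (8 ^ n * (n.factorial : ℂ))

/-- The remainder `R_N^{(K)}(z, ν)`, that is, the solution `R` of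
`K_ν(z) = (π / (2z))^{1/2} e^{-z} (∑_{n < N} a_n(ν) / zⁿ + R)`. -/
noncomputable def remainderK (N : ℕ) (ζ ν : ℂ) : ℂ :=
  besselK ν ζ * exp (exp ζ) * exp ((ζ + Real.log (2 / Real.pi)) / 2) -
    ∑ n ∈ Finset.range N, hankelCoeff n ν / exp ζ ^ n

/-- `ω = z - π ν / 2 - π / 4`. -/
noncomputable def hankelPhase (ζ ν : ℂ) : ℂ :=
  exp ζ - Real.pi / 2 * ν - Real.pi / 4

/-- The modulating function `P` in
`J_ν(z) = (2 / (πz))^{1/2} (P cos ω - Q sin ω)`, `Y_ν(z) = (2 / (πz))^{1/2} (P sin ω + Q cos ω)`. -/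
noncomputable def hankelP (ζ ν : ℂ) : ℂ :=
  exp ((ζ + Real.log (Real.pi / 2)) / 2) *
    (besselJ ν ζ * cos (hankelPhase ζ ν) + besselY ν ζ * sin (hankelPhase ζ ν))

/-- The modulating function `Q` in
`J_ν(z) = (2 / (πz))^{1/2} (P cos ω - Q sin ω)`, `Y_ν(z) = (2 / (πz))^{1/2} (P sin ω + Q cos ω)`. -/
noncomputable def hankelQ (ζ ν : ℂ) : ℂ :=
  exp ((ζ + Real.log (Real.pi / 2)) / 2) *
    (besselY ν ζ * cos (hankelPhase ζ ν) - besselJ ν ζ * sin (hankelPhase ζ ν))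

/-- The remainders `R_N^{(J)}(z, ν)`: `P = ∑_{n < M} (-1)ⁿ a_{2n}(ν) / z^{2n} + R_{2M}^{(J)}` and
`Q = ∑_{m < M} (-1)ᵐ a_{2m+1}(ν) / z^{2m+1} - R_{2M+1}^{(J)}`.  -/
noncomputable def remainderJ (N : ℕ) (ζ ν : ℂ) : ℂ :=
  if Even N then
    hankelP ζ ν -
      ∑ n ∈ Finset.range (N / 2), (-1) ^ n * hankelCoeff (2 * n) ν / exp ζ ^ (2 * n)
  else
    (∑ m ∈ Finset.range (N / 2), (-1) ^ m * hankelCoeff (2 * m + 1) ν / exp ζ ^ (2 * m + 1)) -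
      hankelQ ζ ν

/-- The remainders `R_{2N}^{(J)}` and `R_{2M+1}^{(J)}` are remainders of the expansion
of `J_ν(z)`. -/
theorem besselJ_eq_remainderJ (N M : ℕ) (ζ ν : ℂ) :
    besselJ ν ζ = exp ((Real.log (2 / Real.pi) - ζ) / 2) *
      (cos (hankelPhase ζ ν) *
        ((∑ n ∈ Finset.range N, (-1) ^ n * hankelCoeff (2 * n) ν / exp ζ ^ (2 * n)) +
          remainderJ (2 * N) ζ ν) -
      sin (hankelPhase ζ ν) *
        ((∑ m ∈ Finset.range M, (-1) ^ m * hankelCoeff (2 * m + 1) ν / exp ζ ^ (2 * m + 1)) -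
          remainderJ (2 * M + 1) ζ ν)) := by
  have h1 : ¬ Even (2 * M + 1) := by simp
  have h2 : (2 * M + 1) / 2 = M := by omega
  have h3 : exp ((Real.log (2 / Real.pi) - ζ) / 2) *
      exp ((ζ + Real.log (Real.pi / 2)) / 2) = 1 := by
    rw [← exp_add]
    have : Real.log (2 / Real.pi) = - Real.log (Real.pi / 2) := by
      rw [← Real.log_inv, inv_div]
    rw [this]
    push_cast
    ring_nf
    exact exp_zero
  have h4 := sin_sq_add_cos_sq (hankelPhase ζ ν)
  simp only [remainderJ, even_two_mul, if_true, h1, if_false, h2, hankelP, hankelQ,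
    Nat.mul_div_cancel_left _ (Nat.succ_pos 1)]
  linear_combination (-(besselJ ν ζ)) * h3 - besselJ ν ζ *
    exp ((Real.log (2 / Real.pi) - ζ) / 2) * exp ((ζ + Real.log (Real.pi / 2)) / 2) * h4

/-- The upper incomplete gamma function `Γ(a, w)` on the Riemann surface of the logarithm, the
integral of `t ^ (a - 1) e ^ (-t) dt` from `w` to `+∞`; the path is the circular arc from `w` to
the positive number `|w|`, followed by the ray from `|w|` to `+∞`.  Here `ζ` is the logarithm
of `w`. -/
noncomputable def upperGamma (a ζ : ℂ) : ℂ :=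
  (∫ φ in ζ.im..0, I * exp (a * (ζ.re + φ * I)) * exp (-exp (ζ.re + φ * I))) +
    ∫ t in Ioi (Real.exp ζ.re), (t : ℂ) ^ (a - 1) * exp (-(t : ℂ))

/-- The basic terminant `Λ_p(w) = w ^ p e ^ w Γ(1 - p, w)`. -/
noncomputable def terminantLambda (p ζ : ℂ) : ℂ :=
  exp (p * ζ) * exp (exp ζ) * upperGamma (1 - p) ζ

/-- The basic terminant `Π_p(w) = (Λ_p(w e ^ (π i / 2)) + Λ_p(w e ^ (-π i / 2))) / 2`. -/
noncomputable def terminantPi (p ζ : ℂ) : ℂ :=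
  (terminantLambda p (ζ + Real.pi / 2 * I) + terminantLambda p (ζ - Real.pi / 2 * I)) / 2

/-- The power series of the regularized hypergeometric function.  The quotient `Γ(a + n) / Γ(a)` is
the rising factorial `(a)_n`; at a pole of `Γ` the value of `(Gamma _)⁻¹` is `0`. -/
noncomputable def regHypergeomSeries (a b c w : ℂ) : ℂ :=
  ∑' n : ℕ, (ascPochhammer ℂ n).eval a * (ascPochhammer ℂ n).eval b *
    (Gamma (c + n))⁻¹ * ((n.factorial : ℂ))⁻¹ * w ^ n

/-- `v` is the value at `w` of the analytic continuation of the hypergeometric series along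
the segment from `0` to `w`. -/
def IsRegHypergeomValue (a b c w v : ℂ) : Prop :=
  ∃ f : ℂ → ℂ, AnalyticOnNhd ℂ f (segment ℝ 0 w) ∧
    f =ᶠ[𝓝 0] regHypergeomSeries a b c ∧ f w = v

/-- The value of the analytic continuation is unique. -/
theorem IsRegHypergeomValue.unique {a b c w v v' : ℂ} (h : IsRegHypergeomValue a b c w v)
    (h' : IsRegHypergeomValue a b c w v') : v = v' := by
  obtain ⟨f, hf, hf0, rfl⟩ := h
  obtain ⟨g, hg, hg0, rfl⟩ := h'
  exact hf.eqOn_of_preconnected_of_eventuallyEq hg (convex_segment 0 w).isPreconnected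
    (left_mem_segment ℝ 0 w) (hf0.trans hg0.symm) (right_mem_segment ℝ 0 w)

/-- The regularized hypergeometric function `𝐅(a, b; c; w)`: the principal branch, on the plane cut
along `[1, ∞)`, of the analytic continuation of its power series. -/
noncomputable def regHypergeom (a b c w : ℂ) : ℂ :=
  Classical.epsilon (IsRegHypergeomValue a b c w)

/-!
For `0 < ν < 1/2` and `z > 0` put `κ(r) = e^(-r) (2 / (π r))^(1/2) K_ν(r)`. The function
`K_ν(z) (2 z / π)^(1/2) e^z` equals `z e^(2z) κ(z)`, and `κ` reproduces itself under the Stieltjes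
transform: `e^(2z) κ(z) = (cos(πν) / π) ∫ κ(r) / (z + r) dr` (`exp_mul_besselWeight`). Expanding
`1 / (z + r)` in a finite geometric series gives the Hankel expansion, whose coefficients are the
moments of `κ` (`integral_pow_mul_besselWeight`), and leaves a remainder of Stieltjes form
(`besselWeight_expansion`).

In that remainder `κ(s)` is eliminated by means of the same reproducing property, now read as
`s e^(2s) κ(s) = 1 - ∫ D(t) e^(-2ts) dt`, where
`D(t) = (2 cos(πν) / π) ∫ r κ(r) e^(-2tr) dr`. Interchanging the integrals turns the term `1` into
`Λ_N(2z)` and the term `D(t)` into `Λ_N(2z(1+t)) / (1+t)^N`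
(`integral_besselWeight_eq_realTerminant`). Expanding the Laplace transform `D` in powers of `t`,
again through the moments of `κ`, identifies `-D(t)` with `t⁻¹ 𝐅(ν + 1/2, -ν + 1/2; 0; -t)`
(`regHypergeom_eq_besselDensity`). The integral representation of `K_ν` behind `κ` is obtained from
the power series for small `z`: both sides solve the same Volterra system
(`exists_gammaRecip_eq_besselRecip`).

The general case follows by holomorphy, in `log z` and then in `ν`. This needs
`|Λ_N(w)| ≤ cos(arg w / 3)^(-N-1)` for `|arg w| < 3π/2`, from rotating the path of the incomplete
gamma function (`norm_terminantLambda_le`), and the bound `t⁻¹ 𝐅 = O(t^(|Re ν| - 3/2 + ε))`, locally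
uniform in `ν`, from Pfaff's transformation (`exists_norm_hyperKernel_le_of_nonneg`). The values at
integral orders are limits, which exist because the right-hand side is continuous in `ν`
(`besselK_eq`). Finally `P ± i Q` are the normalized functions `K_ν(z e^(∓πi/2))`
(`hankelP_add_hankelQ`, `hankelP_sub_hankelQ`), so the statement on `J_ν` is a half-sum or a
half-difference of two instances of the statement on `K_ν`.
-/


/-! ### Integration tools -/

/-- Tonelli's theorem for nonnegative kernels, in Bochner form: when all sections are integrable,
the two iterated integrals agree, and one outer integrand is integrable exactly when the other
is. -/
theorem integral_swap_of_nonneg {S T : Set ℝ} (hS : MeasurableSet S) (hT : MeasurableSet T)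
    {f : ℝ → ℝ → ℝ} (hm : Measurable (Function.uncurry f))
    (h0 : ∀ x ∈ S, ∀ y ∈ T, 0 ≤ f x y) (hx : ∀ x ∈ S, IntegrableOn (f x) T)
    (hy : ∀ y ∈ T, IntegrableOn (fun x => f x y) S) :
    (∫ x in S, ∫ y in T, f x y) = (∫ y in T, ∫ x in S, f x y) ∧
    (IntegrableOn (fun x => ∫ y in T, f x y) S ↔
      IntegrableOn (fun y => ∫ x in S, f x y) T) := by
  set μ : Measure ℝ := volume.restrict S with hμ
  set ν : Measure ℝ := volume.restrict T with hν
  have hms : AEStronglyMeasurable (Function.uncurry f) (μ.prod ν) := hm.aestronglyMeasurable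
  have e1 : ∀ᵐ x ∂μ, (∫ y, ‖f x y‖ ∂ν) = ∫ y, f x y ∂ν := by
    filter_upwards [ae_restrict_mem hS] with x hx'
    exact setIntegral_congr_fun hT fun y hy' => Real.norm_of_nonneg (h0 x hx' y hy')
  have e2 : ∀ᵐ y ∂ν, (∫ x, ‖f x y‖ ∂μ) = ∫ x, f x y ∂μ := by
    filter_upwards [ae_restrict_mem hT] with y hy'
    exact setIntegral_congr_fun hS fun x hx' => Real.norm_of_nonneg (h0 x hx' y hy')
  have i1 : Integrable (Function.uncurry f) (μ.prod ν) ↔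
      Integrable (fun x => ∫ y, f x y ∂ν) μ := by
    rw [integrable_prod_iff hms]
    have : ∀ᵐ x ∂μ, Integrable (fun y => Function.uncurry f (x, y)) ν := by
      filter_upwards [ae_restrict_mem hS] with x hx'
      exact hx x hx'
    simp only [this, true_and]
    exact integrable_congr e1
  have i2 : Integrable (Function.uncurry f) (μ.prod ν) ↔
      Integrable (fun y => ∫ x, f x y ∂μ) ν := by
    rw [integrable_prod_iff' hms]
    have : ∀ᵐ y ∂ν, Integrable (fun x => Function.uncurry f (x, y)) μ := by
      filter_upwards [ae_restrict_mem hT] with y hy'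
      exact hy y hy'
    simp only [this, true_and]
    exact integrable_congr e2
  refine ⟨?_, i1.symm.trans i2⟩
  by_cases h : Integrable (Function.uncurry f) (μ.prod ν)
  · exact integral_integral_swap h
  · rw [integral_undef (mt i1.2 h), integral_undef (mt i2.2 h)]

/-- The integrand of the Gamma integral with rate `r` is integrable. -/
theorem integrableOn_rpow_mul_exp_neg_mul {a r : ℝ} (ha : 0 < a) (hr : 0 < r) :
    IntegrableOn (fun t : ℝ => t ^ (a - 1) * Real.exp (-(r * t))) (Ioi 0) := by
  have := integrableOn_rpow_mul_exp_neg_mul_rpow (p := 1) (s := a - 1) (b := r) (by linarith)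
    one_pos hr
  simpa using this

/-- The substitution `x = c / y` on the positive half-line. -/
theorem integral_comp_const_div_Ioi (g : ℝ → ℝ) {c : ℝ} (hc : 0 < c) :
    ∫ y in Ioi (0 : ℝ), c / y ^ 2 * g (c / y) = ∫ x in Ioi (0 : ℝ), g x := by
  have h1 := integral_comp_rpow_Ioi (fun x => g (c * x)) (p := -1) (by norm_num)
  have h2 := integral_comp_mul_left_Ioi' g 0 hc
  rw [mul_zero] at h2
  rw [← h2, ← h1, smul_eq_mul, ← integral_const_mul]
  refine setIntegral_congr_fun measurableSet_Ioi fun y hy => ?_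
  have hy : (0 : ℝ) < y := hy
  have h3 : y ^ (-1 - 1 : ℝ) = (y ^ 2)⁻¹ := by
    rw [show (-1 - 1 : ℝ) = -((2 : ℕ) : ℝ) by norm_num, Real.rpow_neg hy.le, Real.rpow_natCast]
  simp only [h3, Real.rpow_neg_one, smul_eq_mul, abs_neg, abs_one]
  rw [div_eq_mul_inv c y]
  ring

/-- The substitution `x = c / y` on the positive half-line preserves integrability. -/
theorem integrableOn_comp_const_div_Ioi {g : ℝ → ℝ} {c : ℝ} (hc : 0 < c)
    (hg : IntegrableOn g (Ioi 0)) :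
    IntegrableOn (fun y : ℝ => c / y ^ 2 * g (c / y)) (Ioi 0) := by
  have himg : (fun y : ℝ => c / y) '' Ioi 0 = Ioi 0 := by
    ext x
    constructor
    · rintro ⟨y, hy, rfl⟩
      exact div_pos hc hy
    · intro hx
      exact ⟨c / x, div_pos hc hx, by field_simp⟩
  have h := (integrableOn_image_iff_integrableOn_abs_deriv_smul (s := Ioi (0 : ℝ))
    (f := fun y => c / y) (f' := fun y => -c / y ^ 2) measurableSet_Ioi
    (fun y hy => by
      have hy : y ≠ 0 := (mem_Ioi.1 hy).ne'
      have := (hasDerivAt_const y c).div (hasDerivAt_id y) hy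
      convert! this.hasDerivWithinAt using 1
      simp)
    (fun x hx y hy hxy => by
      have hx : x ≠ 0 := (mem_Ioi.1 hx).ne'
      have hy : y ≠ 0 := (mem_Ioi.1 hy).ne'
      have hxy : c / x = c / y := hxy
      field_simp at hxy
      exact hxy.symm) g).1 (by rwa [himg])
  refine h.congr_fun (fun y hy => ?_) measurableSet_Ioi
  simp only [smul_eq_mul, abs_div, abs_neg, abs_of_pos hc, abs_of_nonneg (sq_nonneg y)]

/-- An integral depending holomorphically on a parameter, with a locally uniform integrable
majorant, can be differentiated under the integral sign; the derivative is dominated through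
Cauchy's estimate. -/
theorem hasDerivAt_integral_of_dominated_holomorphic {α : Type*} [MeasurableSpace α] {μ : Measure α}
    {U : Set ℂ} (hU : IsOpen U) {f : ℂ → α → ℂ}
    (hm : ∀ z ∈ U, AEStronglyMeasurable (f z) μ)
    (hd : ∀ᵐ t ∂μ, DifferentiableOn ℂ (fun z => f z t) U)
    (hb : ∀ z ∈ U, ∃ ε > 0, ∃ g : α → ℝ, Integrable g μ ∧
      ∀ᵐ t ∂μ, ∀ w ∈ Metric.ball z ε, ‖f w t‖ ≤ g t) :
    ∀ z ∈ U, Integrable (fun t => deriv (fun w => f w t) z) μ ∧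
      HasDerivAt (fun w => ∫ t, f w t ∂μ) (∫ t, deriv (fun w => f w t) z ∂μ) z := by
  intro z hz
  obtain ⟨ε₁, hε₁, g, hg, hfg⟩ := hb z hz
  obtain ⟨ε₂, hε₂, hball⟩ := Metric.isOpen_iff.1 hU z hz
  set ε := min ε₁ ε₂ with hε
  have hεpos : 0 < ε := lt_min hε₁ hε₂
  have hsubU : Metric.ball z ε ⊆ U := (Metric.ball_subset_ball (min_le_right _ _)).trans hball
  have hsub : ∀ w ∈ Metric.ball z (ε / 4), Metric.closedBall w (ε / 4) ⊆ Metric.ball z ε := by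
    intro w hw
    apply Metric.closedBall_subset_ball'
    have := Metric.mem_ball.1 hw
    linarith
  have hdiff : ∀ᵐ t ∂μ, ∀ w ∈ Metric.ball z (ε / 4),
      HasDerivAt (fun z => f z t) (deriv (fun z => f z t) w) w := by
    filter_upwards [hd] with t ht w hw
    exact (ht.differentiableAt (hU.mem_nhds (hsubU (hsub w hw
      (Metric.mem_closedBall_self (by positivity)))))).hasDerivAt
  have hzm : z ∈ Metric.ball z (ε / 4) := Metric.mem_ball_self (by positivity)
  have hmeas' : AEStronglyMeasurable (fun t => deriv (fun z => f z t) z) μ := by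
    -- the derivative is the limit of the difference quotients with steps
    -- `(ε / 4) / (n + 2)`
    set u : ℕ → ℂ := fun n => (((ε / 4) / (n + 2) : ℝ) : ℂ) with hu
    have hu0 : Tendsto u atTop (𝓝 0) := by
      have h1 : Tendsto (fun n : ℕ => (ε / 4) / ((n : ℝ) + 2)) atTop (𝓝 0) :=
        tendsto_const_nhds.div_atTop
          (tendsto_atTop_add_const_right _ _ tendsto_natCast_atTop_atTop)
      have h2 := (Complex.continuous_ofReal.tendsto 0).comp h1
      rwa [Complex.ofReal_zero] at h2
    have hune : ∀ n, u n ≠ 0 := by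
      intro n
      have : (0 : ℝ) < (ε / 4) / (n + 2) := by positivity
      exact Complex.ofReal_ne_zero.2 this.ne'
    have hmem : ∀ n, z + u n ∈ U := by
      intro n
      apply hsubU
      rw [Metric.mem_ball, dist_eq_norm, add_sub_cancel_left]
      have h2 : (0 : ℝ) < (ε / 4) / (n + 2) := by positivity
      rw [hu, Complex.norm_real, Real.norm_of_nonneg h2.le]
      have : (ε / 4) / ((n : ℝ) + 2) ≤ ε / 4 := div_le_self (by positivity) (by linarith [n.cast_nonneg (α := ℝ)])
      linarith
    refine aestronglyMeasurable_of_tendsto_ae atTop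
      (f := fun n t => (u n)⁻¹ • (f (z + u n) t - f z t)) (fun n => ?_) ?_
    · exact AEStronglyMeasurable.const_smul ((hm _ (hmem n)).sub (hm z hz)) (u n)⁻¹
    · filter_upwards [hdiff] with t ht
      have := (ht z hzm).tendsto_slope_zero
      refine this.comp (tendsto_nhdsWithin_iff.2 ⟨hu0, Eventually.of_forall fun n => ?_⟩)
      exact hune n
  exact hasDerivAt_integral_of_dominated_loc_of_deriv_le (μ := μ) (F := f) (x₀ := z)
    (s := Metric.ball z (ε / 4)) (F' := fun w t => deriv (fun z => f z t) w)
    (bound := fun t => g t / (ε / 4)) (Metric.ball_mem_nhds z (by positivity))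
    (by
      filter_upwards [hU.mem_nhds hz] with w hw using hm w hw)
    (by
      refine hg.mono' (hm z hz) ?_
      filter_upwards [hfg] with t ht
      exact ht z (Metric.mem_ball_self hε₁))
    hmeas'
    (by
      filter_upwards [hfg, hd] with t ht htd w hw
      refine norm_deriv_le_of_forall_mem_sphere_norm_le (by positivity) ?_ ?_
      · refine (htd.mono ?_).diffContOnCl
        rw [closure_ball _ (by positivity)]
        exact (hsub w hw).trans hsubU
      · intro v hv
        exact ht v (Metric.ball_subset_ball (min_le_left _ _)
          (hsub w hw (Metric.sphere_subset_closedBall hv))))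
    (hg.div_const _) hdiff

/-- An integral depending holomorphically on a parameter, with a locally uniform integrable
majorant, is holomorphic. -/
theorem differentiableOn_integral_of_dominated {α : Type*} [MeasurableSpace α] {μ : Measure α}
    {U : Set ℂ} (hU : IsOpen U) {f : ℂ → α → ℂ}
    (hm : ∀ z ∈ U, AEStronglyMeasurable (f z) μ)
    (hd : ∀ᵐ t ∂μ, DifferentiableOn ℂ (fun z => f z t) U)
    (hb : ∀ z ∈ U, ∃ ε > 0, ∃ g : α → ℝ, Integrable g μ ∧
      ∀ᵐ t ∂μ, ∀ w ∈ Metric.ball z ε, ‖f w t‖ ≤ g t) :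
    DifferentiableOn ℂ (fun z => ∫ t, f z t ∂μ) U := fun z hz =>
  (hasDerivAt_integral_of_dominated_holomorphic hU hm hd hb z
    hz).2.differentiableAt.differentiableWithinAt

/-! ### The Bessel power series and the reciprocal gamma integral -/

/-- The reciprocals `1 / Γ(ν + k + 1)` are bounded, uniformly in `k` and locally uniformly
in `ν`. -/
theorem exists_bound_inv_Gamma (ν₀ : ℂ) :
    ∃ M : ℝ, 0 ≤ M ∧ ∀ ν ∈ Metric.closedBall ν₀ 1, ∀ k : ℕ, ‖(Gamma (ν + k + 1))⁻¹‖ ≤ M := by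
  obtain ⟨K, hK⟩ := exists_nat_gt (‖ν₀‖ + 1)
  have hcont : ∀ k : ℕ, ∃ M : ℝ, ∀ ν ∈ Metric.closedBall ν₀ 1,
      ‖(Gamma (ν + k + 1))⁻¹‖ ≤ M := by
    intro k
    refine (isCompact_closedBall ν₀ 1).exists_bound_of_continuousOn (Continuous.continuousOn ?_)
    exact Complex.differentiable_one_div_Gamma.continuous.comp (by fun_prop)
  choose M hM using hcont
  have hM0 : ∀ k, 0 ≤ M k := fun k =>
    (norm_nonneg _).trans (hM k ν₀ (Metric.mem_closedBall_self zero_le_one))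
  refine ⟨∑ k ∈ Finset.range (K + 1), M k, Finset.sum_nonneg fun k _ => hM0 k,
    fun ν hν k => ?_⟩
  have hsmall : ∀ k ≤ K, ‖(Gamma (ν + k + 1))⁻¹‖ ≤ ∑ k ∈ Finset.range (K + 1), M k :=
    fun k hk => (hM k ν hν).trans (Finset.single_le_sum (f := M) (fun i _ => hM0 i)
      (Finset.mem_range.2 (Nat.lt_succ_of_le hk)))
  rcases le_total k K with hk | hk
  · exact hsmall k hk
  · induction k, hk using Nat.le_induction with
    | base => exact hsmall K le_rfl
    | succ k hk ih =>
      have hre : 1 ≤ (ν + k + 1).re := by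
        have h1 : ‖ν‖ ≤ ‖ν₀‖ + 1 := by
          have := Metric.mem_closedBall.1 hν
          rw [dist_eq_norm] at this
          linarith [norm_sub_norm_le ν ν₀]
        have h2 := neg_le_of_abs_le (Complex.abs_re_le_norm ν)
        have h3 : (K : ℝ) ≤ k := by exact_mod_cast hk
        simp only [add_re, natCast_re, one_re]
        linarith
      have hne : ν + k + 1 ≠ 0 := by
        intro h
        rw [h] at hre
        norm_num at hre
      have hnorm : 1 ≤ ‖ν + k + 1‖ := hre.trans (Complex.re_le_norm _)
      have : Gamma (ν + (k + 1 : ℕ) + 1) = (ν + k + 1) * Gamma (ν + k + 1) := by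
        rw [← Complex.Gamma_add_one _ hne]
        push_cast
        ring_nf
      rw [this, mul_inv, norm_mul, norm_inv]
      calc ‖ν + k + 1‖⁻¹ * ‖(Gamma (ν + k + 1))⁻¹‖ ≤ 1 * ‖(Gamma (ν + k + 1))⁻¹‖ := by
            gcongr
            exact inv_le_one_of_one_le₀ hnorm
        _ ≤ _ := by rw [one_mul]; exact ih

/-- The entire function `∑ xᵏ / (k! Γ(ν + k + 1))`, through which `I_ν` and `J_ν` are expressed. -/
noncomputable def besselSeries (ν x : ℂ) : ℂ :=
  ∑' k : ℕ, x ^ k / ((k.factorial : ℂ) * Gamma (ν + k + 1))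

theorem besselI_eq (ν ζ : ℂ) :
    besselI ν ζ = exp (ν * (ζ - Real.log 2)) * besselSeries ν (exp ζ ^ 2 / 4) := rfl

theorem besselJ_eq (ν ζ : ℂ) :
    besselJ ν ζ = exp (ν * (ζ - Real.log 2)) * besselSeries ν (-(exp ζ ^ 2 / 4)) := rfl

theorem norm_besselSeries_term_le {ν x : ℂ} {M R : ℝ} (k : ℕ)
    (hM : ‖(Gamma (ν + k + 1))⁻¹‖ ≤ M) (hx : ‖x‖ ≤ R) :
    ‖x ^ k / ((k.factorial : ℂ) * Gamma (ν + k + 1))‖ ≤ M * (R ^ k / k.factorial) := by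
  have hM0 : 0 ≤ M := (norm_nonneg _).trans hM
  have hR0 : 0 ≤ R := (norm_nonneg _).trans hx
  rw [div_eq_mul_inv, mul_inv, norm_mul, norm_mul, norm_pow, norm_inv, norm_natCast]
  calc ‖x‖ ^ k * ((k.factorial : ℝ)⁻¹ * ‖(Gamma (ν + k + 1))⁻¹‖)
      ≤ R ^ k * ((k.factorial : ℝ)⁻¹ * M) := by gcongr
    _ = _ := by ring

theorem differentiable_besselSeries_order (x : ℂ) :
    Differentiable ℂ fun ν => besselSeries ν x := by
  intro ν₀
  obtain ⟨M, hM0, hM⟩ := exists_bound_inv_Gamma ν₀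
  have := differentiableOn_tsum_of_summable_norm (U := Metric.ball ν₀ 1)
    (F := fun (k : ℕ) (ν : ℂ) => x ^ k / ((k.factorial : ℂ) * Gamma (ν + k + 1)))
    ((Real.summable_pow_div_factorial ‖x‖).mul_left M) (fun k => ?_) Metric.isOpen_ball
    (fun k ν hν => norm_besselSeries_term_le k (hM ν (Metric.ball_subset_closedBall hν) k) le_rfl)
  · exact this.differentiableAt (Metric.ball_mem_nhds ν₀ one_pos)
  · have h1 : Differentiable ℂ fun ν : ℂ => (Gamma (ν + k + 1))⁻¹ :=
      Complex.differentiable_one_div_Gamma.comp (by fun_prop)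
    have h2 : (fun ν : ℂ => x ^ k / ((k.factorial : ℂ) * Gamma (ν + k + 1))) =
        fun ν : ℂ => x ^ k * (k.factorial : ℂ)⁻¹ * (Gamma (ν + k + 1))⁻¹ := by
      ext ν
      rw [div_eq_mul_inv, mul_inv, mul_assoc]
    rw [h2]
    exact (h1.const_mul _).differentiableOn

theorem hasDerivAt_besselSeries (ν x : ℂ) :
    HasDerivAt (besselSeries ν) (besselSeries (ν + 1) x) x := by
  obtain ⟨M, hM0, hM⟩ := exists_bound_inv_Gamma ν
  have hM := hM ν (Metric.mem_closedBall_self zero_le_one)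
  set F : ℕ → ℂ → ℂ := fun k x => x ^ k / ((k.factorial : ℂ) * Gamma (ν + k + 1)) with hF
  have hsum := (Real.summable_pow_div_factorial (‖x‖ + 1)).mul_left M
  have hd : ∀ k, DifferentiableOn ℂ (F k) (Metric.ball x 1) := fun k =>
    (Differentiable.div_const (by fun_prop) _).differentiableOn
  have hle : ∀ (k : ℕ), ∀ w ∈ Metric.ball x 1, ‖F k w‖ ≤ M * ((‖x‖ + 1) ^ k / k.factorial) := by
    intro k w hw
    refine norm_besselSeries_term_le k (hM k) ?_
    have := Metric.mem_ball.1 hw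
    rw [dist_eq_norm] at this
    linarith [norm_sub_norm_le w x]
  have hx : x ∈ Metric.ball x 1 := Metric.mem_ball_self one_pos
  have h1 := (differentiableOn_tsum_of_summable_norm hsum hd Metric.isOpen_ball hle).differentiableAt
    (Metric.ball_mem_nhds x one_pos)
  have h2 := hasSum_deriv_of_summable_norm hsum hd Metric.isOpen_ball hle hx
  have h3 : deriv (fun w => ∑' k, F k w) x = besselSeries (ν + 1) x := by
    rw [← h2.tsum_eq, h2.summable.tsum_eq_zero_add]
    have h0 : deriv (F 0) x = 0 := by
      simp [hF]
    rw [h0, zero_add]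
    refine tsum_congr fun k => ?_
    simp only [hF]
    rw [deriv_div_const, deriv_pow_field]
    have hk : ((k + 1 : ℕ) : ℂ) ≠ 0 := by exact_mod_cast k.succ_ne_zero
    rw [Nat.factorial_succ, Nat.cast_mul, mul_assoc, mul_div_mul_left _ _ hk]
    push_cast
    rw [add_right_comm ν 1 (k : ℂ), ← add_assoc]
  rw [← h3]
  exact h1.hasDerivAt

/-- The three-term recurrence; with `hasDerivAt_besselSeries` it says that
`x^ν besselSeries ν x` has derivative `x^(ν-1) besselSeries (ν-1) x`. -/
theorem besselSeries_sub_one (ν x : ℂ) :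
    besselSeries (ν - 1) x = ν * besselSeries ν x + x * besselSeries (ν + 1) x := by
  obtain ⟨M, hM0, hM⟩ := exists_bound_inv_Gamma ν
  have hM := hM ν (Metric.mem_closedBall_self zero_le_one)
  obtain ⟨M', hM0', hM'⟩ := exists_bound_inv_Gamma (ν + 1)
  have hM' := hM' (ν + 1) (Metric.mem_closedBall_self zero_le_one)
  have hs : Summable fun k : ℕ => x ^ k / ((k.factorial : ℂ) * Gamma (ν + k + 1)) :=
    Summable.of_norm_bounded ((Real.summable_pow_div_factorial ‖x‖).mul_left M)
      fun k => norm_besselSeries_term_le k (hM k) le_rfl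
  have hs' : Summable fun k : ℕ => x ^ k / ((k.factorial : ℂ) * Gamma (ν + 1 + k + 1)) :=
    Summable.of_norm_bounded ((Real.summable_pow_div_factorial ‖x‖).mul_left M')
      fun k => norm_besselSeries_term_le k (hM' k) le_rfl
  set G : ℕ → ℂ := fun k => k * (x ^ k / ((k.factorial : ℂ) * Gamma (ν + k + 1))) with hG
  have hGs : ∀ k, G (k + 1) = x * (x ^ k / ((k.factorial : ℂ) * Gamma (ν + 1 + k + 1))) := by
    intro k
    simp only [hG]
    have hk : ((k + 1 : ℕ) : ℂ) ≠ 0 := by exact_mod_cast k.succ_ne_zero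
    have : ν + ((k + 1 : ℕ) : ℂ) + 1 = ν + 1 + k + 1 := by push_cast; ring
    rw [this, Nat.factorial_succ, Nat.cast_mul, mul_assoc, mul_div_assoc', mul_div_mul_left _ _ hk,
      pow_succ]
    ring
  have hGsum : Summable G := by
    rw [← summable_nat_add_iff 1]
    simp only [hGs]
    exact hs'.mul_left x
  have h2 : x * besselSeries (ν + 1) x = ∑' k, G k := by
    rw [hGsum.tsum_eq_zero_add, besselSeries, ← tsum_mul_left]
    simp only [hGs]
    simp [hG]
  rw [h2, besselSeries, besselSeries, ← tsum_mul_left, ← (hs.mul_left ν).tsum_add hGsum]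
  refine tsum_congr fun k => ?_
  have hg := Complex.one_div_Gamma_eq_self_mul_one_div_Gamma_add_one (ν + k)
  have e : ν - 1 + k + 1 = ν + k := by ring
  rw [e, div_eq_mul_inv, mul_inv, hg]
  simp only [hG]
  rw [div_eq_mul_inv, mul_inv]
  ring

/-- The Laplace-type integral `f_ν(x) = ∫ t^(ν-1) e^(-t-x/t) dt` over the positive half-line; up to
a power of `x` it is `K_ν(2√x)`. -/
noncomputable def gammaRecip (ν x : ℝ) : ℝ :=
  ∫ t in Ioi (0 : ℝ), t ^ (ν - 1) * Real.exp (-(t + x / t))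

theorem integrableOn_gammaRecip {ν x : ℝ} (hν : 0 < ν) (hx : 0 ≤ x) :
    IntegrableOn (fun t : ℝ => t ^ (ν - 1) * Real.exp (-(t + x / t))) (Ioi 0) := by
  refine (integrableOn_rpow_mul_exp_neg_mul hν one_pos).mono' (by fun_prop) ?_
  filter_upwards [ae_restrict_mem measurableSet_Ioi] with t ht
  have ht : 0 < t := ht
  rw [Real.norm_of_nonneg (by positivity)]
  gcongr
  have : 0 ≤ x / t := by positivity
  linarith

theorem gammaRecip_nonneg (ν x : ℝ) : 0 ≤ gammaRecip ν x :=
  setIntegral_nonneg measurableSet_Ioi fun t ht => by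
    have ht : 0 < t := ht
    positivity

theorem gammaRecip_le {ν x : ℝ} (hν : 0 < ν) (hx : 0 ≤ x) : gammaRecip ν x ≤ Real.Gamma ν := by
  rw [Real.Gamma_eq_integral hν]
  refine setIntegral_mono_on (integrableOn_gammaRecip hν hx) (Real.GammaIntegral_convergent hν)
    measurableSet_Ioi fun t ht => ?_
  have ht : 0 < t := ht
  rw [mul_comm]
  gcongr
  have : 0 ≤ x / t := by positivity
  linarith

theorem gammaRecip_integrand_const_div {ν y t : ℝ} (hy : 0 < y) (ht : 0 < t) :
    y ^ (ν - 1) * (y / t ^ 2 * ((y / t) ^ (1 - ν - 1) * Real.exp (-(y / t + y / (y / t))))) =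
      t ^ (ν - 2) * Real.exp (-(t + y / t)) := by
  have h1 : y / (y / t) = t := by field_simp
  rw [h1, Real.div_rpow hy.le ht.le]
  have h2 : y ^ (ν - 1) * y * y ^ (1 - ν - 1) = 1 := by
    nth_rw 2 [← Real.rpow_one y]
    rw [← Real.rpow_add hy, ← Real.rpow_add hy]
    ring_nf
    exact Real.rpow_zero y
  have h3 : t ^ (ν - 2) * (t ^ 2 * t ^ (1 - ν - 1)) = 1 := by
    rw [← Real.rpow_natCast t 2, ← Real.rpow_add ht, ← Real.rpow_add ht]
    push_cast
    ring_nf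
    exact Real.rpow_zero t
  rw [add_comm (y / t) t]
  calc y ^ (ν - 1) * (y / t ^ 2 * (y ^ (1 - ν - 1) / t ^ (1 - ν - 1) * Real.exp (-(t + y / t))))
      = (y ^ (ν - 1) * y * y ^ (1 - ν - 1)) / (t ^ 2 * t ^ (1 - ν - 1)) *
          Real.exp (-(t + y / t)) := by ring
    _ = _ := by
      rw [h2, ← eq_one_div_of_mul_eq_one_left h3]

theorem rpow_mul_gammaRecip {ν y : ℝ} (hy : 0 < y) :
    y ^ (ν - 1) * gammaRecip (1 - ν) y =
      ∫ t in Ioi (0 : ℝ), t ^ (ν - 2) * Real.exp (-(t + y / t)) := by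
  rw [gammaRecip, ← integral_comp_const_div_Ioi _ hy, ← integral_const_mul]
  exact setIntegral_congr_fun measurableSet_Ioi fun t ht => gammaRecip_integrand_const_div hy ht

/-- The integral equation `f_ν(x) = Γ(ν) - ∫₀ˣ y^(ν-1) f_(1-ν)(y) dy`. -/
theorem gammaRecip_volterra {ν x : ℝ} (hν : 0 < ν) (hν1 : ν < 1) (hx : 0 < x) :
    IntegrableOn (fun y => y ^ (ν - 1) * gammaRecip (1 - ν) y) (Ioc 0 x) ∧
    gammaRecip ν x =
      Real.Gamma ν - ∫ y in Ioc 0 x, y ^ (ν - 1) * gammaRecip (1 - ν) y := by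
  have hinner : ∀ t > 0, ∫ y in Ioc 0 x, t ^ (ν - 2) * Real.exp (-(t + y / t)) =
      t ^ (ν - 1) * Real.exp (-t) - t ^ (ν - 1) * Real.exp (-(t + x / t)) := by
    intro t ht
    rw [← intervalIntegral.integral_of_le hx.le]
    have hd : ∀ y ∈ uIcc 0 x, HasDerivAt (fun y => -(t ^ (ν - 1) * Real.exp (-(t + y / t))))
        (t ^ (ν - 2) * Real.exp (-(t + y / t))) y := by
      intro y _
      have h1 : HasDerivAt (fun y : ℝ => -(t + y / t)) (-(1 / t)) y :=
        (((hasDerivAt_id y).div_const t).const_add t).neg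
      have h2 := ((h1.exp).const_mul (t ^ (ν - 1))).neg
      convert! h2 using 1
      have : t ^ (ν - 1) = t ^ (ν - 2) * t := by
        nth_rw 3 [← Real.rpow_one t]
        rw [← Real.rpow_add ht]
        ring_nf
      rw [this]
      field_simp
    rw [intervalIntegral.integral_eq_sub_of_hasDerivAt hd
      (Continuous.intervalIntegrable (by fun_prop) _ _)]
    simp only [zero_div, add_zero]
    ring
  have hint : IntegrableOn (fun t : ℝ => t ^ (ν - 1) * Real.exp (-t)) (Ioi 0) := by
    simpa using integrableOn_rpow_mul_exp_neg_mul hν one_pos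
  have hint2 := integrableOn_gammaRecip hν hx.le
  have hswap := integral_swap_of_nonneg (S := Ioc 0 x) (T := Ioi 0) measurableSet_Ioc
    measurableSet_Ioi (f := fun y t => t ^ (ν - 2) * Real.exp (-(t + y / t))) (by fun_prop)
    (fun y _ t ht => by have ht : 0 < t := ht; positivity)
    (fun y hy => by
      have h1 := integrableOn_comp_const_div_Ioi hy.1
        (integrableOn_gammaRecip (ν := 1 - ν) (by linarith) hy.1.le)
      exact IntegrableOn.congr_fun (h1.const_mul (y ^ (ν - 1)))
        (fun t ht => gammaRecip_integrand_const_div hy.1 ht) measurableSet_Ioi)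
    (fun t ht => (Continuous.integrableOn_Ioc (by fun_prop)))
  have hI : IntegrableOn (fun t => ∫ y in Ioc 0 x, t ^ (ν - 2) * Real.exp (-(t + y / t)))
      (Ioi 0) :=
    IntegrableOn.congr_fun (hint.sub hint2) (fun t ht => (hinner t ht).symm) measurableSet_Ioi
  have hcongr : ∀ y ∈ Ioc 0 x, ∫ t in Ioi (0 : ℝ), t ^ (ν - 2) * Real.exp (-(t + y / t)) =
      y ^ (ν - 1) * gammaRecip (1 - ν) y := fun y hy => (rpow_mul_gammaRecip hy.1).symm
  refine ⟨(hswap.2.2 hI).congr_fun hcongr measurableSet_Ioc, ?_⟩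
  rw [← setIntegral_congr_fun measurableSet_Ioc hcongr, hswap.1,
    setIntegral_congr_fun measurableSet_Ioi hinner, integral_sub hint hint2,
    Real.Gamma_eq_integral hν, gammaRecip]
  simp only [mul_comm (Real.exp _)]
  ring

/-! ### The integral representation of `K_ν` near the origin -/

/-- The power series expression for `K_ν`, in the normalization of `gammaRecip`. -/
noncomputable def besselRecip (ν x : ℝ) : ℂ :=
  Real.pi / sin (Real.pi * ν) *
    (besselSeries (-ν) x - ((x ^ ν : ℝ) : ℂ) * besselSeries ν x)

theorem continuous_besselSeries (ν : ℂ) : Continuous (besselSeries ν) :=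
  continuous_iff_continuousAt.2 fun x => (hasDerivAt_besselSeries ν x).continuousAt

theorem besselSeries_zero (ν : ℂ) : besselSeries ν 0 = (Gamma (ν + 1))⁻¹ := by
  rw [besselSeries, tsum_eq_single 0]
  · simp
  · intro k hk
    simp [hk]

theorem continuous_besselRecip {ν : ℝ} (hν : 0 < ν) : Continuous (besselRecip ν) := by
  have h1 : Continuous fun x : ℝ => x ^ ν := Real.continuous_rpow_const hν.le
  have h2 := continuous_besselSeries (-ν : ℂ)
  have h3 := continuous_besselSeries (ν : ℂ)
  unfold besselRecip
  fun_prop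

theorem hasDerivAt_besselRecip {ν y : ℝ} (hy : 0 < y) :
    HasDerivAt (besselRecip ν) (-(((y ^ (ν - 1) : ℝ) : ℂ) * besselRecip (1 - ν) y)) y := by
  have h1 := (hasDerivAt_besselSeries (-ν) y).comp_ofReal
  have h2 := (hasDerivAt_besselSeries ν y).comp_ofReal
  have h3 : HasDerivAt (fun y : ℝ => ((y ^ ν : ℝ) : ℂ)) ((ν * y ^ (ν - 1) : ℝ) : ℂ) y :=
    (Real.hasDerivAt_rpow_const (Or.inl hy.ne')).ofReal_comp
  have h4 := (h1.sub (h3.mul h2)).const_mul (Real.pi / sin (Real.pi * ν) : ℂ)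
  have e1 : (y ^ ν : ℝ) = y ^ (ν - 1) * y := by
    nth_rw 3 [← Real.rpow_one y]
    rw [← Real.rpow_add hy, sub_add_cancel]
  have e2 : y ^ (ν - 1) * y ^ (1 - ν) = 1 := by
    rw [← Real.rpow_add hy]
    ring_nf
    exact Real.rpow_zero y
  have e2' : ((y ^ (ν - 1) : ℝ) : ℂ) * ((y ^ (1 - ν) : ℝ) : ℂ) = 1 := by exact_mod_cast e2
  have e3 : sin (Real.pi * ((1 - ν : ℝ) : ℂ)) = sin (Real.pi * ν) := by
    push_cast
    rw [mul_sub, mul_one, Complex.sin_pi_sub]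
  have e4 := besselSeries_sub_one (ν : ℂ) y
  convert! h4 using 1
  rw [besselRecip, e3, e1]
  push_cast
  rw [show (-(1 - ν) : ℂ) = ν - 1 by ring, show (1 - ν : ℂ) = -ν + 1 by ring, e4]
  linear_combination (Real.pi / sin (Real.pi * ν) : ℂ) * besselSeries (-ν + 1) y * e2'

theorem besselRecip_zero {ν : ℝ} (hν : 0 < ν) (hν1 : ν < 1) :
    besselRecip ν 0 = (Real.Gamma ν : ℂ) := by
  have h1 := Complex.Gamma_mul_Gamma_one_sub (ν : ℂ)
  have h2 : Gamma (1 - ν : ℂ) ≠ 0 := Complex.Gamma_ne_zero_of_re_pos (by simpa using hν1)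
  rw [besselRecip, Real.zero_rpow hν.ne', ofReal_zero, zero_mul, sub_zero, besselSeries_zero,
    ← h1, show (-ν + 1 : ℂ) = 1 - ν by ring, mul_inv_cancel_right₀ h2, Complex.Gamma_ofReal]

/-- The power series satisfy the same integral equation as `gammaRecip`. -/
theorem besselRecip_volterra {ν x : ℝ} (hν : 0 < ν) (hν1 : ν < 1) (hx : 0 < x) :
    IntegrableOn (fun y : ℝ => ((y ^ (ν - 1) : ℝ) : ℂ) * besselRecip (1 - ν) y) (Ioc 0 x) ∧
    besselRecip ν x =
      Real.Gamma ν - ∫ y in Ioc 0 x, ((y ^ (ν - 1) : ℝ) : ℂ) * besselRecip (1 - ν) y := by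
  have hint : IntervalIntegrable (fun y : ℝ => ((y ^ (ν - 1) : ℝ) : ℂ) * besselRecip (1 - ν) y)
      volume 0 x := by
    have h1 : IntervalIntegrable (fun y : ℝ => y ^ (ν - 1)) volume 0 x :=
      intervalIntegral.intervalIntegrable_rpow' (by linarith)
    have h2 : IntervalIntegrable (fun y : ℝ => ((y ^ (ν - 1) : ℝ) : ℂ)) volume 0 x :=
      ⟨h1.1.ofReal, h1.2.ofReal⟩
    exact h2.mul_continuousOn (continuous_besselRecip (by linarith)).continuousOn
  refine ⟨(intervalIntegrable_iff_integrableOn_Ioc_of_le hx.le).1 hint, ?_⟩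
  rw [← intervalIntegral.integral_of_le hx.le]
  have h := intervalIntegral.integral_eq_sub_of_hasDerivAt_of_le hx.le
    (continuous_besselRecip hν).continuousOn (fun y hy => hasDerivAt_besselRecip hy.1) hint.neg
  rw [intervalIntegral.integral_neg, besselRecip_zero hν hν1] at h
  linear_combination -h

/-- For small argument the integral and the power series agree: their difference solves a
homogeneous Volterra system whose kernel has small mass near `0`, so every bound for it can be
halved. -/
theorem exists_gammaRecip_eq_besselRecip {ν : ℝ} (hν : 0 < ν) (hν1 : ν < 1) :
    ∃ δ > 0, ∀ x ∈ Ioc 0 δ, (gammaRecip ν x : ℂ) = besselRecip ν x := by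
  set d : ℝ → ℝ → ℂ := fun ν x => (gammaRecip ν x : ℂ) - besselRecip ν x with hd
  have hstep : ∀ {ν : ℝ}, 0 < ν → ν < 1 → ∀ {x : ℝ}, 0 < x → ∀ {B : ℝ},
      (∀ y ∈ Ioc 0 x, ‖d (1 - ν) y‖ ≤ B) → ‖d ν x‖ ≤ B * (x ^ ν / ν) := by
    intro ν hν hν1 x hx B hB
    obtain ⟨i1, e1⟩ := gammaRecip_volterra hν hν1 hx
    obtain ⟨i2, e2⟩ := besselRecip_volterra hν hν1 hx
    have e3 : d ν x = -∫ y in Ioc 0 x, ((y ^ (ν - 1) : ℝ) : ℂ) * d (1 - ν) y := by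
      have i1' : IntegrableOn (fun y : ℝ => ((y ^ (ν - 1) : ℝ) : ℂ) * (gammaRecip (1 - ν) y : ℂ))
          (Ioc 0 x) := by
        have := i1.ofReal (𝕜 := ℂ)
        simpa [IntegrableOn] using this
      simp only [hd, mul_sub]
      rw [integral_sub i1' i2, e2, e1]
      push_cast
      rw [← integral_complex_ofReal]
      push_cast
      ring
    rw [e3, norm_neg]
    have hg : IntegrableOn (fun y : ℝ => B * y ^ (ν - 1)) (Ioc 0 x) :=
      ((intervalIntegrable_iff_integrableOn_Ioc_of_le hx.le).1
        (intervalIntegral.intervalIntegrable_rpow' (by linarith))).const_mul B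
    refine (norm_integral_le_of_norm_le hg ?_).trans (le_of_eq ?_)
    · filter_upwards [ae_restrict_mem measurableSet_Ioc] with y hy
      rw [norm_mul, Complex.norm_real, Real.norm_of_nonneg (Real.rpow_nonneg hy.1.le _), mul_comm]
      exact mul_le_mul_of_nonneg_right (hB y hy) (Real.rpow_nonneg hy.1.le _)
    · rw [integral_const_mul, ← intervalIntegral.integral_of_le hx.le,
        integral_rpow (Or.inl (by linarith)), sub_add_cancel, Real.zero_rpow hν.ne', sub_zero]
  -- a length on which the kernels have mass at most one half
  obtain ⟨δ, hδ, hδ1, hδν, hδν'⟩ : ∃ δ > 0, δ ≤ 1 ∧ (∀ x ∈ Ioc 0 δ, x ^ ν / ν ≤ 1 / 2) ∧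
      ∀ x ∈ Ioc 0 δ, x ^ (1 - ν) / (1 - ν) ≤ 1 / 2 := by
    have key : ∀ μ : ℝ, 0 < μ → ∀ᶠ x in 𝓝[>] (0 : ℝ), x ^ μ / μ < 1 / 2 := by
      intro μ hμ
      have : Tendsto (fun x : ℝ => x ^ μ / μ) (𝓝[>] 0) (𝓝 (0 ^ μ / μ)) :=
        (((Real.continuous_rpow_const hμ.le).div_const μ).tendsto 0).mono_left nhdsWithin_le_nhds
      rw [Real.zero_rpow hμ.ne', zero_div] at this
      exact this.eventually_lt_const (by norm_num)
    have h1 := (key ν hν).and ((key (1 - ν) (by linarith)).and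
      (mem_nhdsWithin_of_mem_nhds (Iio_mem_nhds (zero_lt_one' ℝ))))
    obtain ⟨u, hu, hu'⟩ := mem_nhdsGT_iff_exists_Ioc_subset.1 h1
    refine ⟨u, hu, le_of_lt (hu' ⟨hu, le_rfl⟩).2.2, fun x hx => (hu' hx).1.le,
      fun x hx => (hu' hx).2.1.le⟩
  obtain ⟨B, hB⟩ : ∃ B : ℝ, ∀ x ∈ Ioc 0 δ, ‖d ν x‖ ≤ B ∧ ‖d (1 - ν) x‖ ≤ B := by
    have hb : ∀ μ : ℝ, 0 < μ → ∃ B : ℝ, ∀ x ∈ Ioc 0 δ, ‖d μ x‖ ≤ B := by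
      intro μ hμ
      obtain ⟨C, hC⟩ := (isCompact_Icc (a := (0 : ℝ)) (b := δ)).exists_bound_of_continuousOn
        (continuous_besselRecip hμ).continuousOn
      refine ⟨Real.Gamma μ + C, fun x hx => (norm_sub_le _ _).trans
        (add_le_add ?_ (hC x ⟨hx.1.le, hx.2⟩))⟩
      rw [Complex.norm_real, Real.norm_of_nonneg (gammaRecip_nonneg μ x)]
      exact gammaRecip_le hμ hx.1.le
    obtain ⟨B1, h1⟩ := hb ν hν
    obtain ⟨B2, h2⟩ := hb (1 - ν) (by linarith)
    exact ⟨max B1 B2, fun x hx => ⟨(h1 x hx).trans (le_max_left _ _),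
      (h2 x hx).trans (le_max_right _ _)⟩⟩
  have hind : ∀ n : ℕ, ∀ x ∈ Ioc 0 δ, ‖d ν x‖ ≤ B * (1 / 2) ^ n ∧
      ‖d (1 - ν) x‖ ≤ B * (1 / 2) ^ n := by
    intro n
    induction n with
    | zero => simpa using hB
    | succ n ih =>
      intro x hx
      have hsub : ∀ y ∈ Ioc 0 x, y ∈ Ioc 0 δ := fun y hy => ⟨hy.1, hy.2.trans hx.2⟩
      have hBn : 0 ≤ B * (1 / 2) ^ n := (norm_nonneg _).trans (ih x hx).1
      rw [pow_succ, ← mul_assoc]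
      constructor
      · exact (hstep hν hν1 hx.1 fun y hy => (ih y (hsub y hy)).2).trans
          (mul_le_mul_of_nonneg_left (hδν x hx) hBn)
      · exact (hstep (ν := 1 - ν) (by linarith) (by linarith) hx.1 fun y hy => by
          rw [sub_sub_cancel]
          exact (ih y (hsub y hy)).1).trans (mul_le_mul_of_nonneg_left (hδν' x hx) hBn)
  refine ⟨δ, hδ, fun x hx => ?_⟩
  have hlim : Tendsto (fun n : ℕ => B * (1 / 2 : ℝ) ^ n) atTop (𝓝 (B * 0)) :=
    (tendsto_pow_atTop_nhds_zero_of_lt_one (by norm_num) (by norm_num)).const_mul B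
  rw [mul_zero] at hlim
  have : ‖d ν x‖ ≤ 0 := ge_of_tendsto' hlim fun n => (hind n x hx).1
  exact sub_eq_zero.1 (norm_le_zero_iff.1 this)

theorem integral_exp_neg_add_inv {ν z : ℝ} (hz : 0 < z) :
    ∫ x in Ioi (0 : ℝ), x ^ (ν - 1) * Real.exp (-(z / 2 * (x + 1 / x))) =
      (z / 2) ^ (-ν) * gammaRecip ν (z ^ 2 / 4) := by
  have hz2 : 0 < z / 2 := by positivity
  have h := integral_comp_mul_left_Ioi'
    (fun t : ℝ => t ^ (ν - 1) * Real.exp (-(t + z ^ 2 / 4 / t))) 0 hz2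
  rw [mul_zero] at h
  rw [gammaRecip, ← h, smul_eq_mul, ← integral_const_mul, ← integral_const_mul]
  refine setIntegral_congr_fun measurableSet_Ioi fun x hx => ?_
  have hx : 0 < x := hx
  have e1 : z / 2 * x + z ^ 2 / 4 / (z / 2 * x) = z / 2 * (x + 1 / x) := by
    field_simp
    ring
  have e2 : (z / 2) ^ (-ν) * (z / 2 * (z / 2) ^ (ν - 1)) = 1 := by
    nth_rw 2 [← Real.rpow_one (z / 2)]
    rw [← Real.rpow_add hz2, ← Real.rpow_add hz2]
    ring_nf
    exact Real.rpow_zero _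
  rw [e1, Real.mul_rpow hz2.le hx.le]
  linear_combination -(x ^ (ν - 1) * Real.exp (-(z / 2 * (x + 1 / x)))) * e2

/-- The integral representation of `K_ν(z)` for `0 < ν < 1` and small positive `z`. -/
theorem exists_besselKQuot_eq_integral {ν : ℝ} (hν : 0 < ν) (hν1 : ν < 1) :
    ∃ δ > 0, ∀ z ∈ Ioc 0 δ, besselKQuot ν (Real.log z) =
      ((∫ x in Ioi (0 : ℝ), x ^ (ν - 1) * Real.exp (-(z / 2 * (x + 1 / x))) : ℝ) : ℂ) / 2 := by
  obtain ⟨δ, hδ, h⟩ := exists_gammaRecip_eq_besselRecip hν hν1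
  refine ⟨min 1 δ, lt_min one_pos hδ, fun z hz => ?_⟩
  have hz0 : 0 < z := hz.1
  have hz1 : z ≤ 1 := hz.2.trans (min_le_left _ _)
  have hz2 : z ^ 2 / 4 ∈ Ioc 0 δ := by
    refine ⟨by positivity, ?_⟩
    have := hz.2.trans (min_le_right _ _)
    nlinarith
  have hzp : 0 < z / 2 := by positivity
  rw [integral_exp_neg_add_inv hz0]
  push_cast
  rw [h _ hz2, besselRecip, besselKQuot, besselI_eq, besselI_eq]
  have hexp : exp (Real.log z : ℂ) ^ 2 / 4 = ((z ^ 2 / 4 : ℝ) : ℂ) := by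
    rw [← Complex.ofReal_exp, Real.exp_log hz0]
    push_cast
    rfl
  have hpow : ∀ μ : ℝ, exp ((μ : ℂ) * ((Real.log z : ℂ) - Real.log 2)) =
      (((z / 2) ^ μ : ℝ) : ℂ) := by
    intro μ
    rw [Real.rpow_def_of_pos hzp, Real.log_div hz0.ne' two_ne_zero]
    push_cast
    rw [mul_comm]
  have hp1 := hpow ν
  have hp2 := hpow (-ν)
  have e1 : (z ^ 2 / 4) ^ ν = (z / 2) ^ ν * (z / 2) ^ ν := by
    rw [← Real.mul_rpow hzp.le hzp.le]
    ring_nf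
  have e2 : (z / 2) ^ (-ν) * (z / 2) ^ ν = 1 := by
    rw [← Real.rpow_add hzp, neg_add_cancel, Real.rpow_zero]
  have e2' : (((z / 2) ^ (-ν) : ℝ) : ℂ) * (((z / 2) ^ ν : ℝ) : ℂ) = 1 := by exact_mod_cast e2
  rw [hexp, e1, hp1]
  push_cast at hp2 ⊢
  rw [hp2]
  linear_combination ((Real.pi : ℂ) / 2 / sin (Real.pi * ν)) *
    (((z / 2) ^ ν : ℝ) : ℂ) * besselSeries ν (z ^ 2 / 4) * e2'

/-! ### The weight `κ` and its moments -/

/-- Euler's beta integral over the positive half-line. -/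
theorem integral_rpow_div_one_add_rpow {α β : ℝ} (hα : 0 < α) (hβ : 0 < β) :
    IntegrableOn (fun x : ℝ => x ^ (α - 1) / (1 + x) ^ (α + β)) (Ioi 0) ∧
    ∫ x in Ioi (0 : ℝ), x ^ (α - 1) / (1 + x) ^ (α + β) =
      Real.Gamma α * Real.Gamma β / Real.Gamma (α + β) := by
  have hαβ : 0 < α + β := by positivity
  have hG : Real.Gamma (α + β) ≠ 0 := (Real.Gamma_pos_of_pos hαβ).ne'
  set f : ℝ → ℝ → ℝ := fun x s => x ^ (α - 1) * (s ^ (α + β - 1) * Real.exp (-((1 + x) * s)))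
    with hf
  have h1 : ∀ x > 0, ∫ s in Ioi (0 : ℝ), f x s =
      Real.Gamma (α + β) * (x ^ (α - 1) / (1 + x) ^ (α + β)) := by
    intro x hx
    simp only [hf]
    rw [integral_const_mul, Real.integral_rpow_mul_exp_neg_mul_Ioi hαβ (by positivity),
      Real.div_rpow zero_le_one (by positivity), Real.one_rpow]
    ring
  have hf2 : ∀ s > 0, ∀ x, f x s =
      s ^ (α + β - 1) * Real.exp (-s) * (x ^ (α - 1) * Real.exp (-(s * x))) := by
    intro s _ x
    simp only [hf]
    rw [show -((1 + x) * s) = -s + -(s * x) by ring, Real.exp_add]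
    ring
  have h2 : ∀ s > 0, ∫ x in Ioi (0 : ℝ), f x s =
      Real.Gamma α * (s ^ (β - 1) * Real.exp (-(1 * s))) := by
    intro s hs
    simp only [hf2 s hs]
    rw [integral_const_mul, Real.integral_rpow_mul_exp_neg_mul_Ioi hα hs,
      Real.div_rpow zero_le_one hs.le, Real.one_rpow, one_mul]
    have : s ^ (α + β - 1) = s ^ α * s ^ (β - 1) := by
      rw [← Real.rpow_add hs]
      ring_nf
    rw [this]
    have : s ^ α ≠ 0 := (Real.rpow_pos_of_pos hs _).ne'
    field_simp
  have hswap := integral_swap_of_nonneg (S := Ioi 0) (T := Ioi 0) measurableSet_Ioi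
    measurableSet_Ioi (f := f) (by fun_prop)
    (fun x hx s hs => by
      have hx : 0 < x := hx
      have hs : 0 < s := hs
      simp only [hf]
      positivity)
    (fun x hx => (integrableOn_rpow_mul_exp_neg_mul hαβ
      (by have hx : 0 < x := hx; positivity)).const_mul _)
    (fun s hs => by
      simp only [hf2 s hs]
      exact (integrableOn_rpow_mul_exp_neg_mul hα hs).const_mul _)
  have hint : IntegrableOn (fun s => ∫ x in Ioi (0 : ℝ), f x s) (Ioi 0) :=
    IntegrableOn.congr_fun ((integrableOn_rpow_mul_exp_neg_mul hβ one_pos).const_mul _)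
      (fun s hs => (h2 s hs).symm) measurableSet_Ioi
  have hint' := IntegrableOn.congr_fun (hswap.2.2 hint) h1 measurableSet_Ioi
  refine ⟨?_, ?_⟩
  · have := hint'.const_mul (Real.Gamma (α + β))⁻¹
    exact IntegrableOn.congr_fun this (fun x _ => inv_mul_cancel_left₀ hG _) measurableSet_Ioi
  · have := hswap.1
    rw [setIntegral_congr_fun measurableSet_Ioi h1, setIntegral_congr_fun measurableSet_Ioi h2,
      integral_const_mul, integral_const_mul, Real.integral_rpow_mul_exp_neg_mul_Ioi hβ one_pos]
      at this
    simp only [div_one, Real.one_rpow, one_mul] at this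
    rw [← this]
    field_simp

/-- The Stieltjes transform of a power. -/
theorem integral_rpow_div_add {p c : ℝ} (hp : 0 < p) (hp1 : p < 1) (hc : 0 < c) :
    IntegrableOn (fun x : ℝ => x ^ (p - 1) / (x + c)) (Ioi 0) ∧
    ∫ x in Ioi (0 : ℝ), x ^ (p - 1) / (x + c) = c ^ (p - 1) * (Real.pi / Real.sin (Real.pi * p)) := by
  obtain ⟨h1, h2⟩ := integral_rpow_div_one_add_rpow hp (β := 1 - p) (by linarith)
  rw [add_sub_cancel, Real.Gamma_one, div_one, Real.Gamma_mul_Gamma_one_sub] at h2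
  rw [add_sub_cancel] at h1
  simp only [Real.rpow_one] at h1 h2
  have e : ∀ x ∈ Ioi (0 : ℝ), c ^ (p - 1) * (c⁻¹ * ((c⁻¹ * x) ^ (p - 1) / (1 + c⁻¹ * x))) =
      x ^ (p - 1) / (x + c) := by
    intro x hx
    have hx : 0 < x := hx
    rw [Real.mul_rpow (by positivity) hx.le, Real.inv_rpow hc.le]
    have : c ^ (p - 1) ≠ 0 := (Real.rpow_pos_of_pos hc _).ne'
    field_simp
    rw [add_comm]
  have hci : 0 < c⁻¹ := inv_pos.2 hc
  constructor
  · have h3 := (integrableOn_Ioi_comp_mul_left_iff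
      (fun x : ℝ => x ^ (p - 1) / (1 + x)) 0 hci).2 (by rwa [mul_zero])
    exact IntegrableOn.congr_fun ((h3.const_mul c⁻¹).const_mul (c ^ (p - 1))) e measurableSet_Ioi
  · have h3 := integral_comp_mul_left_Ioi' (fun x : ℝ => x ^ (p - 1) / (1 + x)) 0 hci
    rw [mul_zero, h2, smul_eq_mul, ← integral_const_mul] at h3
    rw [← h3, ← integral_const_mul]
    exact (setIntegral_congr_fun measurableSet_Ioi e).symm

/-- `∫ x^(ν-1) e^(-r (1+x)²/(2x)) dx` over the positive half-line, that is, `2 e^(-r) K_ν(r)`. -/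
noncomputable def besselKInt (ν r : ℝ) : ℝ :=
  ∫ x in Ioi (0 : ℝ), x ^ (ν - 1) * Real.exp (-(r * ((1 + x) ^ 2 / (2 * x))))

theorem integrableOn_besselKInt {ν r : ℝ} (hν : 0 < ν) (hr : 0 < r) :
    IntegrableOn (fun x : ℝ => x ^ (ν - 1) * Real.exp (-(r * ((1 + x) ^ 2 / (2 * x))))) (Ioi 0) := by
  refine (integrableOn_rpow_mul_exp_neg_mul hν (half_pos hr)).mono' (by fun_prop) ?_
  filter_upwards [ae_restrict_mem measurableSet_Ioi] with x hx
  have hx : 0 < x := hx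
  rw [Real.norm_of_nonneg (by positivity)]
  refine mul_le_mul_of_nonneg_left (Real.exp_le_exp.2 (neg_le_neg ?_)) (by positivity)
  have : x / 2 ≤ (1 + x) ^ 2 / (2 * x) := by
    rw [div_le_div_iff₀ two_pos (by positivity)]
    nlinarith
  calc r / 2 * x = r * (x / 2) := by ring
    _ ≤ _ := by gcongr

theorem measurable_besselKInt (ν : ℝ) : Measurable (besselKInt ν) := by
  have : StronglyMeasurable (Function.uncurry fun r x : ℝ =>
      x ^ (ν - 1) * Real.exp (-(r * ((1 + x) ^ 2 / (2 * x))))) :=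
    Measurable.stronglyMeasurable (by fun_prop)
  exact (this.integral_prod_right (ν := volume.restrict (Ioi 0))).measurable

theorem besselKInt_nonneg (ν r : ℝ) : 0 ≤ besselKInt ν r :=
  setIntegral_nonneg measurableSet_Ioi fun x hx => by
    have hx : 0 < x := hx
    positivity

/-- The weight `κ(r) = e^(-r) (2 / (π r))^(1/2) K_ν(r)`, normalized so that
`K_ν(z) = (π / (2 z))^(1/2) e^(-z) · z e^(2 z) κ(z)`. -/
noncomputable def besselWeight (ν r : ℝ) : ℝ :=
  (Real.sqrt (2 * Real.pi))⁻¹ * (r ^ (-(1 / 2) : ℝ) * besselKInt ν r)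

theorem measurable_besselWeight (ν : ℝ) : Measurable (besselWeight ν) := by
  have := measurable_besselKInt ν
  unfold besselWeight
  fun_prop

theorem besselWeight_nonneg (ν : ℝ) {r : ℝ} (hr : 0 < r) : 0 ≤ besselWeight ν r := by
  have := besselKInt_nonneg ν r
  unfold besselWeight
  positivity

/-- The moments of `besselKInt` against half-integral powers. -/
theorem integral_rpow_mul_besselKInt {ν : ℝ} (hν : 0 < ν) (hν2 : ν < 1 / 2) (n : ℕ) :
    IntegrableOn (fun r : ℝ => r ^ ((n : ℝ) + 1 / 2 - 1) * besselKInt ν r) (Ioi 0) ∧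
    ∫ r in Ioi (0 : ℝ), r ^ ((n : ℝ) + 1 / 2 - 1) * besselKInt ν r =
      Real.Gamma (n + 1 / 2) * 2 ^ ((n : ℝ) + 1 / 2) *
        (Real.Gamma (n + 1 / 2 + ν) * Real.Gamma (n + 1 / 2 - ν) / Real.Gamma (2 * n + 1)) := by
  obtain ⟨s, hs⟩ : ∃ s : ℝ, s = (n : ℝ) + 1 / 2 := ⟨_, rfl⟩
  rw [← hs]
  have hs0 : 0 < s := by rw [hs]; positivity
  have hs2 : 1 / 2 ≤ s := by
    have : (0 : ℝ) ≤ n := n.cast_nonneg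
    linarith
  set f : ℝ → ℝ → ℝ := fun r x =>
    r ^ (s - 1) * (x ^ (ν - 1) * Real.exp (-(r * ((1 + x) ^ 2 / (2 * x))))) with hf
  have hfeq : ∀ r x, f r x = x ^ (ν - 1) *
      (r ^ (s - 1) * Real.exp (-(((1 + x) ^ 2 / (2 * x)) * r))) := by
    intro r x
    simp only [hf]
    rw [mul_comm r]
    ring
  have h1 : ∀ r ∈ Ioi (0 : ℝ), ∫ x in Ioi (0 : ℝ), f r x = r ^ (s - 1) * besselKInt ν r := by
    intro r _
    simp only [hf]
    rw [integral_const_mul, besselKInt]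
  have h2 : ∀ x ∈ Ioi (0 : ℝ), ∫ r in Ioi (0 : ℝ), f r x = Real.Gamma s * 2 ^ s *
      (x ^ (s + ν - 1) / (1 + x) ^ (s + ν + (s - ν))) := by
    intro x hx
    have hx : 0 < x := hx
    simp only [hfeq]
    rw [integral_const_mul, Real.integral_rpow_mul_exp_neg_mul_Ioi hs0 (by positivity),
      one_div_div, Real.div_rpow (by positivity) (by positivity), Real.mul_rpow two_pos.le hx.le,
      ← Real.rpow_natCast (1 + x) 2, ← Real.rpow_mul (by positivity),
      show s + ν + (s - ν) = (2 : ℕ) * s by push_cast; ring,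
      show s + ν - 1 = s + (ν - 1) by ring, Real.rpow_add hx]
    ring
  obtain ⟨b1, b2⟩ := integral_rpow_div_one_add_rpow (α := s + ν) (β := s - ν) (by linarith)
    (by linarith)
  have hswap := integral_swap_of_nonneg (S := Ioi 0) (T := Ioi 0) measurableSet_Ioi
    measurableSet_Ioi (f := f) (by fun_prop)
    (fun r hr x hx => by
      have hx : 0 < x := hx
      have hr : 0 < r := hr
      simp only [hf]
      positivity)
    (fun r hr => (integrableOn_besselKInt hν hr).const_mul _)
    (fun x hx => by
      have hx : 0 < x := hx
      simp only [hfeq]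
      exact (integrableOn_rpow_mul_exp_neg_mul hs0 (by positivity)).const_mul _)
  have hint : IntegrableOn (fun x => ∫ r in Ioi (0 : ℝ), f r x) (Ioi 0) :=
    IntegrableOn.congr_fun (b1.const_mul _) (fun x hx => (h2 x hx).symm) measurableSet_Ioi
  refine ⟨IntegrableOn.congr_fun (hswap.2.2 hint) h1 measurableSet_Ioi, ?_⟩
  rw [← setIntegral_congr_fun measurableSet_Ioi h1, hswap.1,
    setIntegral_congr_fun measurableSet_Ioi h2, integral_const_mul, b2,
    show s + ν + (s - ν) = 2 * n + 1 by rw [hs]; ring]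

theorem rpow_natCast_sub_half {r : ℝ} (hr : 0 < r) (n : ℕ) :
    r ^ ((n : ℝ) + 1 / 2 - 1) = r ^ n * r ^ (-(1 / 2) : ℝ) := by
  rw [← Real.rpow_natCast, ← Real.rpow_add hr]
  ring_nf

theorem integrableOn_pow_mul_besselWeight {ν : ℝ} (hν : 0 < ν) (hν2 : ν < 1 / 2) (n : ℕ) :
    IntegrableOn (fun r : ℝ => r ^ n * besselWeight ν r) (Ioi 0) := by
  refine IntegrableOn.congr_fun ((integral_rpow_mul_besselKInt hν hν2 n).1.const_mul
    (Real.sqrt (2 * Real.pi))⁻¹) (fun r hr => ?_) measurableSet_Ioi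
  rw [rpow_natCast_sub_half hr, besselWeight]
  ring

/-- The moments of the weight are, up to sign, the Hankel coefficients. -/
theorem integral_pow_mul_besselWeight {ν : ℝ} (hν : 0 < ν) (hν2 : ν < 1 / 2) (n : ℕ) :
    Real.cos (Real.pi * ν) / Real.pi * ∫ r in Ioi (0 : ℝ), r ^ n * besselWeight ν r =
      (∏ k ∈ Finset.range n, (((k : ℝ) + 1 / 2) ^ 2 - ν ^ 2)) / (2 ^ n * n.factorial) := by
  have h1 : ∫ r in Ioi (0 : ℝ), r ^ n * besselWeight ν r = (Real.sqrt (2 * Real.pi))⁻¹ *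
      (Real.Gamma (n + 1 / 2) * 2 ^ ((n : ℝ) + 1 / 2) *
        (Real.Gamma (n + 1 / 2 + ν) * Real.Gamma (n + 1 / 2 - ν) / Real.Gamma (2 * n + 1))) := by
    rw [← (integral_rpow_mul_besselKInt hν hν2 n).2, ← integral_const_mul]
    refine setIntegral_congr_fun measurableSet_Ioi (fun r hr => ?_)
    rw [rpow_natCast_sub_half hr, besselWeight]
    ring
  rw [h1]
  clear h1
  have hcos : Real.cos (Real.pi * ν) ≠ 0 := by
    refine (Real.cos_pos_of_mem_Ioo ⟨?_, ?_⟩).ne' <;> nlinarith [Real.pi_pos]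
  have hpi := Real.pi_pos
  induction n with
  | zero =>
    have e1 := Real.Gamma_mul_Gamma_one_sub (1 / 2 + ν)
    rw [show 1 - (1 / 2 + ν) = 1 / 2 - ν by ring,
      show Real.pi * (1 / 2 + ν) = Real.pi * ν + Real.pi / 2 by ring, Real.sin_add_pi_div_two] at e1
    simp only [Nat.cast_zero, zero_add, mul_zero, Real.Gamma_one, Finset.range_zero,
      Finset.prod_empty, pow_zero, Nat.factorial_zero, Nat.cast_one, mul_one, div_one]
    rw [e1, Real.Gamma_one_half_eq, ← Real.sqrt_eq_rpow, mul_comm (Real.sqrt Real.pi),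
      ← Real.sqrt_mul two_pos.le]
    have : Real.sqrt (2 * Real.pi) ≠ 0 := by positivity
    field_simp
  | succ n ih =>
    have hn : (0 : ℝ) ≤ n := n.cast_nonneg
    have g1 : Real.Gamma ((n + 1 : ℕ) + 1 / 2) = (n + 1 / 2) * Real.Gamma (n + 1 / 2) := by
      rw [← Real.Gamma_add_one (by positivity)]
      push_cast
      ring_nf
    have g2 : Real.Gamma ((n + 1 : ℕ) + 1 / 2 + ν) =
        (n + 1 / 2 + ν) * Real.Gamma (n + 1 / 2 + ν) := by
      rw [← Real.Gamma_add_one (by positivity)]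
      push_cast
      ring_nf
    have g3 : Real.Gamma ((n + 1 : ℕ) + 1 / 2 - ν) =
        (n + 1 / 2 - ν) * Real.Gamma (n + 1 / 2 - ν) := by
      rw [← Real.Gamma_add_one (by linarith)]
      push_cast
      ring_nf
    have g4 : Real.Gamma (2 * (n + 1 : ℕ) + 1) =
        (2 * n + 2) * ((2 * n + 1) * Real.Gamma (2 * n + 1)) := by
      rw [← Real.Gamma_add_one (by positivity), show (2 * n + 2 : ℝ) = 2 * n + 1 + 1 by ring,
        ← Real.Gamma_add_one (by positivity)]
      push_cast
      ring_nf
    have g5 : (2 : ℝ) ^ (((n + 1 : ℕ) : ℝ) + 1 / 2) = 2 * 2 ^ ((n : ℝ) + 1 / 2) := by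
      rw [show ((n + 1 : ℕ) : ℝ) + 1 / 2 = (n : ℝ) + 1 / 2 + 1 by push_cast; ring,
        Real.rpow_add_one two_ne_zero, mul_comm]
    have g6 : Real.Gamma (2 * n + 1) ≠ 0 := (Real.Gamma_pos_of_pos (by positivity)).ne'
    rw [Finset.prod_range_succ, Nat.factorial_succ, g1, g2, g3, g4, g5]
    push_cast
    have e : (∏ k ∈ Finset.range n, (((k : ℝ) + 1 / 2) ^ 2 - ν ^ 2)) *
        (((n : ℝ) + 1 / 2) ^ 2 - ν ^ 2) / (2 ^ (n + 1) * (((n : ℝ) + 1) * n.factorial)) =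
        (∏ k ∈ Finset.range n, (((k : ℝ) + 1 / 2) ^ 2 - ν ^ 2)) / (2 ^ n * n.factorial) *
          ((((n : ℝ) + 1 / 2) ^ 2 - ν ^ 2) / (2 * (n + 1))) := by
      generalize ∏ k ∈ Finset.range n, (((k : ℝ) + 1 / 2) ^ 2 - ν ^ 2) = P
      field_simp
      ring
    rw [e, ← ih]
    have : (2 * (n : ℝ) + 1) ≠ 0 := by positivity
    have : ((n : ℝ) + 1) ≠ 0 := by positivity
    field_simp
    ring

/-! ### Self-reproduction of the weight under the Stieltjes transform -/

/-- Folding an integral over the positive half-line at `1` by means of `x ↦ 1 / x`. -/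
theorem integral_Ioi_zero_eq_integral_Ioi_one {g : ℝ → ℝ} (hg : IntegrableOn g (Ioi 0)) :
    ∫ x in Ioi (0 : ℝ), g x = ∫ q in Ioi (1 : ℝ), (g q + 1 / q ^ 2 * g (1 / q)) := by
  have himg : (fun q : ℝ => 1 / q) '' Ioi 1 = Ioo 0 1 := by
    ext x
    constructor
    · rintro ⟨q, hq, rfl⟩
      have hq : (1 : ℝ) < q := hq
      exact ⟨by positivity, by simpa using inv_lt_one_of_one_lt₀ hq⟩
    · intro hx
      exact ⟨1 / x, by simpa using (one_lt_inv₀ hx.1).2 hx.2, by simp⟩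
  have hd : ∀ q ∈ Ioi (1 : ℝ), HasDerivWithinAt (fun q : ℝ => 1 / q) (-1 / q ^ 2) (Ioi 1) q := by
    intro q hq
    have hq : (q : ℝ) ≠ 0 := (zero_lt_one.trans hq).ne'
    have := (hasDerivAt_const q (1 : ℝ)).div (hasDerivAt_id q) hq
    convert! this.hasDerivWithinAt using 1
    simp
  have hinj : InjOn (fun q : ℝ => 1 / q) (Ioi 1) := fun a _ b _ h => by simpa using h
  have habs : ∀ q : ℝ, |(-1 : ℝ) / q ^ 2| = 1 / q ^ 2 := fun q => by
    rw [abs_div, abs_neg, abs_one, abs_of_nonneg (sq_nonneg q)]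
  have h1 := integral_image_eq_integral_abs_deriv_smul measurableSet_Ioi hd hinj g
  have h2 := (integrableOn_image_iff_integrableOn_abs_deriv_smul measurableSet_Ioi hd hinj g).1
    (by rw [himg]; exact hg.mono_set Ioo_subset_Ioi_self)
  simp only [habs, smul_eq_mul, himg] at h1 h2
  rw [integral_add (hg.mono_set (Ioi_subset_Ioi zero_le_one)) h2, ← h1,
    ← Ioc_union_Ioi_eq_Ioi (zero_le_one' ℝ), setIntegral_union (Ioc_disjoint_Ioi le_rfl)
      measurableSet_Ioi (hg.mono_set Ioc_subset_Ioi_self)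
      (hg.mono_set (Ioi_subset_Ioi zero_le_one)), integral_Ioc_eq_integral_Ioo, add_comm]

/-- The substitution `y = (q - 1)² / (2 q)`, `q > 1`. -/
theorem integral_comp_sub_one_sq_div (g : ℝ → ℝ) :
    ∫ q in Ioi (1 : ℝ), (q ^ 2 - 1) / (2 * q ^ 2) * g ((q - 1) ^ 2 / (2 * q)) =
      ∫ y in Ioi (0 : ℝ), g y := by
  have himg : (fun q : ℝ => (q - 1) ^ 2 / (2 * q)) '' Ioi 1 = Ioi 0 := by
    ext y
    constructor
    · rintro ⟨q, hq, rfl⟩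
      have hq : (1 : ℝ) < q := hq
      have : 0 < q - 1 := by linarith
      have : 0 < q := by linarith
      show 0 < (q - 1) ^ 2 / (2 * q)
      positivity
    · intro hy
      have hy : 0 < y := hy
      have hs : Real.sqrt (y ^ 2 + 2 * y) ^ 2 = y ^ 2 + 2 * y := Real.sq_sqrt (by positivity)
      have hs0 := Real.sqrt_nonneg (y ^ 2 + 2 * y)
      refine ⟨1 + y + Real.sqrt (y ^ 2 + 2 * y), ?_, ?_⟩
      · show 1 < 1 + y + Real.sqrt (y ^ 2 + 2 * y)
        linarith
      · have h0 : 2 * (1 + y + Real.sqrt (y ^ 2 + 2 * y)) ≠ 0 := by positivity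
        show (1 + y + Real.sqrt (y ^ 2 + 2 * y) - 1) ^ 2 /
          (2 * (1 + y + Real.sqrt (y ^ 2 + 2 * y))) = y
        rw [div_eq_iff h0]
        linear_combination hs
  have hd : ∀ q ∈ Ioi (1 : ℝ), HasDerivWithinAt (fun q : ℝ => (q - 1) ^ 2 / (2 * q))
      ((q ^ 2 - 1) / (2 * q ^ 2)) (Ioi 1) q := by
    intro q hq
    have hq : (q : ℝ) ≠ 0 := (zero_lt_one.trans hq).ne'
    have := (((hasDerivAt_id q).sub_const 1).pow 2).div ((hasDerivAt_id q).const_mul 2)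
      (mul_ne_zero two_ne_zero hq)
    convert! this.hasDerivWithinAt using 1
    simp only [id, Pi.pow_apply]
    field_simp
    ring
  have hinj : InjOn (fun q : ℝ => (q - 1) ^ 2 / (2 * q)) (Ioi 1) := by
    intro a ha b hb h
    have ha : (1 : ℝ) < a := ha
    have hb : (1 : ℝ) < b := hb
    have ha0 : 0 < a := by linarith
    have hb0 : 0 < b := by linarith
    have h : (a - 1) ^ 2 / (2 * a) = (b - 1) ^ 2 / (2 * b) := h
    rw [div_eq_div_iff (by positivity) (by positivity)] at h
    have h1 : (a - b) * (a * b - 1) = 0 := by linear_combination h / 2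
    rcases mul_eq_zero.1 h1 with h2 | h2
    · linarith
    · nlinarith
  have h1 := integral_image_eq_integral_abs_deriv_smul measurableSet_Ioi hd hinj g
  rw [himg] at h1
  rw [h1]
  refine setIntegral_congr_fun measurableSet_Ioi fun q hq => ?_
  have hq : (1 : ℝ) < q := hq
  have : 0 ≤ (q ^ 2 - 1) / (2 * q ^ 2) := div_nonneg (by nlinarith) (by positivity)
  rw [smul_eq_mul, abs_of_nonneg this]

/-- The partial fraction expansion is available because `α + y`, with `α = (1 + x)² / (2 x)` and
`y = (q - 1)² / (2 q)`, factors as `(x + q) (x + 1/q) / (2 x)`. -/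
theorem rpow_mul_sqrt_div_eq {ν q x : ℝ} (hq : 1 < q) (hx : 0 < x) :
    x ^ (ν - 1) * (((1 + x) ^ 2 / (2 * x)) ^ (1 / 2 : ℝ) /
        ((1 + x) ^ 2 / (2 * x) + (q - 1) ^ 2 / (2 * q))) =
      2 ^ (1 / 2 : ℝ) * (q / (q + 1) * (x ^ (ν + 1 / 2 - 1) / (x + q)) +
        1 / (q + 1) * (x ^ (ν + 1 / 2 - 1) / (x + q⁻¹))) := by
  have hq0 : 0 < q := by linarith
  have e1 : ((1 + x) ^ 2 / (2 * x)) ^ (1 / 2 : ℝ) =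
      (1 + x) / (2 ^ (1 / 2 : ℝ) * x ^ (1 / 2 : ℝ)) := by
    rw [Real.div_rpow (by positivity) (by positivity), Real.mul_rpow two_pos.le hx.le,
      ← Real.sqrt_eq_rpow, Real.sqrt_sq (by positivity)]
  have e2 : (2 : ℝ) ^ (1 / 2 : ℝ) * 2 ^ (1 / 2 : ℝ) = 2 := by
    rw [← Real.rpow_add two_pos]
    norm_num
  have e3 : x ^ (1 / 2 : ℝ) * x ^ (1 / 2 : ℝ) = x := by
    rw [← Real.rpow_add hx]
    norm_num
  have e4 : x ^ (ν + 1 / 2 - 1) = x ^ (ν - 1) * x ^ (1 / 2 : ℝ) := by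
    rw [← Real.rpow_add hx]
    ring_nf
  have hden : (1 + x) ^ 2 / (2 * x) + (q - 1) ^ 2 / (2 * q) = (x + q) * (x + q⁻¹) / (2 * x) := by
    field_simp
    ring
  rw [e1, e4, hden]
  have h2 : 0 < (2 : ℝ) ^ (1 / 2 : ℝ) := by positivity
  have hx2 : 0 < x ^ (1 / 2 : ℝ) := by positivity
  generalize (2 : ℝ) ^ (1 / 2 : ℝ) = s at *
  generalize x ^ (1 / 2 : ℝ) = u at *
  generalize x ^ (ν - 1) = v at *
  have hq1 : q - q⁻¹ ≠ 0 := by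
    have : q⁻¹ < 1 := inv_lt_one_of_one_lt₀ hq
    linarith
  have hpart : q / (q + 1) * (v * u / (x + q)) + 1 / (q + 1) * (v * u / (x + q⁻¹)) =
      v * u * (1 + x) / ((x + q) * (x + q⁻¹)) := by
    field_simp
    ring
  rw [hpart, ← e3]
  have : 0 < (u * u + q) := by positivity
  have : 0 < (u * u + q⁻¹) := by positivity
  field_simp
  linear_combination (-v) * e2

/-- After the partial fraction expansion this is a sum of two integrals `∫ x^(ν-1/2) / (x + c) dx`,
with `c = q` and `c = 1/q`. -/
theorem integral_rpow_mul_sqrt_div {ν q : ℝ} (hν : 0 < ν) (hν2 : ν < 1 / 2) (hq : 1 < q) :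
    IntegrableOn (fun x : ℝ => x ^ (ν - 1) * (((1 + x) ^ 2 / (2 * x)) ^ (1 / 2 : ℝ) /
        ((1 + x) ^ 2 / (2 * x) + (q - 1) ^ 2 / (2 * q)))) (Ioi 0) ∧
    ∫ x in Ioi (0 : ℝ), x ^ (ν - 1) * (((1 + x) ^ 2 / (2 * x)) ^ (1 / 2 : ℝ) /
        ((1 + x) ^ 2 / (2 * x) + (q - 1) ^ 2 / (2 * q))) =
      2 ^ (1 / 2 : ℝ) * (Real.pi / Real.cos (Real.pi * ν)) *
        ((q ^ (ν + 1 / 2) + q ^ (1 / 2 - ν)) / (q + 1)) := by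
  have hq0 : 0 < q := by linarith
  obtain ⟨a1, a2⟩ := integral_rpow_div_add (p := ν + 1 / 2) (by linarith) (by linarith) hq0
  obtain ⟨b1, b2⟩ := integral_rpow_div_add (p := ν + 1 / 2) (by linarith) (by linarith)
    (inv_pos.2 hq0)
  have hsum := ((a1.const_mul (q / (q + 1))).add (b1.const_mul (1 / (q + 1)))).const_mul
    ((2 : ℝ) ^ (1 / 2 : ℝ))
  have hcongr := fun x (hx : x ∈ Ioi (0 : ℝ)) => rpow_mul_sqrt_div_eq (ν := ν) hq hx
  refine ⟨IntegrableOn.congr_fun hsum (fun x hx => (hcongr x hx).symm) measurableSet_Ioi, ?_⟩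
  rw [setIntegral_congr_fun measurableSet_Ioi hcongr, integral_const_mul,
    integral_add (a1.const_mul _) (b1.const_mul _), integral_const_mul, integral_const_mul, a2, b2,
    show Real.pi * (ν + 1 / 2) = Real.pi * ν + Real.pi / 2 by ring, Real.sin_add_pi_div_two]
  have e1 : q ^ (ν + 1 / 2) = q * q ^ (ν + 1 / 2 - 1) := by
    rw [mul_comm, ← Real.rpow_add_one hq0.ne', sub_add_cancel]
  have e2 : q⁻¹ ^ (ν + 1 / 2 - 1) = q ^ (1 / 2 - ν) := by
    rw [Real.inv_rpow hq0.le, ← Real.rpow_neg hq0.le]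
    ring_nf
  rw [e1, e2]
  ring

/-- The weight is, up to the factor `e^(2z)`, a multiple of its own Stieltjes transform. -/
theorem exp_mul_besselWeight {ν z : ℝ} (hν : 0 < ν) (hν2 : ν < 1 / 2) (hz : 0 < z) :
    Real.exp (2 * z) * besselWeight ν z =
      Real.cos (Real.pi * ν) / Real.pi * ∫ r in Ioi (0 : ℝ), besselWeight ν r / (z + r) := by
  have hcos : 0 < Real.cos (Real.pi * ν) := by
    refine Real.cos_pos_of_mem_Ioo ⟨?_, ?_⟩ <;> nlinarith [Real.pi_pos]
  set al : ℝ → ℝ := fun x => (1 + x) ^ 2 / (2 * x) with hal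
  have hal0 : ∀ x ∈ Ioi (0 : ℝ), 0 < al x := fun x hx => by
    have hx : 0 < x := hx
    simp only [hal]
    positivity
  have halm : Measurable al := by fun_prop
  have hhalf : (0 : ℝ) < 1 / 2 := by norm_num
  -- the Stieltjes transform as a double integral
  set f : ℝ → ℝ → ℝ := fun r x =>
    r ^ (1 / 2 - 1 : ℝ) / (z + r) * (x ^ (ν - 1) * Real.exp (-(r * al x))) with hf
  have f1 : ∀ r ∈ Ioi (0 : ℝ), ∫ x in Ioi (0 : ℝ), f r x =
      Real.sqrt (2 * Real.pi) * (besselWeight ν r / (z + r)) := by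
    intro r _
    have h2pi : Real.sqrt (2 * Real.pi) ≠ 0 := by positivity
    simp only [hf]
    have hK : ∫ x in Ioi (0 : ℝ), x ^ (ν - 1) * Real.exp (-(r * al x)) = besselKInt ν r := rfl
    rw [integral_const_mul, hK, besselWeight, show (1 / 2 - 1 : ℝ) = -(1 / 2) by norm_num]
    field_simp
  -- the substitution `r = z y / α` in the inner integral
  set g : ℝ → ℝ → ℝ := fun y x =>
    y ^ (1 / 2 - 1 : ℝ) * Real.exp (-(z * y)) * (x ^ (ν - 1) * (al x ^ (1 / 2 : ℝ) / (al x + y)))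
    with hg
  have f2 : ∀ x ∈ Ioi (0 : ℝ), ∫ r in Ioi (0 : ℝ), f r x =
      z ^ (1 / 2 - 1 : ℝ) * ∫ y in Ioi (0 : ℝ), g y x := by
    intro x hx
    have ha := hal0 x hx
    have h := integral_comp_mul_left_Ioi' (fun r => f r x) 0 (div_pos hz ha)
    rw [mul_zero] at h
    rw [← h, smul_eq_mul, ← integral_const_mul, ← integral_const_mul]
    refine setIntegral_congr_fun measurableSet_Ioi fun y hy => ?_
    have hy : 0 < y := hy
    simp only [hf, hg]
    have e1 : z / al x * y * al x = z * y := by field_simp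
    have e2 : al x ^ (1 / 2 : ℝ) = al x * al x ^ (1 / 2 - 1 : ℝ) := by
      rw [mul_comm, ← Real.rpow_add_one ha.ne', sub_add_cancel]
    have h1 : al x ^ (1 / 2 - 1 : ℝ) * al x ^ (1 - 1 / 2 : ℝ) = 1 := by
      rw [← Real.rpow_add ha]; norm_num
    have h2 : al x ^ (1 / 2 : ℝ) * al x ^ (1 / 2 - 1 : ℝ) = 1 := by
      rw [← Real.rpow_add ha]; norm_num
    have h3 : 0 < al x ^ (1 / 2 - 1 : ℝ) := by positivity
    have h4 : 0 < al x ^ (1 / 2 : ℝ) := by positivity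
    rw [e1, Real.mul_rpow (by positivity) hy.le, Real.div_rpow hz.le ha.le]
    have e3 : z + z / al x * y = z * (al x + y) / al x := by field_simp
    rw [e3]
    have hay : 0 < al x + y := by positivity
    have e4 : (al x ^ (1 / 2 - 1 : ℝ))⁻¹ = al x ^ (1 / 2 : ℝ) :=
      (eq_inv_of_mul_eq_one_left h2).symm
    rw [div_eq_mul_inv (z ^ (1 / 2 - 1 : ℝ)), e4]
    field_simp
  have hswap1 := integral_swap_of_nonneg (S := Ioi 0) (T := Ioi 0) measurableSet_Ioi
    measurableSet_Ioi (f := f) (by fun_prop)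
    (fun r hr x hx => by
      have hx : 0 < x := hx
      have hr : 0 < r := hr
      simp only [hf]
      positivity)
    (fun r hr => (integrableOn_besselKInt hν hr).const_mul _)
    (fun x hx => by
      have ha := hal0 x hx
      refine Integrable.mono' (((integrableOn_rpow_mul_exp_neg_mul hhalf ha).const_mul
        (x ^ (ν - 1) / z))) (Measurable.aestronglyMeasurable (by fun_prop)) ?_
      filter_upwards [ae_restrict_mem measurableSet_Ioi] with r hr
      have hx : 0 < x := hx
      have hr : 0 < r := hr
      simp only [hf]
      rw [Real.norm_of_nonneg (by positivity), mul_comm r (al x)]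
      have : r ^ (1 / 2 - 1 : ℝ) / (z + r) ≤ r ^ (1 / 2 - 1 : ℝ) / z := by
        gcongr
        linarith
      calc r ^ (1 / 2 - 1 : ℝ) / (z + r) * (x ^ (ν - 1) * Real.exp (-(al x * r)))
          ≤ r ^ (1 / 2 - 1 : ℝ) / z * (x ^ (ν - 1) * Real.exp (-(al x * r))) := by gcongr
        _ = _ := by ring)
  have hsub : ∀ y ∈ Ioi (0 : ℝ), ∃ q > 1, (q - 1) ^ 2 / (2 * q) = y := by
    intro y hy
    have hy : 0 < y := hy
    have hs : Real.sqrt (y ^ 2 + 2 * y) ^ 2 = y ^ 2 + 2 * y := Real.sq_sqrt (by positivity)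
    have hs0 := Real.sqrt_nonneg (y ^ 2 + 2 * y)
    refine ⟨1 + y + Real.sqrt (y ^ 2 + 2 * y), by linarith, ?_⟩
    have h0 : 2 * (1 + y + Real.sqrt (y ^ 2 + 2 * y)) ≠ 0 := by positivity
    rw [div_eq_iff h0]
    linear_combination hs
  have hswap2 := integral_swap_of_nonneg (S := Ioi 0) (T := Ioi 0) measurableSet_Ioi
    measurableSet_Ioi (f := g) (by fun_prop)
    (fun y hy x hx => by
      have ha := hal0 x hx
      have hx : 0 < x := hx
      have hy : 0 < y := hy
      simp only [hg]
      positivity)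
    (fun y hy => by
      obtain ⟨q, hq, rfl⟩ := hsub y hy
      exact (integral_rpow_mul_sqrt_div hν hν2 hq).1.const_mul _)
    (fun x hx => by
      have ha := hal0 x hx
      refine Integrable.mono' (((integrableOn_rpow_mul_exp_neg_mul hhalf hz).mul_const
        (x ^ (ν - 1) * (al x ^ (1 / 2 : ℝ) / al x))))
        (Measurable.aestronglyMeasurable (by fun_prop)) ?_
      filter_upwards [ae_restrict_mem measurableSet_Ioi] with y hy
      have hx : 0 < x := hx
      have hy : 0 < y := hy
      simp only [hg]
      rw [Real.norm_of_nonneg (by positivity)]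
      gcongr
      linarith)
  -- evaluation of the inner integral after the substitution `y = (q - 1)² / (2 q)`
  have g1 : ∀ q ∈ Ioi (1 : ℝ), (q ^ 2 - 1) / (2 * q ^ 2) *
      ∫ x in Ioi (0 : ℝ), g ((q - 1) ^ 2 / (2 * q)) x =
      Real.pi / Real.cos (Real.pi * ν) * (q ^ (ν - 1) * Real.exp (-(z * ((q - 1) ^ 2 / (2 * q)))) +
        1 / q ^ 2 * ((1 / q) ^ (ν - 1) *
          Real.exp (-(z * ((1 / q - 1) ^ 2 / (2 * (1 / q))))))) := by
    intro q hq
    have hq : 1 < q := hq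
    have hq0 : 0 < q := by linarith
    have hq1 : 0 < q - 1 := by linarith
    simp only [hg]
    rw [integral_const_mul, (integral_rpow_mul_sqrt_div hν hν2 hq).2]
    have e1 : (1 / q - 1) ^ 2 / (2 * (1 / q)) = (q - 1) ^ 2 / (2 * q) := by
      field_simp
      ring
    have e2 : ((q - 1) ^ 2 / (2 * q)) ^ (1 / 2 - 1 : ℝ) =
        (2 ^ (1 / 2 : ℝ) * q ^ (1 / 2 : ℝ)) / (q - 1) := by
      rw [show (1 / 2 - 1 : ℝ) = -(1 / 2) by norm_num, Real.rpow_neg (by positivity),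
        Real.div_rpow (by positivity) (by positivity), Real.mul_rpow two_pos.le hq0.le,
        ← Real.sqrt_eq_rpow, Real.sqrt_sq hq1.le, inv_div]
    have e3 : (2 : ℝ) ^ (1 / 2 : ℝ) * 2 ^ (1 / 2 : ℝ) = 2 := by
      rw [← Real.rpow_add two_pos]
      norm_num
    have e4 : q ^ (1 / 2 : ℝ) * q ^ (ν + 1 / 2) = q ^ 2 * q ^ (ν - 1) := by
      rw [← Real.rpow_natCast q 2, ← Real.rpow_add hq0, ← Real.rpow_add hq0]
      push_cast
      ring_nf
    have e5 : q ^ (1 / 2 : ℝ) * q ^ (1 / 2 - ν) = (1 / q) ^ (ν - 1) := by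
      rw [one_div q, Real.inv_rpow hq0.le, ← Real.rpow_neg hq0.le, ← Real.rpow_add hq0]
      ring_nf
    rw [e1, e2, ← e5]
    have e6 : q ^ (ν - 1) = q ^ (1 / 2 : ℝ) * q ^ (ν + 1 / 2) / q ^ 2 := by
      rw [e4]
      field_simp
    rw [e6]
    generalize Real.exp (-(z * ((q - 1) ^ 2 / (2 * q)))) = E
    generalize q ^ (1 / 2 : ℝ) = u
    generalize q ^ (ν + 1 / 2) = v
    generalize q ^ (1 / 2 - ν) = w
    have hE : (q ^ 2 - 1) / (2 * q ^ 2) * (2 ^ (1 / 2 : ℝ) * u / (q - 1) * E *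
        (2 ^ (1 / 2 : ℝ) * (Real.pi / Real.cos (Real.pi * ν)) * ((v + w) / (q + 1)))) =
        (2 ^ (1 / 2 : ℝ) * 2 ^ (1 / 2 : ℝ)) * ((q ^ 2 - 1) / (2 * q ^ 2) * (u / (q - 1) * E *
        (Real.pi / Real.cos (Real.pi * ν) * ((v + w) / (q + 1))))) := by ring
    rw [hE, e3]
    field_simp
    ring
  have hb : ∀ x ∈ Ioi (0 : ℝ), x ^ (ν - 1) * Real.exp (-(z * ((x - 1) ^ 2 / (2 * x)))) =
      Real.exp (2 * z) * (x ^ (ν - 1) * Real.exp (-(z * al x))) := by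
    intro x hx
    have hx : 0 < x := hx
    have e1 : -(z * ((x - 1) ^ 2 / (2 * x))) = 2 * z + -(z * al x) := by
      simp only [hal]
      field_simp
      ring
    rw [e1, Real.exp_add]
    ring
  have hbint : IntegrableOn (fun x : ℝ => x ^ (ν - 1) * Real.exp (-(z * ((x - 1) ^ 2 / (2 * x)))))
      (Ioi 0) :=
    IntegrableOn.congr_fun ((integrableOn_besselKInt hν hz).const_mul (Real.exp (2 * z)))
      (fun x hx => (hb x hx).symm) measurableSet_Ioi
  have hfold := integral_Ioi_zero_eq_integral_Ioi_one hbint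
  rw [setIntegral_congr_fun measurableSet_Ioi hb, integral_const_mul] at hfold
  have hK : ∫ x in Ioi (0 : ℝ), x ^ (ν - 1) * Real.exp (-(z * al x)) = besselKInt ν z := rfl
  rw [hK] at hfold
  have total : Real.sqrt (2 * Real.pi) * ∫ r in Ioi (0 : ℝ), besselWeight ν r / (z + r) =
      z ^ (1 / 2 - 1 : ℝ) * (Real.pi / Real.cos (Real.pi * ν) *
        (Real.exp (2 * z) * besselKInt ν z)) := by
    rw [← integral_const_mul, ← setIntegral_congr_fun measurableSet_Ioi f1, hswap1.1,
      setIntegral_congr_fun measurableSet_Ioi f2, integral_const_mul, ← hswap2.1,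
      ← integral_comp_sub_one_sq_div, setIntegral_congr_fun measurableSet_Ioi g1,
      integral_const_mul, hfold]
  have h2pi : Real.sqrt (2 * Real.pi) ≠ 0 := by positivity
  have hfin : ∫ r in Ioi (0 : ℝ), besselWeight ν r / (z + r) = (Real.sqrt (2 * Real.pi))⁻¹ *
      (z ^ (1 / 2 - 1 : ℝ) * (Real.pi / Real.cos (Real.pi * ν) *
        (Real.exp (2 * z) * besselKInt ν z))) := by
    rw [← total, inv_mul_cancel_left₀ h2pi]
  rw [hfin, besselWeight, show (1 / 2 - 1 : ℝ) = -(1 / 2) by norm_num]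
  have := Real.pi_pos
  field_simp

/-! ### The real expansion with its terminant remainder -/

theorem integral_exp_neg_mul_Ioi_zero {a : ℝ} (ha : 0 < a) :
    IntegrableOn (fun y : ℝ => Real.exp (-(a * y))) (Ioi 0) ∧
      ∫ y in Ioi (0 : ℝ), Real.exp (-(a * y)) = 1 / a := by
  have h1 := integrableOn_rpow_mul_exp_neg_mul one_pos ha
  have h2 := Real.integral_rpow_mul_exp_neg_mul_Ioi one_pos ha
  simp only [sub_self, Real.rpow_zero, one_mul, Real.rpow_one, Real.Gamma_one, mul_one] at h1 h2
  exact ⟨h1, h2⟩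

/-- The basic terminant at a positive argument: `Λ_N(w) = ∫ e^(-x) (1 + x/w)^(-N) dx`. -/
noncomputable def realTerminant (N : ℕ) (w : ℝ) : ℝ :=
  ∫ x in Ioi (0 : ℝ), Real.exp (-x) / (1 + x / w) ^ N

theorem gamma_mul_realTerminant (n : ℕ) {w : ℝ} (hw : 0 < w) :
    Real.Gamma ((n : ℝ) + 1) * realTerminant (n + 1) w =
      ∫ s in Ioi (0 : ℝ), s ^ n * Real.exp (-s) * (w / (w + s)) := by
  set f : ℝ → ℝ → ℝ := fun s y => s ^ n * Real.exp (-s) * (w * Real.exp (-((w + s) * y))) with hf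
  have h1 : ∀ s ∈ Ioi (0 : ℝ), ∫ y in Ioi (0 : ℝ), f s y =
      s ^ n * Real.exp (-s) * (w / (w + s)) := by
    intro s hs
    have hs : 0 < s := hs
    simp only [hf]
    rw [integral_const_mul, integral_const_mul, (integral_exp_neg_mul_Ioi_zero (a := w + s) (by positivity)).2]
    ring
  have hfy : ∀ y s, f s y = w * Real.exp (-(w * y)) *
      (s ^ ((n : ℝ) + 1 - 1) * Real.exp (-((1 + y) * s))) := by
    intro y s
    simp only [hf]
    rw [add_sub_cancel_right, Real.rpow_natCast,
      show -((w + s) * y) = -(w * y) + -(s * y) by ring,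
      show -((1 + y) * s) = -s + -(s * y) by ring, Real.exp_add, Real.exp_add]
    ring
  have hn : (0 : ℝ) < (n : ℝ) + 1 := by positivity
  have h2 : ∀ y ∈ Ioi (0 : ℝ), ∫ s in Ioi (0 : ℝ), f s y =
      Real.Gamma ((n : ℝ) + 1) * (w * (Real.exp (-(w * y)) / (1 + y) ^ (n + 1))) := by
    intro y hy
    have hy : 0 < y := hy
    simp only [hfy]
    rw [integral_const_mul, Real.integral_rpow_mul_exp_neg_mul_Ioi hn (by positivity),
      ← Nat.cast_succ, Real.rpow_natCast, one_div_pow, Nat.succ_eq_add_one]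
    generalize (1 + y) ^ (n + 1) = P
    ring
  have hswap := integral_swap_of_nonneg (S := Ioi 0) (T := Ioi 0) measurableSet_Ioi
    measurableSet_Ioi (f := f) (by fun_prop)
    (fun s hs y hy => by
      have hs : 0 < s := hs
      simp only [hf]
      positivity)
    (fun s hs => by
      have hs : 0 < s := hs
      exact ((integral_exp_neg_mul_Ioi_zero (a := w + s) (by positivity)).1.const_mul _).const_mul _)
    (fun y hy => by
      have hy : 0 < y := hy
      simp only [hfy]
      exact (integrableOn_rpow_mul_exp_neg_mul hn (by positivity)).const_mul _)
  have h3 := integral_comp_mul_left_Ioi' (fun x => Real.exp (-x) / (1 + x / w) ^ (n + 1)) 0 hw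
  rw [mul_zero] at h3
  rw [← setIntegral_congr_fun measurableSet_Ioi h1, hswap.1,
    setIntegral_congr_fun measurableSet_Ioi h2, integral_const_mul, integral_const_mul,
    realTerminant, ← h3, smul_eq_mul]
  simp only [mul_div_cancel_left₀ _ hw.ne']

/-- The terminant at `2 z (1 + t)` as a Laplace-type integral with a `t`-independent weight. -/
theorem gamma_mul_realTerminant_scaled (n : ℕ) {z t : ℝ} (hz : 0 < z) (ht : 0 ≤ t) :
    Real.Gamma ((n : ℝ) + 1) / 2 ^ (n + 1) *
        (realTerminant (n + 1) (2 * z * (1 + t)) / (1 + t) ^ (n + 1)) =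
      ∫ s in Ioi (0 : ℝ), s ^ n * Real.exp (-(2 * s)) * (z / (z + s)) * Real.exp (-(2 * t * s)) := by
  have ht1 : 0 < 1 + t := by linarith
  have hb : 0 < 2 * (1 + t) := by positivity
  have h := integral_comp_mul_left_Ioi' (fun s => s ^ n * Real.exp (-s) *
    (2 * z * (1 + t) / (2 * z * (1 + t) + s))) 0 hb
  rw [mul_zero, ← gamma_mul_realTerminant n (by positivity), smul_eq_mul, ← integral_const_mul] at h
  have h2 : ∀ s ∈ Ioi (0 : ℝ), s ^ n * Real.exp (-(2 * s)) * (z / (z + s)) *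
      Real.exp (-(2 * t * s)) = (2 * (1 + t)) ^ (-(n + 1 : ℤ)) * (2 * (1 + t) *
        ((2 * (1 + t) * s) ^ n * Real.exp (-(2 * (1 + t) * s)) *
          (2 * z * (1 + t) / (2 * z * (1 + t) + 2 * (1 + t) * s)))) := by
    intro s hs
    have hs : 0 < s := hs
    have e1 : 2 * z * (1 + t) / (2 * z * (1 + t) + 2 * (1 + t) * s) = z / (z + s) := by
      rw [show 2 * z * (1 + t) = 2 * (1 + t) * z by ring, ← mul_add, mul_div_mul_left _ _ hb.ne']
    have e2 : -(2 * (1 + t) * s) = -(2 * s) + -(2 * t * s) := by ring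
    have e3 : (2 * (1 + t)) ^ (-(n + 1 : ℤ)) = ((2 * (1 + t)) ^ (n + 1))⁻¹ := by
      rw [zpow_neg]
      norm_cast
    rw [e1, e2, Real.exp_add, e3, mul_pow (2 * (1 + t)) s]
    field_simp
    ring
  rw [setIntegral_congr_fun measurableSet_Ioi h2, integral_const_mul, h]
  have e3 : (2 * (1 + t)) ^ (-(n + 1 : ℤ)) = ((2 * (1 + t)) ^ (n + 1))⁻¹ := by
    rw [zpow_neg]
    norm_cast
  rw [e3, mul_pow]
  field_simp

/-- The Laplace transform `D(t) = (2 cos(πν) / π) ∫ r κ(r) e^(-2 t r) dr`; it equals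
`-t⁻¹ 𝐅(ν + 1/2, -ν + 1/2; 0; -t)`. -/
noncomputable def besselDensity (ν t : ℝ) : ℝ :=
  2 * (Real.cos (Real.pi * ν) / Real.pi) *
    ∫ r in Ioi (0 : ℝ), r * besselWeight ν r * Real.exp (-(2 * t * r))

section density

variable {ν : ℝ}

theorem cos_pi_mul_pos (hν : 0 < ν) (hν2 : ν < 1 / 2) : 0 < Real.cos (Real.pi * ν) := by
  refine Real.cos_pos_of_mem_Ioo ⟨?_, ?_⟩ <;> nlinarith [Real.pi_pos]

theorem measurable_besselDensity (ν : ℝ) : Measurable (besselDensity ν) := by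
  have hm := measurable_besselWeight ν
  have : StronglyMeasurable (Function.uncurry fun t r : ℝ =>
      r * besselWeight ν r * Real.exp (-(2 * t * r))) :=
    Measurable.stronglyMeasurable (by fun_prop)
  exact (this.integral_prod_right (ν := volume.restrict (Ioi 0))).measurable.const_mul _

theorem besselDensity_nonneg (hν : 0 < ν) (hν2 : ν < 1 / 2) (t : ℝ) : 0 ≤ besselDensity ν t := by
  have h := cos_pi_mul_pos hν hν2
  have : 0 ≤ ∫ r in Ioi (0 : ℝ), r * besselWeight ν r * Real.exp (-(2 * t * r)) :=
    setIntegral_nonneg measurableSet_Ioi fun r hr => by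
      have hr0 : 0 < r := hr
      have := besselWeight_nonneg ν hr0
      positivity
  have := Real.pi_pos
  unfold besselDensity
  positivity

theorem integrableOn_besselWeight_div (hν : 0 < ν) (hν2 : ν < 1 / 2) (n : ℕ) {z : ℝ} (hz : 0 < z) :
    IntegrableOn (fun r : ℝ => r ^ n * besselWeight ν r * (z / (z + r))) (Ioi 0) := by
  have hm := measurable_besselWeight ν
  refine (integrableOn_pow_mul_besselWeight hν hν2 n).mono'
    (Measurable.aestronglyMeasurable (by fun_prop)) ?_
  filter_upwards [ae_restrict_mem measurableSet_Ioi] with r hr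
  have hr : 0 < r := hr
  have hk := besselWeight_nonneg ν hr
  rw [Real.norm_of_nonneg (by positivity)]
  refine mul_le_of_le_one_right (by positivity) ?_
  rw [div_le_one (by positivity)]
  linarith

/-- Expansion of the Stieltjes transform, with the remainder in Stieltjes form. -/
theorem besselWeight_expansion (hν : 0 < ν) (hν2 : ν < 1 / 2) {z : ℝ} (hz : 0 < z) (N : ℕ) :
    z * (Real.exp (2 * z) * besselWeight ν z) =
      ∑ n ∈ Finset.range N, (-1) ^ n * (Real.cos (Real.pi * ν) / Real.pi *
        ∫ r in Ioi (0 : ℝ), r ^ n * besselWeight ν r) / z ^ n +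
      (-1) ^ N * (Real.cos (Real.pi * ν) / Real.pi *
        ∫ r in Ioi (0 : ℝ), r ^ N * besselWeight ν r * (z / (z + r))) / z ^ N := by
  induction N with
  | zero =>
    rw [exp_mul_besselWeight hν hν2 hz]
    simp only [Finset.range_zero, Finset.sum_empty, pow_zero, one_mul, div_one, zero_add]
    rw [mul_left_comm, ← integral_const_mul]
    congr 2
    ext r
    ring
  | succ N ih =>
    rw [ih, Finset.sum_range_succ, add_assoc]
    congr 1
    have h : ∫ r in Ioi (0 : ℝ), r ^ N * besselWeight ν r * (z / (z + r)) =
        (∫ r in Ioi (0 : ℝ), r ^ N * besselWeight ν r) -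
          z⁻¹ * ∫ r in Ioi (0 : ℝ), r ^ (N + 1) * besselWeight ν r * (z / (z + r)) := by
      rw [← integral_const_mul, ← integral_sub (integrableOn_pow_mul_besselWeight hν hν2 N)
        ((integrableOn_besselWeight_div hν hν2 (N + 1) hz).const_mul _)]
      refine setIntegral_congr_fun measurableSet_Ioi fun r hr => ?_
      have hr : 0 < r := hr
      have : z + r ≠ 0 := by positivity
      field_simp
      ring
    rw [h]
    field_simp
    ring

/-- `∫ D(t) e^(-2 t s) dt = 1 - s e^(2 s) κ(s)`. -/
theorem integral_besselDensity_mul_exp (hν : 0 < ν) (hν2 : ν < 1 / 2) {s : ℝ} (hs : 0 < s) :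
    IntegrableOn (fun t : ℝ => besselDensity ν t * Real.exp (-(2 * t * s))) (Ioi 0) ∧
    ∫ t in Ioi (0 : ℝ), besselDensity ν t * Real.exp (-(2 * t * s)) =
      1 - s * (Real.exp (2 * s) * besselWeight ν s) := by
  have hm := measurable_besselWeight ν
  set c : ℝ := Real.cos (Real.pi * ν) / Real.pi with hc
  have hc0 : 0 < c := div_pos (cos_pi_mul_pos hν hν2) Real.pi_pos
  set f : ℝ → ℝ → ℝ := fun t r =>
    2 * c * (r * besselWeight ν r) * Real.exp (-(2 * (s + r) * t)) with hf
  have h1 : ∀ t ∈ Ioi (0 : ℝ), ∫ r in Ioi (0 : ℝ), f t r =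
      besselDensity ν t * Real.exp (-(2 * t * s)) := by
    intro t _
    rw [besselDensity, mul_assoc, ← integral_mul_const, ← integral_const_mul]
    refine setIntegral_congr_fun measurableSet_Ioi fun r _ => ?_
    simp only [hf]
    rw [show -(2 * (s + r) * t) = -(2 * t * r) + -(2 * t * s) by ring, Real.exp_add]
    ring
  have h2 : ∀ r ∈ Ioi (0 : ℝ), ∫ t in Ioi (0 : ℝ), f t r =
      c * besselWeight ν r - c / s * s * (r ^ 0 * besselWeight ν r * (s / (s + r))) := by
    intro r hr
    have hr : 0 < r := hr
    simp only [hf]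
    rw [integral_const_mul, (integral_exp_neg_mul_Ioi_zero (a := 2 * (s + r)) (by positivity)).2]
    field_simp
    ring
  have i0 := integrableOn_pow_mul_besselWeight hν hν2 0
  simp only [pow_zero, one_mul] at i0
  have i1 := integrableOn_besselWeight_div hν hν2 0 hs
  have hswap := integral_swap_of_nonneg (S := Ioi 0) (T := Ioi 0) measurableSet_Ioi
    measurableSet_Ioi (f := f) (by fun_prop)
    (fun t ht r hr => by
      have hr : 0 < r := hr
      have := besselWeight_nonneg ν hr
      simp only [hf]
      positivity)
    (fun t ht => by
      have ht : 0 < t := ht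
      have i := (integrableOn_pow_mul_besselWeight hν hν2 1).const_mul (2 * c)
      refine i.mono' (Measurable.aestronglyMeasurable (by fun_prop)) ?_
      filter_upwards [ae_restrict_mem measurableSet_Ioi] with r hr
      have hr : 0 < r := hr
      have := besselWeight_nonneg ν hr
      simp only [hf]
      rw [Real.norm_of_nonneg (by positivity), pow_one]
      refine mul_le_of_le_one_right (by positivity) (Real.exp_le_one_iff.2 ?_)
      have : 0 < 2 * (s + r) * t := by positivity
      linarith)
    (fun r hr => by
      have hr : 0 < r := hr
      exact (integral_exp_neg_mul_Ioi_zero (a := 2 * (s + r)) (by positivity)).1.const_mul _)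
  have hint : IntegrableOn (fun r => ∫ t in Ioi (0 : ℝ), f t r) (Ioi 0) :=
    IntegrableOn.congr_fun ((i0.const_mul c).sub (i1.const_mul (c / s * s)))
      (fun r hr => (h2 r hr).symm) measurableSet_Ioi
  refine ⟨IntegrableOn.congr_fun (hswap.2.2 hint) h1 measurableSet_Ioi, ?_⟩
  have hm0 := integral_pow_mul_besselWeight hν hν2 0
  have hq := besselWeight_expansion hν hν2 hs 0
  simp only [Finset.range_zero, Finset.prod_empty, pow_zero, Nat.factorial_zero, Nat.cast_one,
    mul_one, div_one, one_mul, Finset.sum_empty, zero_add] at hm0 hq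
  rw [← setIntegral_congr_fun measurableSet_Ioi h1, hswap.1,
    setIntegral_congr_fun measurableSet_Ioi h2,
    integral_sub (i0.const_mul c) (i1.const_mul (c / s * s)), integral_const_mul,
    integral_const_mul, hm0, hq, div_mul_cancel₀ _ hs.ne']
  simp only [pow_zero, one_mul, hc]

/-- The remainder of the expansion, expressed through the terminant. -/
theorem integral_besselWeight_eq_realTerminant (hν : 0 < ν) (hν2 : ν < 1 / 2) {z : ℝ} (hz : 0 < z)
    (n : ℕ) :
    ∫ r in Ioi (0 : ℝ), r ^ (n + 1) * besselWeight ν r * (z / (z + r)) =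
      Real.Gamma ((n : ℝ) + 1) / 2 ^ (n + 1) * (realTerminant (n + 1) (2 * z) -
        ∫ t in Ioi (0 : ℝ), besselDensity ν t *
          (realTerminant (n + 1) (2 * z * (1 + t)) / (1 + t) ^ (n + 1))) := by
  have hm := measurable_besselDensity ν
  set f : ℝ → ℝ → ℝ := fun s t => s ^ n * Real.exp (-(2 * s)) * (z / (z + s)) *
    (besselDensity ν t * Real.exp (-(2 * t * s))) with hf
  have i0 : IntegrableOn (fun s : ℝ => s ^ n * Real.exp (-(2 * s)) * (z / (z + s))) (Ioi 0) := by
    have hn : (0 : ℝ) < (n : ℝ) + 1 := by positivity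
    refine (integrableOn_rpow_mul_exp_neg_mul hn two_pos).mono'
      (Measurable.aestronglyMeasurable (by fun_prop)) ?_
    filter_upwards [ae_restrict_mem measurableSet_Ioi] with s hs
    have hs : 0 < s := hs
    rw [Real.norm_of_nonneg (by positivity), add_sub_cancel_right, Real.rpow_natCast]
    refine mul_le_of_le_one_right (by positivity) ?_
    rw [div_le_one (by positivity)]
    linarith
  have h1 : ∀ s ∈ Ioi (0 : ℝ), ∫ t in Ioi (0 : ℝ), f s t =
      s ^ n * Real.exp (-(2 * s)) * (z / (z + s)) -
        s ^ (n + 1) * besselWeight ν s * (z / (z + s)) := by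
    intro s hs
    have hs : 0 < s := hs
    simp only [hf]
    rw [integral_const_mul, (integral_besselDensity_mul_exp hν hν2 hs).2]
    have : Real.exp (-(2 * s)) * Real.exp (2 * s) = 1 := by
      rw [← Real.exp_add, neg_add_cancel, Real.exp_zero]
    linear_combination (-(s ^ n * (z / (z + s)) * s * besselWeight ν s)) * this
  have h2 : ∀ t ∈ Ioi (0 : ℝ), ∫ s in Ioi (0 : ℝ), f s t =
      Real.Gamma ((n : ℝ) + 1) / 2 ^ (n + 1) * (besselDensity ν t *
          (realTerminant (n + 1) (2 * z * (1 + t)) / (1 + t) ^ (n + 1))) := by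
    intro t ht
    have ht : 0 < t := ht
    rw [mul_left_comm, gamma_mul_realTerminant_scaled n hz ht.le, ← integral_const_mul]
    congr 1
    ext s
    simp only [hf]
    ring
  have hswap := integral_swap_of_nonneg (S := Ioi 0) (T := Ioi 0) measurableSet_Ioi
    measurableSet_Ioi (f := f) (by fun_prop)
    (fun s hs t ht => by
      have hs : 0 < s := hs
      have := besselDensity_nonneg hν hν2 t
      simp only [hf]
      positivity)
    (fun s hs => (integral_besselDensity_mul_exp hν hν2 hs).1.const_mul _)
    (fun t ht => by
      have ht : 0 < t := ht
      refine (i0.const_mul (besselDensity ν t)).mono'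
        (Measurable.aestronglyMeasurable (by fun_prop)) ?_
      filter_upwards [ae_restrict_mem measurableSet_Ioi] with s hs
      have hs : 0 < s := hs
      have hD := besselDensity_nonneg hν hν2 t
      have he : Real.exp (-(2 * t * s)) ≤ 1 := by
        refine Real.exp_le_one_iff.2 ?_
        have : 0 < 2 * t * s := by positivity
        linarith
      simp only [hf]
      rw [Real.norm_of_nonneg (by positivity), mul_comm (besselDensity ν t) (s ^ n * _ * _)]
      gcongr
      exact mul_le_of_le_one_right hD he)
  have i1 := integrableOn_besselWeight_div hν hν2 (n + 1) hz
  have h0 := gamma_mul_realTerminant_scaled n hz le_rfl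
  simp only [add_zero, mul_one, one_pow, div_one, mul_zero, zero_mul, neg_zero, Real.exp_zero] at h0
  have := hswap.1
  rw [setIntegral_congr_fun measurableSet_Ioi h1, setIntegral_congr_fun measurableSet_Ioi h2,
    integral_sub i0 i1, integral_const_mul] at this
  rw [mul_sub, h0, ← this]
  ring

end density

/-! ### The terminant on the Riemann surface -/

theorem integrableOn_cpow_mul_exp_neg {a : ℂ} (ha : a.re ≤ 1) {x : ℝ} (hx : 0 < x) :
    IntegrableOn (fun t : ℝ => (t : ℂ) ^ (a - 1) * exp (-(t : ℂ))) (Ioi x) := by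
  have hcont : ContinuousOn (fun t : ℝ => (t : ℂ) ^ (a - 1) * exp (-(t : ℂ))) (Ioi x) := by
    intro t ht
    have ht : 0 < t := hx.trans ht
    refine ContinuousAt.continuousWithinAt (ContinuousAt.mul ?_ (by fun_prop))
    exact continuousAt_ofReal_cpow_const _ _ (Or.inr ht.ne')
  refine ((integrableOn_exp_neg_Ioi x).const_mul (x ^ (a.re - 1))).mono'
    (hcont.aestronglyMeasurable measurableSet_Ioi) ?_
  filter_upwards [ae_restrict_mem measurableSet_Ioi] with t ht
  have ht0 : 0 < t := hx.trans ht
  rw [norm_mul, Complex.norm_cpow_eq_rpow_re_of_pos ht0, Complex.norm_exp, sub_re, one_re, neg_re,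
    ofReal_re]
  gcongr ?_ * _
  exact Real.rpow_le_rpow_of_nonpos hx (le_of_lt ht) (by linarith)

/-- On the Riemann surface of the logarithm the incomplete gamma function is holomorphic, with the
expected derivative. -/
theorem hasDerivAt_upperGamma {a : ℂ} (ha : a.re ≤ 1) (ζ : ℂ) :
    HasDerivAt (upperGamma a) (-(exp (a * ζ) * exp (-exp ζ))) ζ := by
  set h : ℂ → ℂ := fun ζ => exp (a * ζ) * exp (-exp ζ) with hh
  have hd : Differentiable ℂ h := by fun_prop
  set T : ℂ := ∫ t in Ioi (1 : ℝ), (t : ℂ) ^ (a - 1) * exp (-(t : ℂ)) with hT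
  have hray : ∀ ρ : ℝ, ∫ t in Ioi (Real.exp ρ), (t : ℂ) ^ (a - 1) * exp (-(t : ℂ)) =
      T - ∫ x in (0 : ℝ)..ρ, h x := by
    intro ρ
    have h1 := intervalIntegral.integral_Ioi_sub_Ioi' (integrableOn_cpow_mul_exp_neg ha one_pos)
      (integrableOn_cpow_mul_exp_neg ha (Real.exp_pos ρ))
    have h2 := intervalIntegral.integral_deriv_smul_comp'' (a := 0) (b := ρ) (f := Real.exp)
      (f' := Real.exp) (g := fun t : ℝ => (t : ℂ) ^ (a - 1) * exp (-(t : ℂ)))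
      Real.continuous_exp.continuousOn (fun x _ => (Real.hasDerivAt_exp x).hasDerivWithinAt)
      Real.continuous_exp.continuousOn (by
        rintro t ⟨x, _, rfl⟩
        refine ContinuousAt.continuousWithinAt (ContinuousAt.mul ?_ (by fun_prop))
        exact continuousAt_ofReal_cpow_const _ _ (Or.inr (Real.exp_pos x).ne'))
    rw [Real.exp_zero] at h2
    have h3 : ∀ x : ℝ, Real.exp x • ((fun t : ℝ => (t : ℂ) ^ (a - 1) * exp (-(t : ℂ))) ∘ Real.exp) x =
        h x := by
      intro x
      simp only [Function.comp, hh, Complex.real_smul]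
      rw [Complex.cpow_def_of_ne_zero (Complex.ofReal_ne_zero.2 (Real.exp_pos x).ne'),
        ← Complex.ofReal_log (Real.exp_pos x).le, Real.log_exp, ← mul_assoc, Complex.ofReal_exp,
        ← Complex.exp_add]
      ring_nf
    simp only [h3] at h2
    rw [h2, hT, ← h1]
    ring
  have hform : upperGamma a = fun ζ => T - wedgeIntegral 0 ζ h := by
    ext ζ
    rw [upperGamma, hray, wedgeIntegral, intervalIntegral.integral_symm]
    simp only [hh, zero_re, zero_im, ofReal_zero, zero_mul, add_zero, smul_eq_mul, mul_assoc,
      intervalIntegral.integral_const_mul]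
    ring
  have hball : ζ ∈ Metric.ball (0 : ℂ) (‖ζ‖ + 1) := by simp
  have := (hd.differentiableOn (s := Metric.ball 0 (‖ζ‖ + 1))).isConservativeOn.hasDerivAt_wedgeIntegral
    hd.continuous.continuousOn hball
  rw [hform]
  exact this.const_sub T

theorem differentiable_terminantLambda {p : ℂ} (hp : 0 ≤ p.re) :
    Differentiable ℂ (terminantLambda p) := by
  have h1 : Differentiable ℂ (upperGamma (1 - p)) := fun ζ =>
    (hasDerivAt_upperGamma (by simpa using hp) ζ).differentiableAt
  unfold terminantLambda
  fun_prop

/-- `|1 + r e^(iψ)| ≥ (1 + r) cos (ψ/2)`. -/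
theorem one_add_mul_cos_le_norm (r ψ : ℝ) :
    (1 + r) * Real.cos (ψ / 2) ≤ ‖1 + r * exp (ψ * I)‖ := by
  have h1 : ‖1 + r * exp (ψ * I)‖ ^ 2 = 1 + 2 * r * Real.cos ψ + r ^ 2 := by
    rw [← Complex.normSq_eq_norm_sq, Complex.normSq_apply]
    simp only [add_re, one_re, add_im, one_im, re_ofReal_mul, im_ofReal_mul, exp_ofReal_mul_I_re,
      exp_ofReal_mul_I_im]
    have := Real.sin_sq_add_cos_sq ψ
    linear_combination r ^ 2 * this
  have h2 : Real.cos ψ = 2 * Real.cos (ψ / 2) ^ 2 - 1 := by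
    rw [← Real.cos_two_mul]
    ring_nf
  refine le_of_sq_le_sq ?_ (norm_nonneg _)
  rw [h1, h2]
  have := Real.cos_sq_le_one (ψ / 2)
  nlinarith [sq_nonneg (1 - r)]

/-- The integrand, along the ray from `e^ζ` in direction `θ`, of the incomplete gamma function
`Γ(1 - N, e^ζ)`. -/
noncomputable def rayIntegrand (θ : ℝ) (N : ℕ) (ζ : ℂ) (y : ℝ) : ℂ :=
  exp (θ * I) * (exp (-(exp ζ + y * exp (θ * I))) / (exp ζ + y * exp (θ * I)) ^ N)

theorem exp_add_ray_eq (θ : ℝ) (ζ : ℂ) (y : ℝ) :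
    exp ζ + y * exp (θ * I) =
      exp ζ * (1 + ((y * Real.exp (-ζ.re) : ℝ) : ℂ) * exp ((θ - ζ.im : ℝ) * I)) := by
  have h1 : exp ζ * (((Real.exp (-ζ.re) : ℝ) : ℂ) * exp ((θ - ζ.im : ℝ) * I)) = exp (θ * I) := by
    rw [Complex.ofReal_exp, ← Complex.exp_add, ← Complex.exp_add]
    congr 1
    push_cast
    nth_rw 1 [← Complex.re_add_im ζ]
    ring
  rw [← h1]
  push_cast
  ring

theorem norm_exp_add_ray_ge (θ : ℝ) (ζ : ℂ) {y : ℝ} :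
    (Real.exp ζ.re + y) * Real.cos ((θ - ζ.im) / 2) ≤ ‖exp ζ + y * exp (θ * I)‖ := by
  rw [exp_add_ray_eq, norm_mul, Complex.norm_exp]
  have h := one_add_mul_cos_le_norm (y * Real.exp (-ζ.re)) (θ - ζ.im)
  refine le_trans (le_of_eq ?_) (mul_le_mul_of_nonneg_left h (Real.exp_pos ζ.re).le)
  have : Real.exp ζ.re * Real.exp (-ζ.re) = 1 := by
    rw [← Real.exp_add, add_neg_cancel, Real.exp_zero]
  linear_combination (-(y * Real.cos ((θ - ζ.im) / 2))) * this

theorem cos_half_pos {θ : ℝ} {ζ : ℂ} (h : |ζ.im - θ| < Real.pi) :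
    0 < Real.cos ((θ - ζ.im) / 2) := by
  have := abs_lt.1 h
  exact Real.cos_pos_of_mem_Ioo ⟨by linarith, by linarith⟩

theorem exp_add_ray_ne_zero {θ : ℝ} {ζ : ℂ} (h : |ζ.im - θ| < Real.pi) {y : ℝ} (hy : 0 ≤ y) :
    exp ζ + y * exp (θ * I) ≠ 0 := by
  have h1 := norm_exp_add_ray_ge θ ζ (y := y)
  have h2 := cos_half_pos h
  have h3 : 0 < (Real.exp ζ.re + y) * Real.cos ((θ - ζ.im) / 2) := by positivity
  exact norm_pos_iff.1 (h3.trans_le h1)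

theorem norm_rayIntegrand_le {θ : ℝ} (N : ℕ) {ζ : ℂ} (h : |ζ.im - θ| < Real.pi) {y : ℝ}
    (hy : 0 ≤ y) :
    ‖rayIntegrand θ N ζ y‖ ≤ Real.exp (-(exp ζ).re) /
      (Real.exp ζ.re * Real.cos ((θ - ζ.im) / 2)) ^ N * Real.exp (-(Real.cos θ * y)) := by
  have h1 := norm_exp_add_ray_ge θ ζ (y := y)
  have h2 := cos_half_pos h
  have h3 : Real.exp ζ.re * Real.cos ((θ - ζ.im) / 2) ≤ ‖exp ζ + y * exp (θ * I)‖ := by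
    refine le_trans ?_ h1
    gcongr
    linarith
  have h4 : (-(exp ζ + y * exp (θ * I))).re = -(exp ζ).re + -(Real.cos θ * y) := by
    simp only [neg_re, add_re, re_ofReal_mul, exp_ofReal_mul_I_re]
    ring
  rw [rayIntegrand, norm_mul, Complex.norm_exp_ofReal_mul_I, one_mul, norm_div, norm_pow,
    Complex.norm_exp, h4, Real.exp_add, div_mul_eq_mul_div]
  gcongr

theorem isOpen_strip (θ r : ℝ) : IsOpen {ζ : ℂ | |ζ.im - θ| < r} :=
  isOpen_lt (by fun_prop) continuous_const

theorem convex_strip (θ r : ℝ) : Convex ℝ {ζ : ℂ | |ζ.im - θ| < r} := by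
  have : {ζ : ℂ | |ζ.im - θ| < r} = Complex.imLm ⁻¹' Metric.ball θ r := by
    ext ζ
    simp [Real.dist_eq]
  rw [this]
  exact (convex_ball θ r).linear_preimage _

theorem hasDerivAt_rayIntegral {θ : ℝ} (hθ : |θ| < Real.pi / 2) (N : ℕ) {ζ : ℂ}
    (hζ : |ζ.im - θ| < Real.pi) :
    HasDerivAt (fun ζ => ∫ y in Ioi (0 : ℝ), rayIntegrand θ N ζ y)
      (-(exp ζ * (exp (-exp ζ) / exp ζ ^ N))) ζ := by
  have hcosθ : 0 < Real.cos θ := by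
    have := abs_lt.1 hθ
    exact Real.cos_pos_of_mem_Ioo ⟨by linarith, by linarith⟩
  have hy0 : ∀ᵐ y ∂(volume.restrict (Ioi (0 : ℝ))), 0 < y := ae_restrict_mem measurableSet_Ioi
  -- derivatives of the integrand in both variables
  set G : ℂ → ℂ := fun v => exp (-v) / v ^ N with hG
  have hGd : ∀ v : ℂ, v ≠ 0 → DifferentiableAt ℂ G v := fun v hv =>
    DifferentiableAt.div (by fun_prop) (by fun_prop) (pow_ne_zero _ hv)
  have hdζ : ∀ ζ : ℂ, |ζ.im - θ| < Real.pi → ∀ y : ℝ, 0 ≤ y →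
      HasDerivAt (fun ζ => rayIntegrand θ N ζ y)
        (exp ζ * (exp (θ * I) * deriv G (exp ζ + y * exp (θ * I)))) ζ := by
    intro ζ hζ y hy
    have h1 := (hGd _ (exp_add_ray_ne_zero hζ hy)).hasDerivAt
    have h2 : HasDerivAt (fun ζ => exp ζ + y * exp (θ * I)) (exp ζ) ζ :=
      (Complex.hasDerivAt_exp ζ).add_const _
    have h3 := (h1.comp ζ h2).const_mul (exp (θ * I))
    convert! h3 using 1
    ring
  have hdy : ∀ y : ℝ, 0 ≤ y → HasDerivAt (fun y : ℝ => exp ζ * G (exp ζ + y * exp (θ * I)))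
      (exp ζ * (exp (θ * I) * deriv G (exp ζ + y * exp (θ * I)))) y := by
    intro y hy
    have h1 := (hGd _ (exp_add_ray_ne_zero hζ hy)).hasDerivAt
    have h2 : HasDerivAt (fun y : ℝ => exp ζ + y * exp (θ * I)) (exp (θ * I)) y := by
      have := ((hasDerivAt_id (y : ℂ)).comp_ofReal.mul_const (exp (θ * I))).const_add (exp ζ)
      simpa using this
    have h3 := (HasDerivAt.comp y h1 h2).const_mul (exp ζ)
    convert! h3 using 1
    ring
  have key := hasDerivAt_integral_of_dominated_holomorphic
    (μ := volume.restrict (Ioi (0 : ℝ))) (isOpen_strip θ Real.pi) (f := rayIntegrand θ N)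
    (fun ζ _ => by
      unfold rayIntegrand
      exact Measurable.aestronglyMeasurable (by fun_prop))
    (by
      filter_upwards [hy0] with y hy w hw
      exact (hdζ w hw y hy.le).differentiableAt.differentiableWithinAt)
    (by
      intro w hw
      set B : ℂ → ℝ := fun ζ => Real.exp (-(exp ζ).re) /
        (Real.exp ζ.re * Real.cos ((θ - ζ.im) / 2)) ^ N with hB
      have hBc : ContinuousAt B w := by
        have h1 := cos_half_pos (θ := θ) (ζ := w) hw
        refine ContinuousAt.div ?_ ?_ (by positivity)
        · fun_prop
        · fun_prop
      have h2 : ∀ᶠ v in 𝓝 w, B v < B w + 1 ∧ |v.im - θ| < Real.pi :=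
        (hBc.eventually_lt_const (lt_add_one _)).and ((isOpen_strip θ Real.pi).mem_nhds hw)
      obtain ⟨ε, hε, hball⟩ := Metric.eventually_nhds_iff_ball.1 h2
      refine ⟨ε, hε, fun y => (B w + 1) * Real.exp (-(Real.cos θ * y)),
        (integral_exp_neg_mul_Ioi_zero hcosθ).1.const_mul _, ?_⟩
      filter_upwards [hy0] with y hy v hv
      obtain ⟨h3, h4⟩ := hball v hv
      refine (norm_rayIntegrand_le N h4 hy.le).trans ?_
      gcongr) ζ hζ
  have hderiv : ∀ᵐ y ∂(volume.restrict (Ioi (0 : ℝ))), deriv (fun w => rayIntegrand θ N w y) ζ =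
      exp ζ * (exp (θ * I) * deriv G (exp ζ + y * exp (θ * I))) := by
    filter_upwards [hy0] with y hy using (hdζ ζ hζ y hy.le).deriv
  have hlim : Tendsto (fun y : ℝ => exp ζ * G (exp ζ + y * exp (θ * I))) atTop (𝓝 0) := by
    have h1 : Tendsto (fun y : ℝ => ‖exp ζ‖ * (Real.exp (-(exp ζ).re) /
        (Real.exp ζ.re * Real.cos ((θ - ζ.im) / 2)) ^ N * Real.exp (-(Real.cos θ * y)))) atTop
        (𝓝 (‖exp ζ‖ * (Real.exp (-(exp ζ).re) /
        (Real.exp ζ.re * Real.cos ((θ - ζ.im) / 2)) ^ N * 0))) := by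
      refine Tendsto.const_mul _ (Tendsto.const_mul _ ?_)
      exact Real.tendsto_exp_neg_atTop_nhds_zero.comp (tendsto_id.const_mul_atTop hcosθ)
    rw [mul_zero, mul_zero] at h1
    refine squeeze_zero_norm' ?_ h1
    filter_upwards [eventually_ge_atTop 0] with y hy
    have := norm_rayIntegrand_le N hζ hy
    rw [rayIntegrand, norm_mul, Complex.norm_exp_ofReal_mul_I, one_mul] at this
    rw [norm_mul]
    gcongr
  have hint := integral_Ioi_of_hasDerivAt_of_tendsto' (fun y (hy : y ∈ Ici 0) => hdy y hy)
    ((integrable_congr hderiv).1 key.1) hlim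
  have := key.2
  rw [integral_congr_ae hderiv, hint] at this
  simpa [hG] using this

theorem norm_rayIntegral_le {θ : ℝ} (hθ : |θ| < Real.pi / 2) (N : ℕ) {ζ : ℂ}
    (hζ : |ζ.im - θ| < Real.pi) :
    ‖∫ y in Ioi (0 : ℝ), rayIntegrand θ N ζ y‖ ≤ Real.exp (-(exp ζ).re) /
      (Real.exp ζ.re * Real.cos ((θ - ζ.im) / 2)) ^ N * (1 / Real.cos θ) := by
  have hcosθ : 0 < Real.cos θ := by
    have := abs_lt.1 hθ
    exact Real.cos_pos_of_mem_Ioo ⟨by linarith, by linarith⟩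
  obtain ⟨h1, h2⟩ := integral_exp_neg_mul_Ioi_zero hcosθ
  rw [← h2, ← integral_const_mul]
  refine norm_integral_le_of_norm_le (h1.const_mul _) ?_
  filter_upwards [ae_restrict_mem measurableSet_Ioi] with y hy
  exact norm_rayIntegrand_le N hζ (le_of_lt hy)

/-- The incomplete gamma function as an integral along a ray. Both sides have the same derivative
and tend to `0` along the positive real axis. -/
theorem upperGamma_eq_rayIntegral {θ : ℝ} (hθ : |θ| < Real.pi / 2) {N : ℕ} {ζ : ℂ}
    (hζ : |ζ.im - θ| < Real.pi) :
    upperGamma (1 - N) ζ = ∫ y in Ioi (0 : ℝ), rayIntegrand θ N ζ y := by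
  have hre : (1 - (N : ℂ)).re ≤ 1 := by simp
  set d : ℂ → ℂ := fun ζ => upperGamma (1 - N) ζ - ∫ y in Ioi (0 : ℝ), rayIntegrand θ N ζ y with hd
  have hd0 : ∀ ζ : ℂ, |ζ.im - θ| < Real.pi → HasDerivAt d 0 ζ := by
    intro ζ hζ
    have h := (hasDerivAt_upperGamma hre ζ).sub (hasDerivAt_rayIntegral hθ N hζ)
    convert! h using 1
    rw [sub_mul, one_mul, Complex.exp_sub, Complex.exp_nat_mul]
    ring
  have hconst : ∀ x : ℝ, d ζ = d x := by
    intro x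
    have hx : |(x : ℂ).im - θ| < Real.pi := by
      have := abs_lt.1 hθ
      rw [ofReal_im, abs_lt]
      constructor <;> linarith [Real.pi_pos]
    exact (isOpen_strip θ Real.pi).is_const_of_deriv_eq_zero (convex_strip θ Real.pi).isPreconnected
      (fun w hw => (hd0 w hw).differentiableAt.differentiableWithinAt)
      (fun w hw => (hd0 w hw).deriv) hζ hx
  have hlim1 : Tendsto (fun x : ℝ => upperGamma (1 - N) (x : ℂ)) atTop (𝓝 0) := by
    have h1 : ∀ x : ℝ, 0 ≤ x → ‖upperGamma (1 - N) (x : ℂ)‖ ≤ Real.exp (-Real.exp x) := by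
      intro x hx
      rw [upperGamma, ofReal_im, intervalIntegral.integral_same, zero_add, ofReal_re]
      rw [← integral_exp_neg_Ioi]
      refine norm_integral_le_of_norm_le (integrableOn_exp_neg_Ioi _) ?_
      filter_upwards [ae_restrict_mem measurableSet_Ioi] with t ht
      have ht1 : 1 < t := (Real.one_le_exp hx).trans_lt ht
      have ht0 : 0 < t := by linarith
      rw [norm_mul, Complex.norm_cpow_eq_rpow_re_of_pos ht0, Complex.norm_exp, neg_re, ofReal_re]
      refine mul_le_of_le_one_left (Real.exp_pos _).le
        (Real.rpow_le_one_of_one_le_of_nonpos ht1.le ?_)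
      simp
    refine squeeze_zero_norm' (a := fun x : ℝ => Real.exp (-Real.exp x)) ?_
      (Real.tendsto_exp_neg_atTop_nhds_zero.comp Real.tendsto_exp_atTop)
    filter_upwards [eventually_ge_atTop 0] with x hx using h1 x hx
  have hlim2 : Tendsto (fun x : ℝ => ∫ y in Ioi (0 : ℝ), rayIntegrand θ N (x : ℂ) y) atTop
      (𝓝 0) := by
    have hc : 0 < Real.cos (θ / 2) := by
      have := abs_lt.1 hθ
      exact Real.cos_pos_of_mem_Ioo ⟨by linarith [Real.pi_pos], by linarith [Real.pi_pos]⟩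
    have hcosθ : 0 < Real.cos θ := by
      have := abs_lt.1 hθ
      exact Real.cos_pos_of_mem_Ioo ⟨by linarith, by linarith⟩
    have h1 : Tendsto (fun x : ℝ => Real.exp (-Real.exp x) *
        (1 / Real.cos (θ / 2) ^ N * (1 / Real.cos θ))) atTop
        (𝓝 (0 * (1 / Real.cos (θ / 2) ^ N * (1 / Real.cos θ)))) :=
      Tendsto.mul_const _ (Real.tendsto_exp_neg_atTop_nhds_zero.comp Real.tendsto_exp_atTop)
    rw [zero_mul] at h1
    refine squeeze_zero_norm' ?_ h1
    filter_upwards [eventually_ge_atTop 0] with x hx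
    have hx' : |(x : ℂ).im - θ| < Real.pi := by
      have := abs_lt.1 hθ
      rw [ofReal_im, abs_lt]
      constructor <;> linarith [Real.pi_pos]
    refine (norm_rayIntegral_le hθ N hx').trans ?_
    rw [← Complex.ofReal_exp, ofReal_re, ofReal_re, ofReal_im, sub_zero, mul_pow, ← mul_assoc]
    gcongr ?_ * _
    rw [mul_one_div]
    gcongr
    exact le_mul_of_one_le_left (by positivity) (one_le_pow₀ (Real.one_le_exp hx))
  have hlim : Tendsto (fun x : ℝ => d x) atTop (𝓝 (0 - 0)) := hlim1.sub hlim2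
  have hz : d ζ = 0 := by
    have h1 : Tendsto (fun _ : ℝ => d ζ) atTop (𝓝 (0 - 0)) := by
      simpa only [← hconst] using hlim
    rw [sub_zero] at h1
    exact tendsto_nhds_unique tendsto_const_nhds h1
  exact sub_eq_zero.1 hz

/-- The terminant is bounded on every closed subsector of `|arg w| < 3π/2`. -/
theorem norm_terminantLambda_le {N : ℕ} {ζ : ℂ} (hζ : |ζ.im| < 3 * Real.pi / 2) :
    ‖terminantLambda N ζ‖ ≤ 1 / Real.cos (ζ.im / 3) ^ (N + 1) := by
  have hζ' := abs_lt.1 hζ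
  have h1 : |ζ.im / 3| < Real.pi / 2 := by
    rw [abs_lt]
    constructor <;> linarith
  have h2 : |ζ.im - ζ.im / 3| < Real.pi := by
    rw [abs_lt]
    constructor <;> linarith
  have h3 : Real.cos ((ζ.im / 3 - ζ.im) / 2) = Real.cos (ζ.im / 3) := by
    rw [← Real.cos_neg]
    ring_nf
  have hc : 0 < Real.cos (ζ.im / 3) := by
    have := abs_lt.1 h1
    exact Real.cos_pos_of_mem_Ioo ⟨by linarith, by linarith⟩
  rw [terminantLambda, upperGamma_eq_rayIntegral h1 h2, norm_mul, norm_mul]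
  have h4 := norm_rayIntegral_le h1 N h2
  rw [h3] at h4
  have h5 : ‖exp ((N : ℂ) * ζ)‖ = Real.exp ζ.re ^ N := by
    rw [Complex.exp_nat_mul, norm_pow, Complex.norm_exp]
  rw [h5, Complex.norm_exp]
  refine (mul_le_mul_of_nonneg_left h4 (by positivity)).trans (le_of_eq ?_)
  rw [Real.exp_neg, mul_pow, pow_succ]
  have := Real.exp_pos ζ.re
  have := Real.exp_pos (exp ζ).re
  field_simp

/-- At a positive argument the terminant is `∫ e^(-x) (1 + x/w)^(-N) dx`. -/
theorem terminantLambda_log {N : ℕ} {w : ℝ} (hw : 0 < w) :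
    terminantLambda N (Real.log w) = (realTerminant N w : ℂ) := by
  have h0 : |(0 : ℝ)| < Real.pi / 2 := by simp [Real.pi_pos]
  rw [terminantLambda, upperGamma_eq_rayIntegral h0 (by simp [Real.pi_pos]), realTerminant,
    Complex.exp_nat_mul, ← Complex.ofReal_exp, Real.exp_log hw, ← integral_complex_ofReal,
    ← integral_const_mul]
  refine setIntegral_congr_fun measurableSet_Ioi fun y hy => ?_
  have hy : 0 < y := hy
  simp only [rayIntegrand]
  have hexp : exp ((Real.log w : ℝ) : ℂ) = w := by
    rw [← Complex.ofReal_exp, Real.exp_log hw]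
  rw [hexp]
  simp only [ofReal_zero, zero_mul, Complex.exp_zero, one_mul, mul_one]
  push_cast
  have hw' : (w : ℂ) ≠ 0 := Complex.ofReal_ne_zero.2 hw.ne'
  have hwy : (w : ℂ) + y ≠ 0 := by
    exact_mod_cast (by positivity : w + y ≠ 0)
  rw [neg_add, Complex.exp_add, Complex.exp_neg (w : ℂ)]
  have h1 : 1 + (y : ℂ) / w = (w + y) / w := by field_simp
  rw [h1, div_pow]
  have := Complex.exp_ne_zero (w : ℂ)
  field_simp

/-! ### Pfaff's series -/

/-- The rising factorial `(a)_n = a (a + 1) ⋯ (a + n - 1)`. -/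
noncomputable abbrev poch (a : ℂ) (n : ℕ) : ℂ := (ascPochhammer ℂ n).eval a

theorem poch_succ (a : ℂ) (n : ℕ) : poch a (n + 1) = poch a n * (a + n) :=
  ascPochhammer_succ_eval n a

theorem poch_succ_left (a : ℂ) (n : ℕ) : poch a (n + 1) = a * poch (a + 1) n := by
  simp [poch, ascPochhammer_succ_left, Polynomial.eval_comp]

theorem poch_add (a : ℂ) (n m : ℕ) : poch a (n + m) = poch a n * poch (a + n) m := by
  simp [poch, ← ascPochhammer_mul, Polynomial.eval_comp]

theorem differentiable_poch (n : ℕ) : Differentiable ℂ fun a => poch a n :=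
  (ascPochhammer ℂ n).differentiable

theorem ringChoose_eq_ascPochhammer {R : Type*} [Field R] [CharZero R] [BinomialRing R] (a : R) (n : ℕ) :
    Ring.choose (a + n - 1) n = (ascPochhammer R n).eval a / n.factorial := by
  have h := Ring.factorial_nsmul_multichoose_eq_ascPochhammer a n
  rw [Polynomial.ascPochhammer_smeval_eq_eval, nsmul_eq_mul, Ring.multichoose_eq] at h
  have : (n.factorial : R) ≠ 0 := Nat.cast_ne_zero.2 n.factorial_ne_zero
  rw [← h]
  field_simp

/-- The binomial series. -/
theorem hasSum_poch (α : ℂ) {w : ℂ} (hw : ‖w‖ < 1) :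
    HasSum (fun m : ℕ => poch α m / m.factorial * w ^ m) (1 / (1 - w) ^ α) := by
  have h := (Complex.one_div_one_sub_cpow_hasFPowerSeriesOnBall_zero α).hasSum (y := w)
    (by rw [Metric.mem_eball, edist_zero_right, ← ofReal_norm]; exact ENNReal.ofReal_lt_one.2 hw)
  simpa [FormalMultilinearSeries.ofScalars, ringChoose_eq_ascPochhammer, zero_add] using h

theorem hasSum_real_ascPochhammer (s : ℝ) {x : ℝ} (hx : |x| < 1) :
    HasSum (fun m : ℕ => (ascPochhammer ℝ m).eval s / m.factorial * x ^ m) (1 / (1 - x) ^ s) := by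
  have h := (Real.one_div_one_sub_rpow_hasFPowerSeriesOnBall_zero s).hasSum (y := x)
    (by rw [Metric.mem_eball, edist_zero_right, ← ofReal_norm]; simpa using hx)
  simpa [FormalMultilinearSeries.ofScalars, ringChoose_eq_ascPochhammer, zero_add] using h

/-- The Chu–Vandermonde sum that turns Pfaff's series back into the hypergeometric series. -/
theorem sum_antidiagonal_chuVandermonde (a : ℂ) (k : ℕ) :
    ∑ ij ∈ Finset.HasAntidiagonal.antidiagonal k,
      (-1) ^ ij.1 * poch a ij.1 / (((ij.1 + 1).factorial : ℂ) * ij.1.factorial * ij.2.factorial) =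
    poch (2 - a) k / ((k.factorial : ℂ) * (k + 1).factorial) := by
  have h := Ring.descPochhammer_smeval_add (r := -a) (s := ((k + 1 : ℕ) : ℂ)) k
    (Commute.all _ _)
  have e : -a + ((k + 1 : ℕ) : ℂ) - k + 1 = 2 - a := by
    push_cast
    ring
  rw [Polynomial.descPochhammer_smeval_eq_ascPochhammer,
    Polynomial.ascPochhammer_smeval_eq_eval, e] at h
  rw [poch, h, Finset.sum_div]
  refine Finset.sum_congr rfl fun ij hij => ?_
  obtain ⟨i, j⟩ := ij
  have hij : i + j = k := by simpa using hij
  have h1 := Polynomial.ascPochhammer_smeval_neg_eq_descPochhammer (-a) i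
  rw [neg_neg, Polynomial.ascPochhammer_smeval_eq_eval] at h1
  have h2 : (-1 : ℂ) ^ i * poch a i = (descPochhammer ℤ i).smeval (-a) := by
    rw [poch, h1, Int.negOnePow_def, zpow_natCast, Units.smul_def, zsmul_eq_mul, ← mul_assoc]
    push_cast
    rw [← mul_pow]
    norm_num
  have h3 : ((i + 1).factorial : ℂ) * (k + 1).descFactorial j = (k + 1).factorial := by
    have := Nat.factorial_mul_descFactorial (show j ≤ k + 1 by omega)
    rw [show k + 1 - j = i + 1 by omega] at this
    exact_mod_cast this
  have h4 : (k.choose i : ℂ) * i.factorial * j.factorial = k.factorial := by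
    have := Nat.choose_mul_factorial_mul_factorial (show i ≤ k by omega)
    rw [show k - i = j by omega] at this
    exact_mod_cast this
  simp only
  rw [h2, Polynomial.descPochhammer_smeval_eq_descFactorial, ← h3, ← h4]
  have hf : ∀ m : ℕ, (m.factorial : ℂ) ≠ 0 := fun m => Nat.cast_ne_zero.2 m.factorial_ne_zero
  have h5 : ((k + 1).descFactorial j : ℂ) ≠ 0 := by
    intro h0
    rw [h0, mul_zero] at h3
    exact hf _ h3.symm
  have h6 : (k.choose i : ℂ) ≠ 0 := by
    intro h0
    rw [h0, zero_mul, zero_mul] at h4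
    exact hf _ h4.symm
  have := hf i
  have := hf j
  have := hf (i + 1)
  field_simp

/-- Coefficients of the series that Pfaff's transformation attaches to `(a)_n (1 - a)_n`. -/
noncomputable def pfaffCoeff (a : ℂ) (n : ℕ) : ℂ :=
  poch (a + 1) n * poch a n / ((n + 1).factorial * n.factorial)

/-- The series `₂F₁(a, a + 1; 2; x)`. -/
noncomputable def pfaffSum (a x : ℂ) : ℂ := ∑' n : ℕ, pfaffCoeff a n * x ^ n

/-- Comparison with the binomial series `∑ (s)_n xⁿ / n!`: the ratio of consecutive coefficients is
bounded by that of the binomial series, up to a factor `L` at the first `K` steps. -/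
theorem norm_pfaffCoeff_le_of_ratio_le {a : ℂ} {s L : ℝ} {K : ℕ} (hs : 0 < s) (hL : 1 ≤ L)
    (h1 : ∀ k < K, ‖a + k‖ * ‖a + 1 + k‖ ≤ L * ((s + k) * (k + 2)))
    (h2 : ∀ k, K ≤ k → ‖a + k‖ * ‖a + 1 + k‖ ≤ (s + k) * (k + 2)) (n : ℕ) :
    ‖pfaffCoeff a n‖ ≤ L ^ K * ((ascPochhammer ℝ n).eval s / n.factorial) := by
  have key : ∀ n, ‖pfaffCoeff a n‖ ≤ L ^ (min n K) * ((ascPochhammer ℝ n).eval s / n.factorial) := by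
    intro n
    induction n with
    | zero => simp [pfaffCoeff, poch]
    | succ n ih =>
      have e1 : pfaffCoeff a (n + 1) = pfaffCoeff a n * ((a + n) * (a + 1 + n)) / ((n + 2) * (n + 1)) := by
        rw [pfaffCoeff, pfaffCoeff, poch_succ, poch_succ, Nat.factorial_succ (n + 1),
          Nat.factorial_succ n]
        push_cast
        have : (n.factorial : ℂ) ≠ 0 := Nat.cast_ne_zero.2 n.factorial_ne_zero
        have : (n : ℂ) + 1 ≠ 0 := Nat.cast_add_one_ne_zero n
        have : (n : ℂ) + 1 + 1 ≠ 0 := by exact_mod_cast Nat.cast_add_one_ne_zero (R := ℂ) (n + 1)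
        have : (n : ℂ) + 2 ≠ 0 := by rwa [show (n : ℂ) + 2 = n + 1 + 1 by ring]
        field_simp
        ring
      have e2 : (ascPochhammer ℝ (n + 1)).eval s / ((n + 1).factorial : ℝ) =
          (ascPochhammer ℝ n).eval s / n.factorial * ((s + n) / (n + 1)) := by
        rw [ascPochhammer_succ_eval, Nat.factorial_succ]
        push_cast
        field_simp
      have hc : 0 ≤ (ascPochhammer ℝ n).eval s / (n.factorial : ℝ) := by
        have := (ascPochhammer_pos n s hs).le
        positivity
      have hn : ‖((n : ℂ) + 2) * (n + 1)‖ = ((n : ℝ) + 2) * (n + 1) := by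
        rw [show ((n : ℂ) + 2) * (n + 1) = (((n : ℝ) + 2) * (n + 1) : ℝ) by push_cast; ring,
          Complex.norm_real, Real.norm_of_nonneg (by positivity)]
      have h3 : ‖a + n‖ * ‖a + 1 + n‖ ≤ L ^ (min (n + 1) K - min n K) * ((s + n) * (n + 2)) := by
        rcases lt_or_ge n K with h | h
        · rw [min_eq_left h, min_eq_left h.le, Nat.add_sub_cancel_left, pow_one]
          exact h1 n h
        · rw [min_eq_right h, min_eq_right (h.trans n.le_succ), Nat.sub_self, pow_zero, one_mul]
          exact h2 n h
      have h4 : L ^ min (n + 1) K = L ^ min n K * L ^ (min (n + 1) K - min n K) := by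
        rw [← pow_add, Nat.add_sub_cancel' (min_le_min_right K n.le_succ)]
      rw [e1, norm_div, norm_mul, norm_mul, hn, e2, h4, div_le_iff₀ (by positivity)]
      calc ‖pfaffCoeff a n‖ * (‖a + n‖ * ‖a + 1 + n‖) ≤
          (L ^ (min n K) * ((ascPochhammer ℝ n).eval s / n.factorial)) *
            (L ^ (min (n + 1) K - min n K) * ((s + n) * (n + 2))) := by gcongr
        _ = _ := by
          field_simp
  refine (key n).trans ?_
  have := (ascPochhammer_pos n s hs).le
  gcongr
  exact min_le_right n K

theorem norm_pfaffCoeff_le {a : ℂ} {A : ℝ} (ha : ‖a‖ ≤ A) (n : ℕ) :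
    ‖pfaffCoeff a n‖ ≤ (ascPochhammer ℝ n).eval (A ^ 2 + 2 * A + 1) / n.factorial := by
  have hA : 0 ≤ A := (norm_nonneg a).trans ha
  have := norm_pfaffCoeff_le_of_ratio_le (a := a) (s := A ^ 2 + 2 * A + 1) (L := 1) (K := 0) (by positivity) le_rfl
    (fun k hk => absurd hk (Nat.not_lt_zero k)) (fun k _ => ?_) n
  · simpa using this
  · have h1 : ‖a + k‖ ≤ A + k := (norm_add_le _ _).trans (by simpa using ha)
    have h2 : ‖a + 1 + k‖ ≤ A + 1 + k := (norm_add_le _ _).trans (by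
      simpa using (norm_add_le a 1).trans (by simpa using ha))
    calc _ ≤ (A + k) * (A + 1 + k) := by gcongr
      _ ≤ _ := by nlinarith [mul_nonneg hA (Nat.cast_nonneg (α := ℝ) k), sq_nonneg A,
          mul_nonneg (sq_nonneg A) (Nat.cast_nonneg (α := ℝ) k)]

theorem differentiable_pfaffSum_left {x : ℂ} (hx : ‖x‖ < 1) :
    Differentiable ℂ fun a => pfaffSum a x := by
  intro a₀
  set A := ‖a₀‖ + 1
  have hU : IsOpen (Metric.ball (0 : ℂ) A) := Metric.isOpen_ball
  have hs := hasSum_real_ascPochhammer (A ^ 2 + 2 * A + 1) (x := ‖x‖) (by simpa using hx)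
  refine (differentiableOn_tsum_of_summable_norm (U := Metric.ball (0 : ℂ) A)
    (F := fun n a => pfaffCoeff a n * x ^ n) hs.summable ?_ hU ?_).differentiableAt
      (hU.mem_nhds (by simp [A]))
  · intro n a _
    refine DifferentiableAt.differentiableWithinAt ?_
    unfold pfaffCoeff
    have h1 := (differentiable_poch n) (a + 1)
    have h2 := (differentiable_poch n) a
    have h3 : DifferentiableAt ℂ (fun a => poch (a + 1) n) a :=
      DifferentiableAt.comp (f := fun a : ℂ => a + 1) (g := fun a => poch a n) a h1 (by fun_prop)
    exact ((h3.mul h2).div_const _).mul_const _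
  · intro n a ha
    rw [norm_mul, norm_pow]
    gcongr
    exact norm_pfaffCoeff_le (by simpa using (Metric.mem_ball.1 ha).le) n

theorem differentiableOn_pfaffSum (a : ℂ) : DifferentiableOn ℂ (pfaffSum a) (Metric.ball 0 1) := by
  intro x₀ hx₀
  have hx₀ : ‖x₀‖ < 1 := by simpa using hx₀
  obtain ⟨r, hr, hr1⟩ := exists_between hx₀
  have hr0 : 0 ≤ r := (norm_nonneg _).trans hr.le
  have hU : IsOpen (Metric.ball (0 : ℂ) r) := Metric.isOpen_ball
  have hs := hasSum_real_ascPochhammer (‖a‖ ^ 2 + 2 * ‖a‖ + 1) (x := r) (by rwa [abs_of_nonneg hr0])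
  refine ((differentiableOn_tsum_of_summable_norm (U := Metric.ball (0 : ℂ) r)
    (F := fun n x => pfaffCoeff a n * x ^ n) hs.summable ?_ hU ?_).differentiableAt
      (hU.mem_nhds (by simpa using hr))).differentiableWithinAt
  · intro n
    fun_prop
  · intro n x hx
    have hx : ‖x‖ < r := by simpa using hx
    have h := norm_pfaffCoeff_le (le_refl ‖a‖) n
    have := (norm_nonneg _).trans h
    rw [norm_mul, norm_pow]
    gcongr

/-- The bound `O((1 - |x|)^(-s))` inherited from the binomial series. -/
theorem norm_pfaffSum_le {a : ℂ} {s L : ℝ} {K : ℕ} (hs : 0 < s) (hL : 1 ≤ L)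
    (h1 : ∀ k < K, ‖a + k‖ * ‖a + 1 + k‖ ≤ L * ((s + k) * (k + 2)))
    (h2 : ∀ k, K ≤ k → ‖a + k‖ * ‖a + 1 + k‖ ≤ (s + k) * (k + 2)) {x : ℂ} (hx : ‖x‖ < 1) :
    ‖pfaffSum a x‖ ≤ L ^ K * (1 / (1 - ‖x‖) ^ s) := by
  have hs' := (hasSum_real_ascPochhammer s (x := ‖x‖) (by simpa using hx)).mul_left (L ^ K)
  refine tsum_of_norm_bounded hs' fun n => ?_
  rw [norm_mul, norm_pow, ← mul_assoc]
  gcongr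
  exact norm_pfaffCoeff_le_of_ratio_le hs hL h1 h2 n

/-! ### The regularized hypergeometric function -/

theorem exists_norm_poch_le (α : ℂ) : ∃ C : ℝ, 0 ≤ C ∧ ∀ j : ℕ, ‖poch α j‖ ≤ C * (2 ^ j * j.factorial) := by
  have h := (hasSum_poch α (w := 1 / 2) (by norm_num)).summable.norm.tendsto_atTop_zero.bddAbove_range
  obtain ⟨C, hC⟩ := h
  have hC : ∀ j : ℕ, ‖poch α j / j.factorial * (1 / 2) ^ j‖ ≤ C := fun j => hC ⟨j, rfl⟩
  refine ⟨C, (norm_nonneg _).trans (hC 0), fun j => ?_⟩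
  have := hC j
  have hj : (0 : ℝ) < j.factorial := Nat.cast_pos.2 j.factorial_pos
  have h2 : ‖(1 / 2 : ℂ) ^ j‖ = (2 ^ j)⁻¹ := by
    simp
  rw [norm_mul, norm_div, h2, Complex.norm_natCast] at this
  field_simp at this
  linarith

/-- At `c = 0` the constant term drops out, because `1 / Γ(0) = 0`. -/
theorem regHypergeomSeries_zero (a b w : ℂ) :
    regHypergeomSeries a b 0 w = a * b * w * ∑' k : ℕ, poch (a + 1) k * poch (b + 1) k /
      ((k.factorial : ℂ) * (k + 1).factorial) * w ^ k := by
  rw [regHypergeomSeries, ← tsum_mul_left, ← Nat.succ_injective.tsum_eq]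
  · refine tsum_congr fun k => ?_
    have := poch_succ_left a k
    have h2 := poch_succ_left b k
    rw [poch] at this h2
    rw [Nat.succ_eq_add_one, this, h2, zero_add, Nat.cast_add_one, Complex.Gamma_nat_eq_factorial,
      pow_succ]
    ring
  · intro n hn
    cases n with
    | zero => simp at hn
    | succ n => exact ⟨n, rfl⟩

/-- The continuation of `𝐅(a, 1 - a; 0; w)` to the half-plane `Re w < 1/2` by Pfaff's
transformation. -/
noncomputable def hyperCont (a w : ℂ) : ℂ :=
  a * (1 - a) * w * ((1 - w) ^ (-(a + 1)) * pfaffSum a (w / (w - 1)))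

theorem norm_div_sub_one_lt {w : ℂ} (hw : w.re < 1 / 2) : ‖w / (w - 1)‖ < 1 := by
  have h0 : w - 1 ≠ 0 := by
    intro h
    have := congrArg Complex.re h
    simp at this
    linarith
  rw [norm_div, div_lt_one (norm_pos_iff.2 h0), ← sq_lt_sq₀ (norm_nonneg _) (norm_nonneg _),
    ← Complex.normSq_eq_norm_sq, ← Complex.normSq_eq_norm_sq, Complex.normSq_apply,
    Complex.normSq_apply]
  simp
  nlinarith

theorem isOpen_re_lt_half : IsOpen {w : ℂ | w.re < 1 / 2} :=
  isOpen_lt Complex.continuous_re continuous_const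

theorem differentiableOn_hyperCont (a : ℂ) : DifferentiableOn ℂ (hyperCont a) {w | w.re < 1 / 2} := by
  intro w hw
  have hw : w.re < 1 / 2 := hw
  have hs : 1 - w ∈ Complex.slitPlane := by
    refine Or.inl ?_
    simp
    linarith
  have h0 : w - 1 ≠ 0 := by
    intro h
    rw [← neg_sub, h, neg_zero] at hs
    exact Complex.slitPlane_ne_zero hs rfl
  have h1 : DifferentiableAt ℂ (fun w : ℂ => w / (w - 1)) w := by
    fun_prop (disch := assumption)
  have h2 : DifferentiableAt ℂ (pfaffSum a) (w / (w - 1)) :=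
    (differentiableOn_pfaffSum a).differentiableAt (Metric.isOpen_ball.mem_nhds
      (by simpa using norm_div_sub_one_lt hw))
  have h3 : DifferentiableAt ℂ (fun w : ℂ => (1 - w) ^ (-(a + 1))) w :=
    DifferentiableAt.cpow_const (by fun_prop) hs
  refine DifferentiableAt.differentiableWithinAt ?_
  unfold hyperCont
  have h4 := DifferentiableAt.comp w h2 h1
  exact DifferentiableAt.mul (by fun_prop) (h3.mul h4)

/-- Absolute convergence of the double series that arises when each factor `(1 - w)^(-(a+1+n))` of
Pfaff's transformation is expanded in powers of `w`. -/
theorem summable_pfaff_double (a : ℂ) {w : ℂ} (hw : ‖w‖ ≤ 1 / 16) :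
    Summable fun p : ℕ × ℕ => (-1) ^ p.1 * poch a p.1 * poch (a + 1) (p.1 + p.2) /
      (((p.1 + 1).factorial : ℂ) * p.1.factorial * p.2.factorial) * w ^ (p.1 + p.2) := by
  obtain ⟨C, hC0, hC⟩ := exists_norm_poch_le a
  obtain ⟨D, hD0, hD⟩ := exists_norm_poch_le (a + 1)
  refine Summable.of_norm_bounded ((summable_geometric_two.mul_of_nonneg summable_geometric_two
    (fun n => by positivity) (fun n => by positivity)).mul_left (C * D)) ?_
  rintro ⟨n, m⟩
  have hch : ((n + m).choose n : ℝ) ≤ 2 ^ (n + m) := by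
    exact_mod_cast Nat.choose_le_two_pow (n + m) n
  have hfac : ((n + m).factorial : ℝ) = (n + m).choose n * n.factorial * m.factorial := by
    have := Nat.choose_mul_factorial_mul_factorial (Nat.le_add_right n m)
    rw [Nat.add_sub_cancel_left] at this
    exact_mod_cast this.symm
  have hn1 : (n.factorial : ℝ) ≤ (n + 1).factorial := by
    exact_mod_cast Nat.factorial_le n.le_succ
  have hn : (0 : ℝ) < n.factorial := Nat.cast_pos.2 n.factorial_pos
  have hm : (0 : ℝ) < m.factorial := Nat.cast_pos.2 m.factorial_pos
  have hn' : (0 : ℝ) < (n + 1).factorial := Nat.cast_pos.2 (n + 1).factorial_pos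
  simp only [norm_mul, norm_div, norm_pow, norm_neg, norm_one, one_pow, one_mul,
    Complex.norm_natCast]
  calc ‖poch a n‖ * ‖poch (a + 1) (n + m)‖ / ((n + 1).factorial * n.factorial * m.factorial) *
        ‖w‖ ^ (n + m)
      ≤ C * (2 ^ n * (n + 1).factorial) * (D * (2 ^ (n + m) * (2 ^ (n + m) * n.factorial * m.factorial))) /
        ((n + 1).factorial * n.factorial * m.factorial) * (1 / 16) ^ (n + m) := by
        gcongr
        · refine (hC n).trans ?_
          gcongr
        · refine (hD (n + m)).trans ?_
          rw [hfac]
          gcongr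
    _ = C * D * (2 ^ n * 2 ^ (n + m) * 2 ^ (n + m) * (1 / 16) ^ (n + m)) := by
        field_simp
    _ ≤ C * D * ((1 / 2) ^ n * (1 / 2) ^ m) := by
        have e : (2 : ℝ) ^ n * 2 ^ (n + m) * 2 ^ (n + m) * (1 / 16) ^ (n + m) =
            (1 / 2) ^ n * (1 / 4) ^ m := by
          rw [pow_add, pow_add, show (2 : ℝ) ^ n * (2 ^ n * 2 ^ m) * (2 ^ n * 2 ^ m) *
            ((1 / 16) ^ n * (1 / 16) ^ m) = (2 ^ n * 2 ^ n * 2 ^ n * (1 / 16) ^ n) *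
              (2 ^ m * 2 ^ m * (1 / 16) ^ m) by ring]
          simp only [← mul_pow]
          norm_num
        rw [e]
        gcongr
        norm_num

theorem tsum_prod_eq_tsum_antidiagonal {f : ℕ × ℕ → ℂ} (hf : Summable f) :
    ∑' n, ∑' m, f (n, m) = ∑' k, ∑ p ∈ Finset.HasAntidiagonal.antidiagonal k, f p := by
  have h := ((Finset.HasAntidiagonal.sigmaAntidiagonalEquivProd.summable_iff).2 hf).tsum_sigma'
    (fun n => (hasSum_fintype _).summable)
  rw [← hf.tsum_prod, ← Finset.HasAntidiagonal.sigmaAntidiagonalEquivProd.tsum_eq f]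
  refine h.trans (tsum_congr fun k => ?_)
  rw [← Finset.sum_finset_coe, ← tsum_fintype (L := .unconditional _)]
  rfl

/-- Pfaff's transformation, near the origin. -/
theorem hyperCont_eq_regHypergeomSeries (a : ℂ) {w : ℂ} (hw : ‖w‖ ≤ 1 / 16) :
    hyperCont a w = regHypergeomSeries a (1 - a) 0 w := by
  have hsum := summable_pfaff_double a hw
  have hw1 : ‖w‖ < 1 := hw.trans_lt (by norm_num)
  have h0 : 1 - w ≠ 0 := by
    intro h
    rw [← sub_eq_zero.1 h] at hw1
    simp at hw1
  have h1 : ∀ n : ℕ, ∑' m : ℕ, (-1) ^ n * poch a n * poch (a + 1) (n + m) /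
      (((n + 1).factorial : ℂ) * n.factorial * m.factorial) * w ^ (n + m) =
      (1 - w) ^ (-(a + 1)) * (pfaffCoeff a n * (w / (w - 1)) ^ n) := by
    intro n
    have hs := (hasSum_poch (a + 1 + n) hw1).tsum_eq
    have e : (1 : ℂ) / (1 - w) ^ (a + 1 + n) = (1 - w) ^ (-(a + 1)) * ((1 - w) ^ n)⁻¹ := by
      rw [Complex.cpow_add _ _ h0, Complex.cpow_natCast, Complex.cpow_neg, one_div, mul_inv]
    rw [e] at hs
    have e2 : (w / (w - 1)) ^ n = (-1) ^ n * w ^ n * ((1 - w) ^ n)⁻¹ := by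
      rw [← neg_sub 1 w, div_neg, neg_pow, div_pow]
      ring
    rw [e2, show (1 - w) ^ (-(a + 1)) * (pfaffCoeff a n * ((-1) ^ n * w ^ n * ((1 - w) ^ n)⁻¹)) =
      pfaffCoeff a n * ((-1) ^ n * w ^ n) * ((1 - w) ^ (-(a + 1)) * ((1 - w) ^ n)⁻¹) by ring,
      ← hs, ← tsum_mul_left]
    refine tsum_congr fun m => ?_
    rw [poch_add, pfaffCoeff, pow_add]
    ring
  have h2 : ∀ k : ℕ, ∑ p ∈ Finset.HasAntidiagonal.antidiagonal k,
      (-1) ^ p.1 * poch a p.1 * poch (a + 1) (p.1 + p.2) /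
      (((p.1 + 1).factorial : ℂ) * p.1.factorial * p.2.factorial) * w ^ (p.1 + p.2) =
      poch (a + 1) k * poch (1 - a + 1) k / ((k.factorial : ℂ) * (k + 1).factorial) * w ^ k := by
    intro k
    rw [show 1 - a + 1 = 2 - a by ring, mul_div_assoc, ← sum_antidiagonal_chuVandermonde,
      Finset.mul_sum, Finset.sum_mul]
    refine Finset.sum_congr rfl fun p hp => ?_
    have hp : p.1 + p.2 = k := by simpa using hp
    rw [hp]
    ring
  rw [regHypergeomSeries_zero, hyperCont, pfaffSum, ← tsum_mul_left]
  congr 1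
  rw [← tsum_congr h1, ← tsum_congr h2]
  exact tsum_prod_eq_tsum_antidiagonal hsum

theorem segment_subset_re_lt_half {t : ℝ} (ht : 0 ≤ t) :
    segment ℝ (0 : ℂ) (-(t : ℂ)) ⊆ {w : ℂ | w.re < 1 / 2} := by
  refine (convex_halfSpace_re_lt (1 / 2)).segment_subset ?_ ?_
  · simp
  · simp
    linarith

/-- The regularized hypergeometric function at a nonpositive argument is given by any holomorphic
function on `Re w < 1/2` that agrees with the series near the origin. -/
theorem regHypergeom_eq_of_differentiableOn {a b : ℂ} {f : ℂ → ℂ}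
    (hf : DifferentiableOn ℂ f {w | w.re < 1 / 2}) (h0 : f =ᶠ[𝓝 0] regHypergeomSeries a b 0)
    {t : ℝ} (ht : 0 ≤ t) : regHypergeom a b 0 (-t) = f (-t) := by
  have h : IsRegHypergeomValue a b 0 (-t) (f (-t)) :=
    ⟨f, fun w hw => hf.analyticAt (isOpen_re_lt_half.mem_nhds (segment_subset_re_lt_half ht hw)),
      h0, rfl⟩
  exact (Classical.epsilon_spec (p := IsRegHypergeomValue a b 0 (-t)) ⟨_, h⟩).unique h

theorem regHypergeom_eq_hyperCont (a : ℂ) {t : ℝ} (ht : 0 ≤ t) :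
    regHypergeom a (1 - a) 0 (-t) = hyperCont a (-t) := by
  refine regHypergeom_eq_of_differentiableOn (differentiableOn_hyperCont a) ?_ ht
  filter_upwards [Metric.closedBall_mem_nhds (0 : ℂ) (show (0 : ℝ) < 1 / 16 by norm_num)] with w hw
  exact hyperCont_eq_regHypergeomSeries a (by simpa using hw)

theorem regHypergeom_comm (a b : ℂ) (w : ℂ) : regHypergeom a b 0 w = regHypergeom b a 0 w := by
  have : regHypergeomSeries a b 0 = regHypergeomSeries b a 0 := by
    ext w
    simp only [regHypergeomSeries, mul_comm ((ascPochhammer ℂ _).eval a)]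
  unfold regHypergeom IsRegHypergeomValue
  rw [this]

section density

variable {ν : ℝ}

/-- The weight decays like `e^(-2r)`, since `(1 + x)² / (2 x) ≥ 2`; half of this decay absorbs
`e^r`. -/
theorem integrableOn_mul_besselWeight_mul_exp (hν : 0 < ν) (hν2 : ν < 1 / 2) :
    IntegrableOn (fun r : ℝ => r * besselWeight ν r * Real.exp r) (Ioi 0) := by
  have hm := measurable_besselWeight ν
  have h := (integrableOn_Ioi_comp_mul_left_iff (fun r : ℝ => r ^ 1 * besselWeight ν r) 0
    (show (0 : ℝ) < 1 / 2 by norm_num)).2 (by simpa using integrableOn_pow_mul_besselWeight hν hν2 1)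
  refine Integrable.mono' (Integrable.const_mul h (2 * 2 ^ (-(1 / 2) : ℝ)))
    (Measurable.aestronglyMeasurable (by fun_prop)) ?_
  filter_upwards [ae_restrict_mem measurableSet_Ioi] with r hr
  have hr : 0 < r := hr
  have hk := besselWeight_nonneg ν hr
  rw [Real.norm_of_nonneg (by positivity)]
  have h1 : besselKInt ν r * Real.exp r ≤ besselKInt ν (1 / 2 * r) := by
    rw [besselKInt, besselKInt, ← integral_mul_const]
    refine setIntegral_mono_on ((integrableOn_besselKInt hν hr).mul_const _)
      (integrableOn_besselKInt hν (by positivity)) measurableSet_Ioi fun x hx => ?_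
    have hx : 0 < x := hx
    rw [mul_assoc, ← Real.exp_add]
    have h2 : 2 ≤ (1 + x) ^ 2 / (2 * x) := by
      rw [le_div_iff₀ (by positivity)]
      nlinarith [sq_nonneg (x - 1)]
    gcongr
    nlinarith
  have h3 : (1 / 2 * r) ^ (-(1 / 2) : ℝ) = (1 / 2 : ℝ) ^ (-(1 / 2) : ℝ) * r ^ (-(1 / 2) : ℝ) :=
    Real.mul_rpow (by norm_num) hr.le
  have h4 : (2 : ℝ) ^ (-(1 / 2) : ℝ) * (1 / 2 : ℝ) ^ (-(1 / 2) : ℝ) = 1 := by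
    rw [← Real.mul_rpow (by norm_num) (by norm_num)]
    norm_num
  rw [besselWeight, besselWeight, h3, pow_one]
  calc r * ((√(2 * Real.pi))⁻¹ * (r ^ (-(1 / 2) : ℝ) * besselKInt ν r)) * Real.exp r
      = r * ((√(2 * Real.pi))⁻¹ * (r ^ (-(1 / 2) : ℝ) * (besselKInt ν r * Real.exp r))) := by ring
    _ ≤ r * ((√(2 * Real.pi))⁻¹ * (r ^ (-(1 / 2) : ℝ) * besselKInt ν (1 / 2 * r))) := by gcongr
    _ = (2 : ℝ) ^ (-(1 / 2) : ℝ) * (1 / 2 : ℝ) ^ (-(1 / 2) : ℝ) *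
        (r * ((√(2 * Real.pi))⁻¹ * (r ^ (-(1 / 2) : ℝ) * besselKInt ν (1 / 2 * r)))) := by
      rw [h4, one_mul]
    _ = _ := by ring

/-- The Laplace integral of `besselDensity`, at a complex argument. -/
noncomputable def densityLaplace (ν : ℝ) (w : ℂ) : ℂ :=
  ∫ r in Ioi (0 : ℝ), ((r * besselWeight ν r : ℝ) : ℂ) * exp (2 * w * r)

theorem differentiableOn_densityLaplace (hν : 0 < ν) (hν2 : ν < 1 / 2) :
    DifferentiableOn ℂ (densityLaplace ν) {w | w.re < 1 / 2} := by
  have hm := measurable_besselWeight ν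
  refine differentiableOn_integral_of_dominated isOpen_re_lt_half
    (f := fun w (r : ℝ) => ((r * besselWeight ν r : ℝ) : ℂ) * exp (2 * w * r)) ?_ ?_ ?_
  · intro w _
    exact Measurable.aestronglyMeasurable (by fun_prop)
  · refine Eventually.of_forall fun r => ?_
    fun_prop
  · intro w hw
    obtain ⟨ε, hε, hb⟩ := Metric.isOpen_iff.1 isOpen_re_lt_half w hw
    refine ⟨ε, hε, _, integrableOn_mul_besselWeight_mul_exp hν hν2, ?_⟩
    filter_upwards [ae_restrict_mem measurableSet_Ioi] with r hr w hw
    have hr : 0 < r := hr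
    have hk := besselWeight_nonneg ν hr
    have hw : w.re < 1 / 2 := hb hw
    rw [norm_mul, Complex.norm_real, Real.norm_of_nonneg (by positivity), Complex.norm_exp]
    gcongr
    simp
    nlinarith

theorem hasSum_real_exp (x : ℝ) :
    HasSum (fun n : ℕ => x ^ n / n.factorial) (Real.exp x) := by
  rw [Real.exp_eq_exp_ℝ]
  exact NormedSpace.expSeries_div_hasSum_exp x

theorem hasSum_complex_exp (x : ℂ) :
    HasSum (fun n : ℕ => x ^ n / n.factorial) (exp x) := by
  rw [Complex.exp_eq_exp_ℂ]
  exact NormedSpace.expSeries_div_hasSum_exp x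

theorem densityLaplace_eq_tsum (hν : 0 < ν) (hν2 : ν < 1 / 2) {w : ℂ} (hw : ‖w‖ < 1 / 2) :
    densityLaplace ν w = ∑' n : ℕ, (2 * w) ^ n / n.factorial *
      ((∫ r in Ioi (0 : ℝ), r ^ (n + 1) * besselWeight ν r : ℝ) : ℂ) := by
  have hm := measurable_besselWeight ν
  have hb : ∀ᵐ r ∂volume.restrict (Ioi (0 : ℝ)), ∀ n : ℕ,
      ‖((r * besselWeight ν r : ℝ) : ℂ) * ((2 * w * r) ^ n / n.factorial)‖ ≤
        r * besselWeight ν r * ((‖2 * w‖ * r) ^ n / n.factorial) := by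
    filter_upwards [ae_restrict_mem measurableSet_Ioi] with r hr n
    have hr : 0 < r := hr
    have hk := besselWeight_nonneg ν hr
    rw [norm_mul, Complex.norm_real, Real.norm_of_nonneg (by positivity), norm_div, norm_pow,
      norm_mul (2 * w), Complex.norm_real, Real.norm_of_nonneg hr.le, Complex.norm_natCast]
  have hi : IntegrableOn (fun r => r * besselWeight ν r * Real.exp (‖2 * w‖ * r)) (Ioi 0) := by
    refine (integrableOn_mul_besselWeight_mul_exp hν hν2).mono'
      (Measurable.aestronglyMeasurable (by fun_prop)) ?_
    filter_upwards [ae_restrict_mem measurableSet_Ioi] with r hr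
    have hr : 0 < r := hr
    have hk := besselWeight_nonneg ν hr
    rw [Real.norm_of_nonneg (by positivity)]
    gcongr
    rw [norm_mul, Complex.norm_ofNat]
    nlinarith
  have h := hasSum_integral_of_dominated_convergence (μ := volume.restrict (Ioi (0 : ℝ)))
    (F := fun n r => ((r * besselWeight ν r : ℝ) : ℂ) * ((2 * w * r) ^ n / n.factorial))
    (f := fun r => ((r * besselWeight ν r : ℝ) : ℂ) * exp (2 * w * r))
    (fun n r => r * besselWeight ν r * ((‖2 * w‖ * r) ^ n / n.factorial))
    (fun n => Measurable.aestronglyMeasurable (by fun_prop))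
    (fun n => hb.mono fun r hr => hr n)
    (Eventually.of_forall fun r => (hasSum_real_exp (‖2 * w‖ * r)).summable.mul_left _)
    (by
      refine hi.congr (Eventually.of_forall fun r => ?_)
      exact ((hasSum_real_exp (‖2 * w‖ * r)).mul_left (r * besselWeight ν r)).tsum_eq.symm)
    (Eventually.of_forall fun r => (hasSum_complex_exp (2 * w * r)).mul_left _)
  rw [densityLaplace, ← h.tsum_eq]
  refine tsum_congr fun n => ?_
  rw [← integral_complex_ofReal, ← integral_const_mul]
  congr 1
  ext r
  push_cast
  ring

theorem poch_mul_poch_eq_prod (ν : ℂ) (n : ℕ) :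
    poch (ν + 1 / 2) n * poch (-ν + 1 / 2) n =
      ∏ k ∈ Finset.range n, (((k : ℂ) + 1 / 2) ^ 2 - ν ^ 2) := by
  induction n with
  | zero => simp [poch]
  | succ n ih =>
    rw [poch_succ, poch_succ, Finset.prod_range_succ, ← ih]
    ring

/-- For `0 < ν < 1/2` the hypergeometric kernel is minus the positive density `D`. -/
theorem regHypergeom_eq_besselDensity (hν : 0 < ν) (hν2 : ν < 1 / 2) {t : ℝ} (ht : 0 ≤ t) :
    regHypergeom (ν + 1 / 2) (-ν + 1 / 2) 0 (-t) = -(t * besselDensity ν t : ℝ) := by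
  set c : ℝ := 2 * (Real.cos (Real.pi * ν) / Real.pi) with hc
  have hd : DifferentiableOn ℂ (fun w : ℂ => w * (c * densityLaplace ν w)) {w | w.re < 1 / 2} :=
    differentiableOn_id.mul ((differentiableOn_densityLaplace hν hν2).const_mul _)
  rw [regHypergeom_eq_of_differentiableOn hd ?_ ht]
  · have e : densityLaplace ν (-t) =
        ((∫ r in Ioi (0 : ℝ), r * besselWeight ν r * Real.exp (-(2 * t * r)) : ℝ) : ℂ) := by
      rw [densityLaplace, ← integral_complex_ofReal]
      congr 1
      ext r
      push_cast
      ring_nf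
    rw [e, besselDensity, ← hc]
    push_cast
    ring
  · filter_upwards [Metric.ball_mem_nhds (0 : ℂ) (show (0 : ℝ) < 1 / 2 by norm_num)] with w hw
    rw [regHypergeomSeries_zero, densityLaplace_eq_tsum hν hν2 (by simpa using hw), ← tsum_mul_left,
      ← tsum_mul_left, ← tsum_mul_left]
    refine tsum_congr fun n => ?_
    have h1 := integral_pow_mul_besselWeight hν hν2 (n + 1)
    have h2 := poch_mul_poch_eq_prod ν (n + 1)
    rw [poch_succ_left, poch_succ_left] at h2
    have h3 := congrArg (fun x : ℝ => (x : ℂ)) h1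
    push_cast at h3
    rw [← h2] at h3
    rw [show w * (c * ((2 * w) ^ n / n.factorial *
        ((∫ r in Ioi (0 : ℝ), r ^ (n + 1) * besselWeight ν r : ℝ) : ℂ))) =
        w * (2 * ((2 * w) ^ n / n.factorial)) * (cos (Real.pi * ν) / Real.pi *
          ((∫ r in Ioi (0 : ℝ), r ^ (n + 1) * besselWeight ν r : ℝ) : ℂ)) by
        rw [hc]; push_cast; ring, h3, mul_pow]
    have := Nat.cast_ne_zero (R := ℂ).2 n.factorial_ne_zero
    have := Nat.cast_ne_zero (R := ℂ).2 (n + 1).factorial_ne_zero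
    rw [pow_succ (2 : ℂ) n]
    generalize poch (ν + 1 / 2 + 1) n = p
    generalize poch (-ν + 1 / 2 + 1) n = q
    field_simp

end density

/-! ### Growth of the kernel and holomorphy of the integral -/

/-- The kernel `t⁻¹ 𝐅(ν + 1/2, -ν + 1/2; 0; -t)`. -/
noncomputable def hyperKernel (ν : ℂ) (t : ℝ) : ℂ :=
  (t : ℂ)⁻¹ * regHypergeom (ν + 1 / 2) (-ν + 1 / 2) 0 (-(t : ℂ))

/-- The kernel is even in the order, which reduces growth estimates to `0 ≤ Re ν`. -/
theorem hyperKernel_neg (ν : ℂ) (t : ℝ) : hyperKernel (-ν) t = hyperKernel ν t := by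
  rw [hyperKernel, hyperKernel, neg_neg, regHypergeom_comm]

/-- Pfaff's transformation of the kernel; the argument `t / (1 + t)` stays in the unit disc. -/
theorem hyperKernel_eq (ν : ℂ) {t : ℝ} (ht : 0 < t) :
    hyperKernel ν t = -((ν + 1 / 2) * (-ν + 1 / 2)) *
      (((1 + t : ℝ) : ℂ) ^ (-(ν + 3 / 2)) * pfaffSum (ν + 1 / 2) ((t / (1 + t) : ℝ) : ℂ)) := by
  have h0 : (t : ℂ) ≠ 0 := Complex.ofReal_ne_zero.2 ht.ne'
  have h1 : ((1 + t : ℝ) : ℂ) ≠ 0 := Complex.ofReal_ne_zero.2 (by positivity)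
  have e : -(t : ℂ) / (-t - 1) = ((t / (1 + t) : ℝ) : ℂ) := by
    have h2 : -(t : ℂ) - 1 ≠ 0 := by
      rw [show -(t : ℂ) - 1 = -((1 + t : ℝ) : ℂ) by push_cast; ring]
      exact neg_ne_zero.2 h1
    push_cast at h1 ⊢
    field_simp
    ring
  rw [hyperKernel, show -ν + 1 / 2 = 1 - (ν + 1 / 2) by ring, regHypergeom_eq_hyperCont _ ht.le,
    hyperCont, e, show 1 - -(t : ℂ) = ((1 + t : ℝ) : ℂ) by push_cast; ring,
    show -(ν + 1 / 2 + 1) = -(ν + 3 / 2) by ring]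
  field_simp

theorem norm_div_one_add_lt_one {t : ℝ} (ht : 0 < t) : ‖((t / (1 + t) : ℝ) : ℂ)‖ < 1 := by
  rw [Complex.norm_real, Real.norm_of_nonneg (by positivity), div_lt_one (by positivity)]
  linarith

theorem differentiable_hyperKernel {t : ℝ} (ht : 0 < t) :
    Differentiable ℂ fun ν => hyperKernel ν t := by
  have h1 : ((1 + t : ℝ) : ℂ) ≠ 0 := Complex.ofReal_ne_zero.2 (by positivity)
  simp only [fun ν => hyperKernel_eq ν ht]
  have h2 : Differentiable ℂ fun ν : ℂ => pfaffSum (ν + 1 / 2) ((t / (1 + t) : ℝ) : ℂ) :=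
    (differentiable_pfaffSum_left (norm_div_one_add_lt_one ht)).comp
      (by fun_prop : Differentiable ℂ fun ν : ℂ => ν + 1 / 2)
  have h3 : Differentiable ℂ fun ν : ℂ => ((1 + t : ℝ) : ℂ) ^ (-(ν + 3 / 2)) := fun ν =>
    DifferentiableAt.const_cpow (by fun_prop) (Or.inl h1)
  exact (by fun_prop : Differentiable ℂ fun ν : ℂ => -((ν + 1 / 2) * (-ν + 1 / 2))).mul (h3.mul h2)

theorem continuousOn_hyperKernel (ν : ℂ) : ContinuousOn (hyperKernel ν) (Ioi 0) := by
  refine ContinuousOn.congr ?_ fun t ht => hyperKernel_eq ν ht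
  have h1 : ContinuousOn (fun t : ℝ => ((t / (1 + t) : ℝ) : ℂ)) (Ioi 0) := by
    refine Complex.continuous_ofReal.comp_continuousOn ?_
    refine ContinuousOn.div (by fun_prop) (by fun_prop) fun t ht => ?_
    have ht : 0 < t := ht
    positivity
  have h2 := (differentiableOn_pfaffSum (ν + 1 / 2)).continuousOn.comp h1 (fun t ht => by
    simpa using norm_div_one_add_lt_one ht)
  have h3 : ContinuousOn (fun t : ℝ => ((1 + t : ℝ) : ℂ) ^ (-(ν + 3 / 2))) (Ioi 0) := by
    refine ContinuousOn.cpow (by fun_prop) (by fun_prop) fun t ht => Or.inl ?_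
    have ht : 0 < t := ht
    simp
    linarith
  exact continuousOn_const.mul (h3.mul h2)

/-- Quadratic comparison behind the growth rate of the coefficients of Pfaff's series. -/
theorem exists_norm_mul_norm_le {τ B δ : ℝ} (hτ : 1 / 2 ≤ τ) (hδ : 0 < δ) :
    ∃ (K : ℕ) (L : ℝ), 1 ≤ L ∧ ∀ a : ℂ, 0 ≤ a.re + 1 → a.re ≤ τ → |a.im| ≤ B →
      (∀ k < K, ‖a + k‖ * ‖a + 1 + k‖ ≤ L * ((2 * τ - 1 + δ + k) * (k + 2))) ∧
      (∀ k : ℕ, K ≤ k → ‖a + k‖ * ‖a + 1 + k‖ ≤ (2 * τ - 1 + δ + k) * (k + 2)) := by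
  set c : ℝ := (τ ^ 2 + (τ + 1) ^ 2) / 2 + B ^ 2 with hc
  obtain ⟨K, hK⟩ := exists_nat_ge (c / δ + 1)
  have hc0 : 0 ≤ c := by positivity
  have hd : 0 ≤ c / δ := by positivity
  have hs : 0 < 2 * τ - 1 + δ := by linarith
  have key : ∀ a : ℂ, 0 ≤ a.re + 1 → a.re ≤ τ → |a.im| ≤ B → ∀ k : ℕ, 1 ≤ k →
      ‖a + k‖ * ‖a + 1 + k‖ ≤ (k : ℝ) ^ 2 + (2 * τ + 1) * k + c := by
    intro a ha0 ha1 ha2 k hk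
    have hk : (1 : ℝ) ≤ k := by exact_mod_cast hk
    have hB : a.im ^ 2 ≤ B ^ 2 := by
      rw [← sq_abs a.im]
      gcongr
    have n1 : ‖a + k‖ ^ 2 = (a.re + k) ^ 2 + a.im ^ 2 := by
      rw [← Complex.normSq_eq_norm_sq, Complex.normSq_apply]
      simp
      ring
    have n2 : ‖a + 1 + k‖ ^ 2 = (a.re + 1 + k) ^ 2 + a.im ^ 2 := by
      rw [← Complex.normSq_eq_norm_sq, Complex.normSq_apply]
      simp
      ring
    have m1 : (a.re + k) ^ 2 ≤ (τ + k) ^ 2 := by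
      have : 0 ≤ a.re + k := by linarith
      gcongr
    have m2 : (a.re + 1 + k) ^ 2 ≤ (τ + 1 + k) ^ 2 := by
      have : 0 ≤ a.re + 1 + k := by linarith
      gcongr
    nlinarith [sq_nonneg (‖a + k‖ - ‖a + 1 + k‖)]
  set L : ℝ := 1 + (|τ| + B + K + 2) ^ 2 / (2 * τ - 1 + δ) with hL
  refine ⟨K, L, ?_, fun a ha0 ha1 ha2 => ⟨fun k hk => ?_, fun k hk => ?_⟩⟩
  · have : 0 ≤ (|τ| + B + K + 2) ^ 2 / (2 * τ - 1 + δ) := by positivity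
    linarith
  · have hk' : (k : ℝ) ≤ K := by exact_mod_cast hk.le
    have hB : 0 ≤ B := (abs_nonneg _).trans ha2
    have hre : |a.re| ≤ |τ| + 1 := by
      rw [abs_le]
      have := le_abs_self τ
      have := abs_nonneg τ
      constructor <;> linarith
    have h1 : ‖a + k‖ ≤ |τ| + B + K + 2 := by
      refine (Complex.norm_le_abs_re_add_abs_im _).trans ?_
      have : |a.re + k| ≤ |a.re| + k := (abs_add_le _ _).trans (by simp)
      simp
      linarith
    have h2 : ‖a + 1 + k‖ ≤ |τ| + B + K + 2 := by
      refine (Complex.norm_le_abs_re_add_abs_im _).trans ?_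
      have h3 : |a.re + 1 + k| ≤ |τ| + K + 2 := by
        rw [abs_le]
        have := le_abs_self τ
        have := abs_nonneg τ
        have : (0 : ℝ) ≤ k := k.cast_nonneg
        have : (0 : ℝ) ≤ K := K.cast_nonneg
        constructor <;> linarith
      simp
      linarith
    calc ‖a + k‖ * ‖a + 1 + k‖ ≤ (|τ| + B + K + 2) * (|τ| + B + K + 2) := by gcongr
      _ = (|τ| + B + K + 2) ^ 2 / (2 * τ - 1 + δ) * (2 * τ - 1 + δ) := by field_simp
      _ ≤ L * ((2 * τ - 1 + δ + k) * (k + 2)) := by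
        have h4 : 2 * τ - 1 + δ ≤ (2 * τ - 1 + δ + k) * (k + 2) := by
          have : (0 : ℝ) ≤ k := k.cast_nonneg
          nlinarith
        have h5 : (|τ| + B + K + 2) ^ 2 / (2 * τ - 1 + δ) ≤ L := by rw [hL]; linarith
        gcongr
  · have hk' : c / δ + 1 ≤ k := hK.trans (by exact_mod_cast hk)
    have h1 : (1 : ℝ) ≤ k := by linarith
    refine (key a ha0 ha1 ha2 k (by exact_mod_cast h1)).trans ?_
    have : c ≤ δ * k := by
      have := mul_le_mul_of_nonneg_left hk' hδ.le
      rw [mul_add, mul_div_cancel₀ _ hδ.ne'] at this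
      linarith
    nlinarith

/-- Growth of the kernel, locally uniformly in the order: `t⁻¹ 𝐅 = O(t^(|Re ν| - 3/2 + ε))`. -/
theorem exists_norm_hyperKernel_le_of_nonneg {ν₀ : ℂ} (h0 : 0 ≤ ν₀.re) {δ : ℝ} (hδ : 0 < δ)
    (hδ1 : δ ≤ 1) :
    ∃ C : ℝ, 0 ≤ C ∧ ∀ ν ∈ Metric.ball ν₀ δ, ∀ t > 0,
      ‖hyperKernel ν t‖ ≤ C * (1 + t) ^ (ν₀.re - 3 / 2 + 6 * δ) := by
  have hτ : 1 / 2 ≤ ν₀.re + 1 / 2 + 2 * δ := by linarith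
  obtain ⟨K, L, hL, h⟩ := exists_norm_mul_norm_le (τ := ν₀.re + 1 / 2 + 2 * δ) (B := |ν₀.im| + δ)
    hτ hδ
  refine ⟨(‖ν₀‖ + δ + 1) * (‖ν₀‖ + δ + 1) * L ^ K, by positivity, fun ν hν t ht => ?_⟩
  rw [Metric.mem_ball, dist_eq_norm] at hν
  have hre := abs_lt.1 ((Complex.abs_re_le_norm (ν - ν₀)).trans_lt hν)
  have him := (Complex.abs_im_le_norm (ν - ν₀)).trans_lt hν
  rw [Complex.sub_re] at hre
  rw [Complex.sub_im] at him
  have hnu : ‖ν‖ ≤ ‖ν₀‖ + δ := by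
    have := norm_add_le ν₀ (ν - ν₀)
    rw [add_sub_cancel] at this
    linarith
  have him' : |ν.im| ≤ |ν₀.im| + δ := by
    have := abs_add_le ν₀.im (ν.im - ν₀.im)
    rw [add_sub_cancel] at this
    linarith
  have r1 : (ν + 1 / 2).re = ν.re + 1 / 2 := by simp
  have i1 : (ν + 1 / 2).im = ν.im := by simp
  obtain ⟨hh1, hh2⟩ := h (ν + 1 / 2) (by rw [r1]; linarith) (by rw [r1]; linarith)
    (by rw [i1]; exact him')
  have ht1 : 0 < 1 + t := by linarith
  -- at `x = t / (1 + t)` one has `1 - x = 1 / (1 + t)`, so the series is `O((1 + t)^s)` with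
  -- `s = 2 τ - 1 + δ`, against the prefactor `(1 + t)^(-(ν + 3/2))`
  have hx := norm_pfaffSum_le (by linarith) hL hh1 hh2 (norm_div_one_add_lt_one ht)
  rw [Complex.norm_real, Real.norm_of_nonneg (by positivity),
    show 1 - t / (1 + t) = (1 + t)⁻¹ by field_simp; ring, Real.inv_rpow ht1.le, one_div (((1 + t) ^ _)⁻¹), inv_inv] at hx
  have n1 : ‖ν + 1 / 2‖ ≤ ‖ν₀‖ + δ + 1 := by
    refine (norm_add_le _ _).trans ?_
    norm_num
    linarith
  have n2 : ‖-ν + 1 / 2‖ ≤ ‖ν₀‖ + δ + 1 := by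
    refine (norm_add_le _ _).trans ?_
    rw [norm_neg]
    norm_num
    linarith
  have hp : ‖((1 + t : ℝ) : ℂ) ^ (-(ν + 3 / 2))‖ ≤ (1 + t) ^ (-(ν₀.re - δ + 3 / 2)) := by
    rw [Complex.norm_cpow_eq_rpow_re_of_pos ht1]
    refine Real.rpow_le_rpow_of_exponent_le (by linarith) ?_
    simp
    linarith
  rw [hyperKernel_eq ν ht, norm_mul, norm_neg, norm_mul, norm_mul]
  calc _ ≤ (‖ν₀‖ + δ + 1) * (‖ν₀‖ + δ + 1) * ((1 + t) ^ (-(ν₀.re - δ + 3 / 2)) *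
        (L ^ K * (1 + t) ^ (2 * (ν₀.re + 1 / 2 + 2 * δ) - 1 + δ))) := by gcongr
    _ = (‖ν₀‖ + δ + 1) * (‖ν₀‖ + δ + 1) * L ^ K * ((1 + t) ^ (-(ν₀.re - δ + 3 / 2)) *
        (1 + t) ^ (2 * (ν₀.re + 1 / 2 + 2 * δ) - 1 + δ)) := by ring
    _ = _ := by
      rw [← Real.rpow_add ht1]
      ring_nf

/-- Divided by `(1 + t)^N` the kernel is integrable when `|Re ν| < N + 1/2`, locally uniformly in
the order. -/
theorem exists_norm_hyperKernel_div_le {N : ℕ} {ν₀ : ℂ} (h0 : |ν₀.re| < (N : ℝ) + 1 / 2) :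
    ∃ δ > (0 : ℝ), ∃ η > (0 : ℝ), ∃ C : ℝ, 0 ≤ C ∧ ∀ ν ∈ Metric.ball ν₀ δ, ∀ t > 0,
      ‖hyperKernel ν t / (1 + (t : ℂ)) ^ N‖ ≤ C * (1 + t) ^ (-1 - η) := by
  obtain ⟨δ, hδ, hδ1, hδ2⟩ : ∃ δ > 0, δ ≤ 1 ∧ 8 * δ ≤ (N : ℝ) + 1 / 2 - |ν₀.re| :=
    ⟨min 1 (((N : ℝ) + 1 / 2 - |ν₀.re|) / 8), lt_min one_pos (by linarith), min_le_left _ _, by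
      linarith [min_le_right 1 (((N : ℝ) + 1 / 2 - |ν₀.re|) / 8)]⟩
  obtain ⟨C, hC0, hC⟩ : ∃ C : ℝ, 0 ≤ C ∧ ∀ ν ∈ Metric.ball ν₀ δ, ∀ t > 0,
      ‖hyperKernel ν t‖ ≤ C * (1 + t) ^ (|ν₀.re| - 3 / 2 + 6 * δ) := by
    rcases le_total 0 ν₀.re with h | h
    · rw [abs_of_nonneg h]
      exact exists_norm_hyperKernel_le_of_nonneg h hδ hδ1
    · obtain ⟨C, hC0, hC⟩ := exists_norm_hyperKernel_le_of_nonneg (ν₀ := -ν₀) (by simpa using h)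
        hδ hδ1
      refine ⟨C, hC0, fun ν hν t ht => ?_⟩
      have := hC (-ν) (by simpa [dist_neg_neg] using hν) t ht
      rwa [hyperKernel_neg, Complex.neg_re, ← abs_of_nonpos h] at this
  refine ⟨δ, hδ, 2 * δ, by positivity, C, hC0, fun ν hν t ht => ?_⟩
  have ht1 : 0 < 1 + t := by linarith
  have e : ‖(1 + (t : ℂ)) ^ N‖ = (1 + t) ^ (N : ℝ) := by
    rw [norm_pow, show 1 + (t : ℂ) = ((1 + t : ℝ) : ℂ) by push_cast; ring, Complex.norm_real,
      Real.norm_of_nonneg ht1.le, Real.rpow_natCast]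
  rw [norm_div, e, div_le_iff₀ (by positivity), mul_assoc, ← Real.rpow_add ht1]
  refine (hC ν hν t ht).trans ?_
  exact mul_le_mul_of_nonneg_left
    (Real.rpow_le_rpow_of_exponent_le (by linarith) (by linarith)) hC0

/-- The integrand of the integral representation of `R_N^{(K)}`. -/
noncomputable def terminantIntegrand (N : ℕ) (ν ζ : ℂ) (t : ℝ) : ℂ :=
  (t : ℂ)⁻¹ / (1 + (t : ℂ)) ^ N * regHypergeom (ν + 1 / 2) (-ν + 1 / 2) 0 (-(t : ℂ)) *
    terminantLambda N (ζ + Real.log (2 * (1 + t)))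

theorem terminantIntegrand_eq (N : ℕ) (ν ζ : ℂ) (t : ℝ) :
    terminantIntegrand N ν ζ t = hyperKernel ν t / (1 + (t : ℂ)) ^ N *
      terminantLambda N (ζ + Real.log (2 * (1 + t))) := by
  rw [terminantIntegrand, hyperKernel]
  ring

theorem continuousOn_terminantIntegrand (N : ℕ) (ν ζ : ℂ) :
    ContinuousOn (terminantIntegrand N ν ζ) (Ioi 0) := by
  refine ContinuousOn.congr ?_ fun t _ => terminantIntegrand_eq N ν ζ t
  have h1 : ContinuousOn (fun t : ℝ => ζ + Real.log (2 * (1 + t))) (Ioi 0) := by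
    refine continuousOn_const.add (Complex.continuous_ofReal.comp_continuousOn ?_)
    refine ContinuousOn.log (by fun_prop) fun t ht => ?_
    have ht : 0 < t := ht
    positivity
  have h2 : ContinuousOn (fun t : ℝ => terminantLambda N (ζ + Real.log (2 * (1 + t)))) (Ioi 0) :=
    (differentiable_terminantLambda (p := N) (by simp)).continuous.comp_continuousOn h1
  refine ((continuousOn_hyperKernel ν).div (by fun_prop) fun t ht => ?_).mul h2
  have ht : 0 < t := ht
  refine pow_ne_zero _ ?_
  rw [show 1 + (t : ℂ) = ((1 + t : ℝ) : ℂ) by push_cast; ring]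
  exact Complex.ofReal_ne_zero.2 (by positivity)

theorem aestronglyMeasurable_terminantIntegrand (N : ℕ) (ν ζ : ℂ) :
    AEStronglyMeasurable (terminantIntegrand N ν ζ) (volume.restrict (Ioi 0)) :=
  (continuousOn_terminantIntegrand N ν ζ).aestronglyMeasurable measurableSet_Ioi

/-- Domination of the integrand, locally uniform in the order and in the variable. -/
theorem exists_norm_terminantIntegrand_le {N : ℕ} {ν₀ ζ₀ : ℂ} (hν : |ν₀.re| < (N : ℝ) + 1 / 2)
    (hζ : |ζ₀.im| < 3 * Real.pi / 2) :
    ∃ ε > 0, ∃ g : ℝ → ℝ, IntegrableOn g (Ioi 0) ∧ ∀ t > 0, ∀ ν ∈ Metric.ball ν₀ ε,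
      ∀ ζ ∈ Metric.ball ζ₀ ε, ‖terminantIntegrand N ν ζ t‖ ≤ g t := by
  obtain ⟨δ, hδ, η, hη, C, hC0, hC⟩ := exists_norm_hyperKernel_div_le hν
  have hcos : 0 < Real.cos (ζ₀.im / 3) := by
    have := abs_lt.1 hζ
    exact Real.cos_pos_of_mem_Ioo ⟨by linarith, by linarith⟩
  have hcont : ContinuousAt (fun ζ : ℂ => 1 / Real.cos (ζ.im / 3) ^ (N + 1)) ζ₀ := by
    refine ContinuousAt.div (by fun_prop) (by fun_prop) (by positivity)
  have hev := hcont.eventually (eventually_lt_nhds (lt_add_one (1 / Real.cos (ζ₀.im / 3) ^ (N + 1))))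
  have hev2 : ∀ᶠ ζ in 𝓝 ζ₀, |ζ.im| < 3 * Real.pi / 2 :=
    (isOpen_lt (by fun_prop) continuous_const).mem_nhds hζ
  obtain ⟨ε, hε, hb⟩ := Metric.eventually_nhds_iff_ball.1 (hev.and hev2)
  set M : ℝ := 1 / Real.cos (ζ₀.im / 3) ^ (N + 1) + 1 with hM
  have hM0 : 0 ≤ M := by positivity
  refine ⟨min δ ε, lt_min hδ hε, fun t => C * (1 + t) ^ (-1 - η) * M, ?_, ?_⟩
  · have h := integrableOn_add_rpow_Ioi_of_lt (a := -1 - η) (c := 0) (m := 1) (by linarith)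
      (by norm_num)
    simp only [add_comm _ (1 : ℝ)] at h
    exact Integrable.mul_const (Integrable.const_mul h C) M
  · intro t ht ν hν ζ hζ
    have h1 := hC ν (Metric.ball_subset_ball (min_le_left _ _) hν) t ht
    obtain ⟨h2, h3⟩ := hb ζ (Metric.ball_subset_ball (min_le_right _ _) hζ)
    have him : (ζ + Real.log (2 * (1 + t))).im = ζ.im := by simp
    have h4 := norm_terminantLambda_le (N := N) (ζ := ζ + Real.log (2 * (1 + t)))
      (by rwa [him])
    rw [him] at h4
    rw [terminantIntegrand_eq, norm_mul]
    have h5 := h4.trans h2.le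
    exact mul_le_mul h1 h5 (norm_nonneg _) ((norm_nonneg _).trans h1)

theorem integrableOn_terminantIntegrand {N : ℕ} {ν ζ : ℂ} (hν : |ν.re| < (N : ℝ) + 1 / 2)
    (hζ : |ζ.im| < 3 * Real.pi / 2) : IntegrableOn (terminantIntegrand N ν ζ) (Ioi 0) := by
  obtain ⟨ε, hε, g, hg, hb⟩ := exists_norm_terminantIntegrand_le hν hζ
  refine Integrable.mono' hg (aestronglyMeasurable_terminantIntegrand N ν ζ) ?_
  filter_upwards [ae_restrict_mem measurableSet_Ioi] with t ht
  exact hb t ht ν (Metric.mem_ball_self hε) ζ (Metric.mem_ball_self hε)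

theorem differentiableOn_integral_terminantIntegrand {N : ℕ} {ν : ℂ}
    (hν : |ν.re| < (N : ℝ) + 1 / 2) :
    DifferentiableOn ℂ (fun ζ => ∫ t in Ioi (0 : ℝ), terminantIntegrand N ν ζ t)
      {ζ | |ζ.im - 0| < 3 * Real.pi / 2} := by
  refine differentiableOn_integral_of_dominated (isOpen_strip 0 _)
    (fun ζ _ => aestronglyMeasurable_terminantIntegrand N ν ζ) ?_ ?_
  · refine Eventually.of_forall fun t => ?_
    simp only [terminantIntegrand_eq]
    refine DifferentiableOn.const_mul ?_ _
    exact ((differentiable_terminantLambda (p := N) (by simp)).comp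
      (by fun_prop : Differentiable ℂ fun ζ : ℂ => ζ + Real.log (2 * (1 + t)))).differentiableOn
  · intro ζ hζ
    have hζ : |ζ.im - 0| < 3 * Real.pi / 2 := hζ
    rw [sub_zero] at hζ
    obtain ⟨ε, hε, g, hg, hb⟩ := exists_norm_terminantIntegrand_le hν hζ
    refine ⟨ε, hε, g, hg, ?_⟩
    filter_upwards [ae_restrict_mem measurableSet_Ioi] with t ht z hz
    exact hb t ht ν (Metric.mem_ball_self hε) z hz

theorem isOpen_abs_re_lt (r : ℝ) : IsOpen {ν : ℂ | |ν.re| < r} :=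
  isOpen_lt (by fun_prop) continuous_const

theorem differentiableOn_integral_terminantIntegrand_order {N : ℕ} {ζ : ℂ}
    (hζ : |ζ.im| < 3 * Real.pi / 2) :
    DifferentiableOn ℂ (fun ν => ∫ t in Ioi (0 : ℝ), terminantIntegrand N ν ζ t)
      {ν | |ν.re| < (N : ℝ) + 1 / 2} := by
  refine differentiableOn_integral_of_dominated (isOpen_abs_re_lt _)
    (fun ν _ => aestronglyMeasurable_terminantIntegrand N ν ζ) ?_ ?_
  · filter_upwards [ae_restrict_mem measurableSet_Ioi] with t ht
    simp only [terminantIntegrand_eq]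
    exact (((differentiable_hyperKernel ht).div_const _).mul_const _).differentiableOn
  · intro ν hν
    obtain ⟨ε, hε, g, hg, hb⟩ := exists_norm_terminantIntegrand_le hν hζ
    refine ⟨ε, hε, g, hg, ?_⟩
    filter_upwards [ae_restrict_mem measurableSet_Ioi] with t ht z hz
    exact hb t ht z hz ζ (Metric.mem_ball_self hε)

/-! ### The expansion of `K_ν` -/

theorem hankelCoeff_eq (n : ℕ) (ν : ℂ) :
    hankelCoeff n ν = (-1) ^ n *
      ((∏ k ∈ Finset.range n, (((k : ℂ) + 1 / 2) ^ 2 - ν ^ 2)) / (2 ^ n * n.factorial)) := by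
  have h : ∀ k ∈ Finset.range n, 4 * ν ^ 2 - (2 * (k : ℂ) + 1) ^ 2 =
      (-4) * (((k : ℂ) + 1 / 2) ^ 2 - ν ^ 2) := fun k _ => by ring
  rw [hankelCoeff, Finset.prod_congr rfl h, Finset.prod_mul_distrib, Finset.prod_const,
    Finset.card_range, show (-4 : ℂ) ^ n = (-1) ^ n * 4 ^ n by rw [← mul_pow]; norm_num,
    show (8 : ℂ) ^ n = 4 ^ n * 2 ^ n by rw [← mul_pow]; norm_num]
  have : (n.factorial : ℂ) ≠ 0 := Nat.cast_ne_zero.2 n.factorial_ne_zero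
  generalize ∏ k ∈ Finset.range n, (((k : ℂ) + 1 / 2) ^ 2 - ν ^ 2) = P
  field_simp

/-- The right-hand side of the integral representation of `R_N^{(K)}`. -/
noncomputable def terminantRemainder (N : ℕ) (ζ ν : ℂ) : ℂ :=
  (-1) ^ N * (cos (Real.pi * ν) / Real.pi) * (Gamma N / 2 ^ N) * (1 / exp ζ ^ N) *
    (terminantLambda N (ζ + Real.log 2) + ∫ t : ℝ in Ioi 0, terminantIntegrand N ν ζ t)

/-- The truncated Hankel expansion. -/
noncomputable def hankelSum (N : ℕ) (ζ ν : ℂ) : ℂ :=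
  ∑ n ∈ Finset.range N, hankelCoeff n ν / exp ζ ^ n

/-- The elementary factor of the Hankel expansion, `e^z (2z/π)^{1/2}`. -/
noncomputable def hankelScale (ζ : ℂ) : ℂ :=
  exp (exp ζ) * exp ((ζ + Real.log (2 / Real.pi)) / 2)

theorem hankelScale_ne_zero (ζ : ℂ) : hankelScale ζ ≠ 0 :=
  mul_ne_zero (exp_ne_zero _) (exp_ne_zero _)

theorem exp_ofReal_log {z : ℝ} (hz : 0 < z) : exp (Real.log z : ℂ) = z := by
  rw [← Complex.ofReal_exp, Real.exp_log hz]

theorem besselKQuot_mul_hankelScale {ν z : ℝ} (hz : 0 < z)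
    (h : besselKQuot ν (Real.log z) =
      ((∫ x in Ioi (0 : ℝ), x ^ (ν - 1) * Real.exp (-(z / 2 * (x + 1 / x))) : ℝ) : ℂ) / 2) :
    besselKQuot ν (Real.log z) * hankelScale (Real.log z) =
      ((z * (Real.exp (2 * z) * besselWeight ν z) : ℝ) : ℂ) := by
  have h1 : ∫ x in Ioi (0 : ℝ), x ^ (ν - 1) * Real.exp (-(z / 2 * (x + 1 / x))) =
      Real.exp z * besselKInt ν z := by
    rw [besselKInt, ← integral_const_mul]
    refine setIntegral_congr_fun measurableSet_Ioi fun x hx => ?_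
    have hx : 0 < x := hx
    rw [mul_left_comm, ← Real.exp_add]
    congr 2
    field_simp
    ring
  have h2 : hankelScale (Real.log z) = ((Real.exp z * √(z * (2 / Real.pi)) : ℝ) : ℂ) := by
    rw [hankelScale, exp_ofReal_log hz, show ((Real.log z : ℂ) + Real.log (2 / Real.pi)) / 2 =
      (((Real.log z + Real.log (2 / Real.pi)) / 2 : ℝ) : ℂ) by push_cast; ring, ← Complex.ofReal_exp,
      ← Complex.ofReal_exp, Real.exp_half,
      Real.exp_add, Real.exp_log hz, Real.exp_log (by positivity)]
    push_cast
    rfl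
  rw [h, h1, h2, besselWeight, Real.rpow_neg hz.le, ← Real.sqrt_eq_rpow, Real.sqrt_mul hz.le,
    Real.sqrt_div two_pos.le, Real.sqrt_mul two_pos.le, two_mul z, Real.exp_add]
  have e1 : √z * √z = z := Real.mul_self_sqrt hz.le
  have e2 : √2 * √2 = (2 : ℝ) := Real.mul_self_sqrt two_pos.le
  have p1 : √z ≠ 0 := by positivity
  have p2 : √2 ≠ 0 := by positivity
  have p3 : √Real.pi ≠ 0 := by positivity
  have : Real.exp z * besselKInt ν z / 2 * (Real.exp z * (√z * (√2 / √Real.pi))) =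
      z * (Real.exp z * Real.exp z * ((√2 * √Real.pi)⁻¹ * ((√z)⁻¹ * besselKInt ν z))) := by
    field_simp
    rw [Real.sq_sqrt hz.le, Real.sq_sqrt two_pos.le]
    ring
  rw [← this]
  push_cast
  ring

/-- For `0 < ν < 1/2` and positive `z` the terminant form of the remainder is its Stieltjes form. -/
theorem terminantRemainder_ofReal {ν : ℝ} (hν : 0 < ν) (hν2 : ν < 1 / 2) {z : ℝ} (hz : 0 < z)
    (n : ℕ) :
    terminantRemainder (n + 1) (Real.log z) ν = (((-1) ^ (n + 1) * (Real.cos (Real.pi * ν) /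
      Real.pi * ∫ r in Ioi (0 : ℝ), r ^ (n + 1) * besselWeight ν r * (z / (z + r))) /
        z ^ (n + 1) : ℝ) : ℂ) := by
  have h1 : ∀ t ∈ Ioi (0 : ℝ), terminantIntegrand (n + 1) ν (Real.log z) t =
      ((-(besselDensity ν t *
          (realTerminant (n + 1) (2 * z * (1 + t)) / (1 + t) ^ (n + 1))) : ℝ) : ℂ) := by
    intro t ht
    have ht : 0 < t := ht
    have e : (Real.log z : ℂ) + Real.log (2 * (1 + t)) = (Real.log (2 * z * (1 + t)) : ℂ) := by
      rw [← Complex.ofReal_add, ← Real.log_mul hz.ne' (by positivity)]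
      ring_nf
    have h0 : (t : ℂ) ≠ 0 := Complex.ofReal_ne_zero.2 ht.ne'
    rw [terminantIntegrand_eq, hyperKernel, regHypergeom_eq_besselDensity hν hν2 ht.le, e,
      terminantLambda_log (by positivity)]
    push_cast
    field_simp
  have e2 : (Real.log z : ℂ) + Real.log 2 = (Real.log (2 * z) : ℂ) := by
    rw [← Complex.ofReal_add, ← Real.log_mul hz.ne' two_ne_zero, mul_comm]
  have e3 : Gamma ((n + 1 : ℕ) : ℂ) = ((Real.Gamma ((n : ℝ) + 1) : ℝ) : ℂ) := by
    rw [← Complex.Gamma_ofReal]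
    push_cast
    rfl
  rw [terminantRemainder, setIntegral_congr_fun measurableSet_Ioi h1, integral_complex_ofReal,
    integral_neg, e2, terminantLambda_log (by positivity), exp_ofReal_log hz, e3,
    integral_besselWeight_eq_realTerminant hν hν2 hz]
  push_cast
  ring

theorem hankelSum_ofReal {ν : ℝ} (hν : 0 < ν) (hν2 : ν < 1 / 2) {z : ℝ} (hz : 0 < z) (N : ℕ) :
    hankelSum N (Real.log z) ν = ((∑ n ∈ Finset.range N, (-1) ^ n * (Real.cos (Real.pi * ν) /
      Real.pi * ∫ r in Ioi (0 : ℝ), r ^ n * besselWeight ν r) / z ^ n : ℝ) : ℂ) := by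
  rw [hankelSum, Complex.ofReal_sum]
  refine Finset.sum_congr rfl fun n _ => ?_
  rw [integral_pow_mul_besselWeight hν hν2, hankelCoeff_eq, exp_ofReal_log hz]
  push_cast
  rfl

theorem differentiable_besselI (ν : ℂ) : Differentiable ℂ (besselI ν) := by
  simp only [funext (besselI_eq ν)]
  have h : Differentiable ℂ (besselSeries ν) := fun x => (hasDerivAt_besselSeries ν x).differentiableAt
  have h2 : Differentiable ℂ fun ζ : ℂ => besselSeries ν (exp ζ ^ 2 / 4) :=
    h.comp (by fun_prop : Differentiable ℂ fun ζ : ℂ => exp ζ ^ 2 / 4)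
  fun_prop

theorem differentiable_besselI_order (ζ : ℂ) : Differentiable ℂ fun ν => besselI ν ζ := by
  simp only [besselI_eq]
  have := differentiable_besselSeries_order (exp ζ ^ 2 / 4)
  fun_prop

theorem differentiable_besselJ_order (ζ : ℂ) : Differentiable ℂ fun ν => besselJ ν ζ := by
  simp only [besselJ_eq]
  have := differentiable_besselSeries_order (-(exp ζ ^ 2 / 4))
  fun_prop

theorem differentiable_hankelScale : Differentiable ℂ hankelScale := by
  unfold hankelScale
  fun_prop

theorem differentiable_hankelSum (N : ℕ) (ν : ℂ) : Differentiable ℂ fun ζ => hankelSum N ζ ν := by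
  unfold hankelSum
  refine Differentiable.fun_sum fun n _ => ?_
  exact (differentiable_const _).div (by fun_prop) fun ζ => pow_ne_zero _ (exp_ne_zero _)

theorem differentiable_hankelSum_order (N : ℕ) (ζ : ℂ) :
    Differentiable ℂ fun ν => hankelSum N ζ ν := by
  unfold hankelSum hankelCoeff
  refine Differentiable.fun_sum fun n _ => ?_
  refine Differentiable.div_const (Differentiable.div_const ?_ _) _
  exact Differentiable.fun_finsetProd fun k _ => by fun_prop

theorem differentiableOn_terminantRemainder {N : ℕ} {ν : ℂ} (hν : |ν.re| < (N : ℝ) + 1 / 2) :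
    DifferentiableOn ℂ (fun ζ => terminantRemainder N ζ ν) {ζ | |ζ.im - 0| < 3 * Real.pi / 2} := by
  have h1 := differentiableOn_integral_terminantIntegrand hν
  have h2 : Differentiable ℂ fun ζ : ℂ => terminantLambda N (ζ + Real.log 2) :=
    (differentiable_terminantLambda (p := N) (by simp)).comp
      (by fun_prop : Differentiable ℂ fun ζ : ℂ => ζ + Real.log 2)
  have h3 : Differentiable ℂ fun ζ : ℂ => 1 / exp ζ ^ N :=
    (differentiable_const _).div (by fun_prop) fun ζ => pow_ne_zero _ (exp_ne_zero _)
  exact (h3.const_mul _).differentiableOn.mul (h2.differentiableOn.add h1)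

theorem differentiableOn_terminantRemainder_order {N : ℕ} {ζ : ℂ} (hζ : |ζ.im| < 3 * Real.pi / 2) :
    DifferentiableOn ℂ (fun ν => terminantRemainder N ζ ν) {ν | |ν.re| < (N : ℝ) + 1 / 2} := by
  have h1 := differentiableOn_integral_terminantIntegrand_order (N := N) hζ
  have h3 : Differentiable ℂ fun ν : ℂ => (-1) ^ N * (cos (Real.pi * ν) / Real.pi) *
      (Gamma N / 2 ^ N) * (1 / exp ζ ^ N) := by fun_prop
  exact h3.differentiableOn.mul (h1.const_add _)

/-- Two holomorphic functions on a convex open set that agree on a real interval are equal. -/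
theorem eqOn_of_eq_on_real_interval {U : Set ℂ} (hU : IsOpen U) (hc : Convex ℝ U) {f g : ℂ → ℂ}
    (hf : DifferentiableOn ℂ f U) (hg : DifferentiableOn ℂ g U) {a b : ℝ} (hab : a < b)
    (hb : (b : ℂ) ∈ U) (h : ∀ x : ℝ, a < x → x < b → f x = g x) : EqOn f g U := by
  refine (hf.analyticOnNhd hU).eqOn_of_preconnected_of_frequently_eq (hg.analyticOnNhd hU)
    hc.isPreconnected hb ?_
  have ht : Tendsto (fun x : ℝ => (x : ℂ)) (𝓝[<] b) (𝓝[≠] (b : ℂ)) := by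
    refine tendsto_nhdsWithin_iff.2 ⟨(Complex.continuous_ofReal.tendsto b).mono_left
      nhdsWithin_le_nhds, ?_⟩
    filter_upwards [self_mem_nhdsWithin] with x hx
    have hx : x < b := hx
    simpa using hx.ne
  refine ht.frequently (Eventually.frequently ?_)
  filter_upwards [Ioo_mem_nhdsLT hab] with x hx
  exact h x hx.1 hx.2

/-- The representation for `0 < ν < 1/2`: it holds at small positive `z`, and both sides are
holomorphic in the logarithm of `z`. -/
theorem besselKQuot_eq_of_lt_half {ν : ℝ} (hν : 0 < ν) (hν2 : ν < 1 / 2) {N : ℕ} (hN : 1 ≤ N)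
    {ζ : ℂ} (hζ : |ζ.im| < 3 * Real.pi / 2) :
    besselKQuot ν ζ * hankelScale ζ = hankelSum N ζ ν + terminantRemainder N ζ ν := by
  obtain ⟨δ, hδ, h⟩ := exists_besselKQuot_eq_integral hν (by linarith)
  have hd : Differentiable ℂ fun ζ => besselKQuot ν ζ * hankelScale ζ := by
    unfold besselKQuot
    exact ((((differentiable_besselI _).sub (differentiable_besselI _)).div_const _).const_mul
      _).mul differentiable_hankelScale
  have hνN : |(ν : ℂ).re| < (N : ℝ) + 1 / 2 := by
    have : (1 : ℝ) ≤ N := by exact_mod_cast hN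
    rw [Complex.ofReal_re, abs_of_pos hν]
    linarith
  refine eqOn_of_eq_on_real_interval (isOpen_strip 0 (3 * Real.pi / 2)) (convex_strip 0 _)
    hd.differentiableOn ((differentiable_hankelSum N ν).differentiableOn.add
      (differentiableOn_terminantRemainder hνN)) (a := Real.log δ - 1) (b := Real.log δ)
    (by linarith) ?_ ?_ (show |ζ.im - 0| < 3 * Real.pi / 2 by rwa [sub_zero])
  · simp
    positivity
  · intro x _ hx
    obtain ⟨z, hz, rfl⟩ : ∃ z > 0, Real.log z = x := ⟨Real.exp x, Real.exp_pos x, Real.log_exp x⟩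
    have hzδ : z < δ := (Real.log_lt_log_iff hz hδ).1 hx
    obtain ⟨n, rfl⟩ : ∃ n, N = n + 1 := ⟨N - 1, by omega⟩
    simp only [Pi.add_apply]
    rw [besselKQuot_mul_hankelScale hz (h z ⟨hz, hzδ.le⟩), terminantRemainder_ofReal hν hν2 hz,
      hankelSum_ofReal hν hν2 hz, besselWeight_expansion hν hν2 hz (n + 1)]
    push_cast
    rfl

/-- The representation, cleared of the denominator `sin (π ν)`, throughout the strip of orders, by
holomorphy in the order. -/
theorem sin_mul_expansion {N : ℕ} (hN : 1 ≤ N) {ν ζ : ℂ} (hν : |ν.re| < (N : ℝ) + 1 / 2)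
    (hζ : |ζ.im| < 3 * Real.pi / 2) :
    Real.pi / 2 * (besselI (-ν) ζ - besselI ν ζ) * hankelScale ζ =
      sin (Real.pi * ν) * (hankelSum N ζ ν + terminantRemainder N ζ ν) := by
  have hI := differentiable_besselI_order ζ
  have hI' : Differentiable ℂ fun ν : ℂ => besselI (-ν) ζ :=
    hI.comp (by fun_prop : Differentiable ℂ fun ν : ℂ => -ν)
  have hconv : Convex ℝ {ν : ℂ | |ν.re| < (N : ℝ) + 1 / 2} := by
    have : {ν : ℂ | |ν.re| < (N : ℝ) + 1 / 2} =
        {ν : ℂ | -((N : ℝ) + 1 / 2) < ν.re} ∩ {ν : ℂ | ν.re < (N : ℝ) + 1 / 2} := by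
      ext ν
      simp [abs_lt]
    rw [this]
    exact (convex_halfSpace_re_gt _).inter (convex_halfSpace_re_lt _)
  have hl : Differentiable ℂ fun ν : ℂ =>
      Real.pi / 2 * (besselI (-ν) ζ - besselI ν ζ) * hankelScale ζ := by fun_prop
  have hs : Differentiable ℂ fun ν : ℂ => sin (Real.pi * ν) := by fun_prop
  refine eqOn_of_eq_on_real_interval (isOpen_abs_re_lt _) hconv hl.differentiableOn
    (hs.differentiableOn.mul ((differentiable_hankelSum_order N ζ).differentiableOn.add
      (differentiableOn_terminantRemainder_order hζ))) (a := 0) (b := 1 / 2) (by norm_num) ?_ ?_ hν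
  · have : (1 : ℝ) ≤ N := by exact_mod_cast hN
    simp only [mem_ofPred_eq, Complex.ofReal_re]
    rw [abs_of_pos (by norm_num)]
    linarith
  · intro x hx hx2
    have h := besselKQuot_eq_of_lt_half hx hx2 hN hζ
    have hsin : sin (Real.pi * x : ℂ) ≠ 0 := by
      rw [← Complex.ofReal_mul, ← Complex.ofReal_sin]
      refine Complex.ofReal_ne_zero.2 (Real.sin_pos_of_pos_of_lt_pi (by positivity) ?_).ne'
      nlinarith [Real.pi_pos]
    simp only [Pi.add_apply, Pi.mul_apply]
    rw [← h, besselKQuot]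
    field_simp

theorem eventually_sin_pi_mul_ne_zero (ν : ℂ) : ∀ᶠ μ in 𝓝[≠] ν, sin (Real.pi * μ) ≠ 0 := by
  by_cases h : sin (Real.pi * ν) = 0
  · have hd : HasDerivAt (fun μ : ℂ => sin (Real.pi * μ)) (cos (Real.pi * ν) * (Real.pi * 1)) ν :=
      ((hasDerivAt_id ν).const_mul (Real.pi : ℂ)).csin
    refine hd.eventually_ne (mul_ne_zero ?_ (by simp [Real.pi_ne_zero]))
    intro hc
    have := sin_sq_add_cos_sq (Real.pi * ν)
    simp [h, hc] at this
  · have hc : ContinuousAt (fun μ : ℂ => sin (Real.pi * μ)) ν := by fun_prop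
    exact (hc.eventually_ne h).filter_mono nhdsWithin_le_nhds

theorem sin_pi_mul_eq_zero_iff (ν : ℂ) : sin (Real.pi * ν) = 0 ↔ ∃ n : ℤ, ν = n := by
  rw [Complex.sin_eq_zero_iff]
  have : (Real.pi : ℂ) ≠ 0 := Complex.ofReal_ne_zero.2 Real.pi_ne_zero
  refine exists_congr fun n => ?_
  rw [mul_comm, mul_left_inj' this]

/-- The Hankel expansion of `K_ν` with its remainder, together with the continuity in the order
that identifies the value at an integer. -/
theorem besselK_eq {N : ℕ} (hN : 1 ≤ N) {ν ζ : ℂ} (hν : |ν.re| < (N : ℝ) + 1 / 2)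
    (hζ : |ζ.im| < 3 * Real.pi / 2) :
    Tendsto (fun μ => besselKQuot μ ζ) (𝓝[≠] ν) (𝓝 (besselK ν ζ)) ∧
      besselK ν ζ * hankelScale ζ = hankelSum N ζ ν + terminantRemainder N ζ ν := by
  have hq : ∀ μ : ℂ, |μ.re| < (N : ℝ) + 1 / 2 → sin (Real.pi * μ) ≠ 0 →
      besselKQuot μ ζ = (hankelSum N ζ μ + terminantRemainder N ζ μ) / hankelScale ζ := by
    intro μ hμ hs
    rw [eq_div_iff (hankelScale_ne_zero ζ), besselKQuot]
    have h := sin_mul_expansion hN hμ hζ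
    field_simp
    field_simp at h
    linear_combination h
  have hcont : ContinuousAt
      (fun μ => (hankelSum N ζ μ + terminantRemainder N ζ μ) / hankelScale ζ) ν :=
    ((differentiable_hankelSum_order N ζ).continuous.continuousAt.add
      ((differentiableOn_terminantRemainder_order hζ).differentiableAt
        ((isOpen_abs_re_lt _).mem_nhds hν)).continuousAt).div_const _
  have ht : Tendsto (fun μ => besselKQuot μ ζ) (𝓝[≠] ν)
      (𝓝 ((hankelSum N ζ ν + terminantRemainder N ζ ν) / hankelScale ζ)) := by
    refine Tendsto.congr' ?_ (hcont.tendsto.mono_left nhdsWithin_le_nhds)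
    filter_upwards [eventually_sin_pi_mul_ne_zero ν,
      nhdsWithin_le_nhds ((isOpen_abs_re_lt _).mem_nhds hν)] with μ hs hμ
    exact (hq μ hμ hs).symm
  have hval : besselK ν ζ = (hankelSum N ζ ν + terminantRemainder N ζ ν) / hankelScale ζ := by
    rw [besselK]
    split_ifs with h
    · exact ht.limUnder_eq
    · exact hq ν hν (mt (sin_pi_mul_eq_zero_iff ν).1 h)
  rw [hval]
  exact ⟨ht, div_mul_cancel₀ _ (hankelScale_ne_zero ζ)⟩

theorem remainderK_eq {N : ℕ} (hN : 1 ≤ N) {ν ζ : ℂ} (hν : |ν.re| < (N : ℝ) + 1 / 2)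
    (hζ : |ζ.im| < 3 * Real.pi / 2) : remainderK N ζ ν = terminantRemainder N ζ ν := by
  have h := (besselK_eq hN hν hζ).2
  rw [hankelScale, hankelSum] at h
  rw [remainderK]
  linear_combination h

/-! ### The expansion of `J_ν` -/

theorem exp_sub_half_pi_mul_I (ζ : ℂ) : exp (ζ - Real.pi / 2 * I) = -(I * exp ζ) := by
  rw [exp_sub, exp_pi_div_two_mul_I]
  field_simp
  rw [I_sq]
  ring

theorem exp_add_half_pi_mul_I (ζ : ℂ) : exp (ζ + Real.pi / 2 * I) = I * exp ζ := by
  rw [exp_add, exp_pi_div_two_mul_I, mul_comm]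

/-- Turning `z` by `∓π/2` changes the sign of `z²`, and so exchanges `I_ν` and `J_ν`. -/
theorem besselI_sub_half_pi (ν ζ : ℂ) :
    besselI ν (ζ - Real.pi / 2 * I) = exp (-(Real.pi / 2 * I * ν)) * besselJ ν ζ := by
  rw [besselI_eq, besselJ_eq, exp_sub_half_pi_mul_I, ← mul_assoc, ← exp_add,
    neg_sq, mul_pow, I_sq, neg_one_mul, neg_div]
  ring_nf

theorem besselI_add_half_pi (ν ζ : ℂ) :
    besselI ν (ζ + Real.pi / 2 * I) = exp (Real.pi / 2 * I * ν) * besselJ ν ζ := by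
  rw [besselI_eq, besselJ_eq, exp_add_half_pi_mul_I, ← mul_assoc, ← exp_add,
    mul_pow, I_sq, neg_one_mul, neg_div]
  ring_nf

theorem exp_neg_half_pi_mul (ν : ℂ) :
    exp (-(Real.pi / 2 * I * ν)) =
      exp (Real.pi / 2 * I * ν) * (cos (Real.pi * ν) - sin (Real.pi * ν) * I) := by
  have h1 : cos (Real.pi * ν) - sin (Real.pi * ν) * I = exp (-(Real.pi * ν * I)) := by
    rw [← neg_mul, exp_mul_I, cos_neg, sin_neg]
    ring
  rw [h1, ← exp_add]
  ring_nf

theorem exp_half_pi_mul (ν : ℂ) :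
    exp (Real.pi / 2 * I * ν) =
      exp (-(Real.pi / 2 * I * ν)) * (cos (Real.pi * ν) + sin (Real.pi * ν) * I) := by
  rw [← exp_mul_I, ← exp_add]
  ring_nf

/-- `K_ν(z e^(-πi/2)) = (πi/2) e^(πiν/2) (J_ν(z) + i Y_ν(z))`, away from the integers. -/
theorem besselKQuot_sub_half_pi {ν : ℂ} (hν : sin (Real.pi * ν) ≠ 0) (ζ : ℂ) :
    besselKQuot ν (ζ - Real.pi / 2 * I) = Real.pi / 2 * I * exp (Real.pi / 2 * I * ν) *
      (besselJ ν ζ + I * besselYQuot ν ζ) := by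
  rw [besselKQuot, besselYQuot, besselI_sub_half_pi, besselI_sub_half_pi, mul_neg, neg_neg,
    exp_neg_half_pi_mul]
  field_simp
  linear_combination (besselJ (-ν) ζ - besselJ ν ζ * cos (Real.pi * ν)) * I_sq

/-- `K_ν(z e^(πi/2)) = -(πi/2) e^(-πiν/2) (J_ν(z) - i Y_ν(z))`, away from the integers. -/
theorem besselKQuot_add_half_pi {ν : ℂ} (hν : sin (Real.pi * ν) ≠ 0) (ζ : ℂ) :
    besselKQuot ν (ζ + Real.pi / 2 * I) = -(Real.pi / 2 * I * exp (-(Real.pi / 2 * I * ν)) *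
      (besselJ ν ζ - I * besselYQuot ν ζ)) := by
  rw [besselKQuot, besselYQuot, besselI_add_half_pi, besselI_add_half_pi, mul_neg,
    exp_half_pi_mul ν]
  field_simp
  linear_combination (besselJ (-ν) ζ - besselJ ν ζ * cos (Real.pi * ν)) * I_sq

theorem abs_im_sub_half_pi_lt {ζ : ℂ} (hζ : |ζ.im| < Real.pi) :
    |(ζ - Real.pi / 2 * I).im| < 3 * Real.pi / 2 := by
  have h := abs_lt.1 hζ
  have : (ζ - Real.pi / 2 * I).im = ζ.im - Real.pi / 2 := by simp
  rw [this, abs_lt]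
  constructor <;> linarith

theorem abs_im_add_half_pi_lt {ζ : ℂ} (hζ : |ζ.im| < Real.pi) :
    |(ζ + Real.pi / 2 * I).im| < 3 * Real.pi / 2 := by
  have h := abs_lt.1 hζ
  have : (ζ + Real.pi / 2 * I).im = ζ.im + Real.pi / 2 := by simp
  rw [this, abs_lt]
  constructor <;> linarith

/-- The connection formulas at every order in the strip; at an integer they are obtained by
passing to the limit, which also shows that the limit defining `Y_ν` exists. -/
theorem besselK_half_pi {N : ℕ} (hN : 1 ≤ N) {ν ζ : ℂ} (hν : |ν.re| < (N : ℝ) + 1 / 2)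
    (hζ : |ζ.im| < Real.pi) :
    besselK ν (ζ - Real.pi / 2 * I) = Real.pi / 2 * I * exp (Real.pi / 2 * I * ν) *
      (besselJ ν ζ + I * besselY ν ζ) ∧
    besselK ν (ζ + Real.pi / 2 * I) = -(Real.pi / 2 * I * exp (-(Real.pi / 2 * I * ν)) *
      (besselJ ν ζ - I * besselY ν ζ)) := by
  have h1 := (besselK_eq hN hν (abs_im_sub_half_pi_lt hζ)).1
  have h2 := (besselK_eq hN hν (abs_im_add_half_pi_lt hζ)).1
  have hpi : (Real.pi : ℂ) ≠ 0 := Complex.ofReal_ne_zero.2 Real.pi_ne_zero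
  have hJ : Tendsto (fun μ => besselJ μ ζ) (𝓝[≠] ν) (𝓝 (besselJ ν ζ)) :=
    (differentiable_besselJ_order ζ).continuous.continuousAt.tendsto.mono_left nhdsWithin_le_nhds
  have hc (f : ℂ → ℂ) (hf : Continuous f) : Tendsto f (𝓝[≠] ν) (𝓝 (f ν)) :=
    hf.continuousAt.tendsto.mono_left nhdsWithin_le_nhds
  have hE := hc (fun μ => exp (Real.pi / 2 * I * μ)) (by fun_prop)
  have hE' := hc (fun μ => exp (-(Real.pi / 2 * I * μ))) (by fun_prop)
  have hY : Tendsto (fun μ => besselYQuot μ ζ) (𝓝[≠] ν) (𝓝 (besselY ν ζ)) := by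
    have ht : Tendsto (fun μ => besselYQuot μ ζ) (𝓝[≠] ν)
        (𝓝 ((besselK ν (ζ - Real.pi / 2 * I) * exp (-(Real.pi / 2 * I * ν)) / (Real.pi / 2 * I) -
          besselJ ν ζ) / I)) := by
      refine Tendsto.congr' ?_ ((((h1.mul hE').div_const (Real.pi / 2 * I)).sub hJ).div_const I)
      filter_upwards [eventually_sin_pi_mul_ne_zero ν] with μ hμ
      have he := exp_ne_zero (Real.pi / 2 * I * μ)
      rw [besselKQuot_sub_half_pi hμ, exp_neg]
      field_simp
      ring
    by_cases h : ∃ n : ℤ, ν = n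
    · rw [besselY, if_pos h, ht.limUnder_eq]
      exact ht
    · have hs := mt (sin_pi_mul_eq_zero_iff ν).1 h
      rw [besselY, if_neg h]
      have he := exp_ne_zero (Real.pi / 2 * I * ν)
      have hK : besselK ν (ζ - Real.pi / 2 * I) = besselKQuot ν (ζ - Real.pi / 2 * I) := by
        rw [besselK, if_neg h]
      convert ht using 2
      rw [hK, besselKQuot_sub_half_pi hs, exp_neg]
      field_simp
      ring
  refine ⟨tendsto_nhds_unique h1 ?_, tendsto_nhds_unique h2 ?_⟩
  · refine Tendsto.congr' ?_ ((hE.const_mul (Real.pi / 2 * I)).mul (hJ.add (hY.const_mul I)))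
    filter_upwards [eventually_sin_pi_mul_ne_zero ν] with μ hμ
    exact (besselKQuot_sub_half_pi hμ ζ).symm
  · refine Tendsto.congr' ?_ ((hE'.const_mul (Real.pi / 2 * I)).mul (hJ.sub (hY.const_mul I))).neg
    filter_upwards [eventually_sin_pi_mul_ne_zero ν] with μ hμ
    exact (besselKQuot_add_half_pi hμ ζ).symm

theorem pi_div_two_mul_exp (ζ : ℂ) :
    Real.pi / 2 * exp ((ζ + Real.log (2 / Real.pi)) / 2) =
      exp ((ζ + Real.log (Real.pi / 2)) / 2) := by
  have h1 : (Real.pi / 2 : ℂ) = exp (Real.log (Real.pi / 2) : ℂ) := by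
    rw [← Complex.ofReal_exp, Real.exp_log (by positivity)]
    push_cast
    rfl
  have h2 : Real.log (2 / Real.pi) = -Real.log (Real.pi / 2) := by
    rw [← Real.log_inv, inv_div]
  rw [h1, h2, ← exp_add]
  push_cast
  ring_nf

theorem hankelScale_sub_half_pi (ν ζ : ℂ) :
    Real.pi / 2 * I * exp (Real.pi / 2 * I * ν) * hankelScale (ζ - Real.pi / 2 * I) =
      exp ((ζ + Real.log (Real.pi / 2)) / 2) *
        (cos (hankelPhase ζ ν) - sin (hankelPhase ζ ν) * I) := by
  have h1 : cos (hankelPhase ζ ν) - sin (hankelPhase ζ ν) * I =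
      exp (-hankelPhase ζ ν * I) := by
    rw [exp_mul_I, cos_neg, sin_neg]
    ring
  have h2 := exp_pi_div_two_mul_I
  have key : exp (Real.pi / 2 * I) * exp (Real.pi / 2 * I * ν) *
      (exp (-(I * exp ζ)) * exp ((ζ - Real.pi / 2 * I + Real.log (2 / Real.pi)) / 2)) =
      exp ((ζ + Real.log (2 / Real.pi)) / 2) * exp (-hankelPhase ζ ν * I) := by
    rw [hankelPhase, ← exp_add, ← exp_add, ← exp_add, ← exp_add]
    ring_nf
  rw [h2] at key
  rw [h1, ← pi_div_two_mul_exp, hankelScale, exp_sub_half_pi_mul_I]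
  linear_combination (Real.pi / 2 : ℂ) * key

theorem hankelScale_add_half_pi (ν ζ : ℂ) :
    -(Real.pi / 2 * I * exp (-(Real.pi / 2 * I * ν))) * hankelScale (ζ + Real.pi / 2 * I) =
      exp ((ζ + Real.log (Real.pi / 2)) / 2) *
        (cos (hankelPhase ζ ν) + sin (hankelPhase ζ ν) * I) := by
  have h2 : exp (-(Real.pi / 2 * I)) = -I := by
    rw [exp_neg, exp_pi_div_two_mul_I, inv_I]
  have key : exp (-(Real.pi / 2 * I)) * exp (-(Real.pi / 2 * I * ν)) *
      (exp (I * exp ζ) * exp ((ζ + Real.pi / 2 * I + Real.log (2 / Real.pi)) / 2)) =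
      exp ((ζ + Real.log (2 / Real.pi)) / 2) * exp (hankelPhase ζ ν * I) := by
    rw [hankelPhase, ← exp_add, ← exp_add, ← exp_add, ← exp_add]
    ring_nf
  rw [h2] at key
  rw [← exp_mul_I, ← pi_div_two_mul_exp, hankelScale, exp_add_half_pi_mul_I]
  linear_combination (Real.pi / 2 : ℂ) * key

/-- `P + i Q` is the normalized `K_ν(z e^(-πi/2))`. -/
theorem hankelP_add_hankelQ {N : ℕ} (hN : 1 ≤ N) {ν ζ : ℂ} (hν : |ν.re| < (N : ℝ) + 1 / 2)
    (hζ : |ζ.im| < Real.pi) :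
    hankelP ζ ν + I * hankelQ ζ ν =
      hankelSum N (ζ - Real.pi / 2 * I) ν + terminantRemainder N (ζ - Real.pi / 2 * I) ν := by
  rw [← (besselK_eq hN hν (abs_im_sub_half_pi_lt hζ)).2, (besselK_half_pi hN hν hζ).1,
    mul_right_comm, hankelScale_sub_half_pi, hankelP, hankelQ]
  linear_combination (-(exp ((ζ + Real.log (Real.pi / 2)) / 2) * besselY ν ζ *
    sin (hankelPhase ζ ν))) * I_sq * (-1)

/-- `P - i Q` is the normalized `K_ν(z e^(πi/2))`. -/
theorem hankelP_sub_hankelQ {N : ℕ} (hN : 1 ≤ N) {ν ζ : ℂ} (hν : |ν.re| < (N : ℝ) + 1 / 2)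
    (hζ : |ζ.im| < Real.pi) :
    hankelP ζ ν - I * hankelQ ζ ν =
      hankelSum N (ζ + Real.pi / 2 * I) ν + terminantRemainder N (ζ + Real.pi / 2 * I) ν := by
  rw [← (besselK_eq hN hν (abs_im_add_half_pi_lt hζ)).2, (besselK_half_pi hN hν hζ).2,
    ← neg_mul, mul_right_comm, hankelScale_add_half_pi, hankelP, hankelQ]
  linear_combination (-(exp ((ζ + Real.log (Real.pi / 2)) / 2) * besselY ν ζ *
    sin (hankelPhase ζ ν))) * I_sq * (-1)

theorem one_div_neg_I_mul_pow (z : ℂ) (n : ℕ) : 1 / (-(I * z)) ^ n = I ^ n / z ^ n := by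
  rw [one_div, ← inv_pow, ← div_pow, ← neg_mul, mul_inv, inv_neg, inv_I, neg_neg, div_eq_mul_inv]

theorem one_div_I_mul_pow (z : ℂ) (n : ℕ) : 1 / (I * z) ^ n = (-I) ^ n / z ^ n := by
  rw [one_div, ← inv_pow, ← div_pow, mul_inv, inv_I, div_eq_mul_inv]

theorem I_pow_two_mul (n : ℕ) : I ^ (2 * n) = (-1) ^ n := by rw [pow_mul, I_sq]

theorem neg_I_pow_two_mul (n : ℕ) : (-I) ^ (2 * n) = (-1) ^ n := by rw [pow_mul, neg_sq, I_sq]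

theorem hankelSum_sub_half_pi (N : ℕ) (ζ ν : ℂ) : hankelSum N (ζ - Real.pi / 2 * I) ν =
    ∑ n ∈ Finset.range N, I ^ n * (hankelCoeff n ν / exp ζ ^ n) := by
  refine Finset.sum_congr rfl fun n _ => ?_
  rw [exp_sub_half_pi_mul_I, div_eq_mul_one_div, one_div_neg_I_mul_pow]
  ring

theorem hankelSum_add_half_pi (N : ℕ) (ζ ν : ℂ) : hankelSum N (ζ + Real.pi / 2 * I) ν =
    ∑ n ∈ Finset.range N, (-I) ^ n * (hankelCoeff n ν / exp ζ ^ n) := by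
  refine Finset.sum_congr rfl fun n _ => ?_
  rw [exp_add_half_pi_mul_I, div_eq_mul_one_div, one_div_I_mul_pow]
  ring

/-- In the half-sum of the two expansions only the even coefficients survive. -/
theorem hankelSum_half_pi_add (M : ℕ) (ζ ν : ℂ) :
    hankelSum (2 * M) (ζ - Real.pi / 2 * I) ν + hankelSum (2 * M) (ζ + Real.pi / 2 * I) ν =
      2 * ∑ n ∈ Finset.range M, (-1) ^ n * hankelCoeff (2 * n) ν / exp ζ ^ (2 * n) := by
  rw [hankelSum_sub_half_pi, hankelSum_add_half_pi]
  induction M with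
  | zero => simp
  | succ M ih =>
    rw [show 2 * (M + 1) = 2 * M + 1 + 1 by ring]
    simp only [Finset.sum_range_succ, pow_succ _ (2 * M), I_pow_two_mul, neg_I_pow_two_mul] at ih ⊢
    linear_combination ih

/-- In the half-difference of the two expansions only the odd coefficients survive. -/
theorem hankelSum_half_pi_sub (M : ℕ) (ζ ν : ℂ) :
    hankelSum (2 * M + 1) (ζ - Real.pi / 2 * I) ν -
        hankelSum (2 * M + 1) (ζ + Real.pi / 2 * I) ν =
      2 * I * ∑ n ∈ Finset.range M, (-1) ^ n * hankelCoeff (2 * n + 1) ν / exp ζ ^ (2 * n + 1) := by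
  rw [hankelSum_sub_half_pi, hankelSum_add_half_pi]
  induction M with
  | zero => simp
  | succ M ih =>
    rw [show 2 * (M + 1) + 1 = 2 * M + 1 + 1 + 1 by ring, Finset.sum_range_succ,
      Finset.sum_range_succ _ (2 * M + 1 + 1), Finset.sum_range_succ _ (2 * M + 1),
      Finset.sum_range_succ _ (2 * M + 1), Finset.sum_range_succ _ M,
      show 2 * M + 1 + 1 = 2 * (M + 1) by ring, I_pow_two_mul, neg_I_pow_two_mul,
      pow_succ I, pow_succ (-I), I_pow_two_mul, neg_I_pow_two_mul]
    linear_combination ih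

theorem terminantRemainder_sub_half_pi (N : ℕ) (ζ ν : ℂ) :
    terminantRemainder N (ζ - Real.pi / 2 * I) ν = (-1) ^ N * I ^ N *
      ((cos (Real.pi * ν) / Real.pi) * (Gamma N / 2 ^ N) * (1 / exp ζ ^ N) *
        (terminantLambda N (ζ + Real.log 2 - Real.pi / 2 * I) +
          ∫ t : ℝ in Ioi 0, terminantIntegrand N ν (ζ - Real.pi / 2 * I) t)) := by
  rw [terminantRemainder, exp_sub_half_pi_mul_I, one_div_neg_I_mul_pow,
    show ζ - Real.pi / 2 * I + Real.log 2 = ζ + Real.log 2 - Real.pi / 2 * I by ring]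
  ring

theorem terminantRemainder_add_half_pi (N : ℕ) (ζ ν : ℂ) :
    terminantRemainder N (ζ + Real.pi / 2 * I) ν = (-1) ^ N * (-I) ^ N *
      ((cos (Real.pi * ν) / Real.pi) * (Gamma N / 2 ^ N) * (1 / exp ζ ^ N) *
        (terminantLambda N (ζ + Real.log 2 + Real.pi / 2 * I) +
          ∫ t : ℝ in Ioi 0, terminantIntegrand N ν (ζ + Real.pi / 2 * I) t)) := by
  rw [terminantRemainder, exp_add_half_pi_mul_I, one_div_I_mul_pow,
    show ζ + Real.pi / 2 * I + Real.log 2 = ζ + Real.log 2 + Real.pi / 2 * I by ring]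
  ring

theorem terminantPi_integrand_eq (N : ℕ) (ν ζ : ℂ) (t : ℝ) :
    (t : ℂ)⁻¹ / (1 + (t : ℂ)) ^ N * regHypergeom (ν + 1 / 2) (-ν + 1 / 2) 0 (-(t : ℂ)) *
        terminantPi N (ζ + Real.log (2 * (1 + t))) =
      (terminantIntegrand N ν (ζ + Real.pi / 2 * I) t +
        terminantIntegrand N ν (ζ - Real.pi / 2 * I) t) / 2 := by
  rw [terminantPi, terminantIntegrand, terminantIntegrand,
    show ζ + Real.pi / 2 * I + Real.log (2 * (1 + t)) =
      ζ + Real.log (2 * (1 + t)) + Real.pi / 2 * I by ring,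
    show ζ - Real.pi / 2 * I + Real.log (2 * (1 + t)) =
      ζ + Real.log (2 * (1 + t)) - Real.pi / 2 * I by ring]
  ring

theorem remainderJ_eq {N : ℕ} (hN : 1 ≤ N) {ν ζ : ℂ} (hν : |ν.re| < (N : ℝ) + 1 / 2)
    (hζ : |ζ.im| < Real.pi) :
    remainderJ N ζ ν = (-1) ^ (N / 2) *
      ((cos (Real.pi * ν) / Real.pi) * (Gamma N / 2 ^ N) * (1 / exp ζ ^ N) *
        (terminantPi N (ζ + Real.log 2) +
          ((∫ t : ℝ in Ioi 0, terminantIntegrand N ν (ζ + Real.pi / 2 * I) t) +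
            ∫ t : ℝ in Ioi 0, terminantIntegrand N ν (ζ - Real.pi / 2 * I) t) / 2)) := by
  have h1 := hankelP_add_hankelQ hN hν hζ
  have h2 := hankelP_sub_hankelQ hN hν hζ
  rw [terminantRemainder_sub_half_pi] at h1
  rw [terminantRemainder_add_half_pi] at h2
  obtain ⟨M, rfl | rfl⟩ := N.even_or_odd'
  · have h3 := hankelSum_half_pi_add M ζ ν
    rw [I_pow_two_mul, Even.neg_one_pow (even_two_mul M)] at h1
    rw [neg_I_pow_two_mul, Even.neg_one_pow (even_two_mul M)] at h2
    rw [remainderJ, if_pos (even_two_mul M), Nat.mul_div_cancel_left M two_pos, terminantPi]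
    linear_combination (h1 + h2 + h3) / 2
  · have h3 := hankelSum_half_pi_sub M ζ ν
    rw [pow_succ I, I_pow_two_mul, Odd.neg_one_pow (odd_two_mul_add_one M)] at h1
    rw [pow_succ (-I), neg_I_pow_two_mul, Odd.neg_one_pow (odd_two_mul_add_one M)] at h2
    rw [remainderJ, if_neg (by simp), show (2 * M + 1) / 2 = M by omega, terminantPi]
    refine mul_left_cancel₀ (mul_ne_zero two_ne_zero I_ne_zero) ?_
    linear_combination h2 - h1 - h3

theorem theorem2 (N : ℕ) (hN : 1 ≤ N) (ν : ℂ) (hν : |ν.re| < (N : ℝ) + 1 / 2) :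
    (∀ ζ : ℂ, |ζ.im| < 3 * Real.pi / 2 →
      IntegrableOn (fun t : ℝ => (t : ℂ)⁻¹ / (1 + (t : ℂ)) ^ N *
          regHypergeom (ν + 1 / 2) (-ν + 1 / 2) 0 (-(t : ℂ)) *
          terminantLambda N (ζ + Real.log (2 * (1 + t)))) (Ioi 0) ∧
      remainderK N ζ ν =
        (-1) ^ N * (cos (Real.pi * ν) / Real.pi) * (Gamma N / 2 ^ N) * (1 / exp ζ ^ N) *
          (terminantLambda N (ζ + Real.log 2) +
            ∫ t : ℝ in Ioi 0, (t : ℂ)⁻¹ / (1 + (t : ℂ)) ^ N *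
              regHypergeom (ν + 1 / 2) (-ν + 1 / 2) 0 (-(t : ℂ)) *
              terminantLambda N (ζ + Real.log (2 * (1 + t))))) ∧
    (∀ ζ : ℂ, |ζ.im| < Real.pi →
      IntegrableOn (fun t : ℝ => (t : ℂ)⁻¹ / (1 + (t : ℂ)) ^ N *
          regHypergeom (ν + 1 / 2) (-ν + 1 / 2) 0 (-(t : ℂ)) *
          terminantPi N (ζ + Real.log (2 * (1 + t)))) (Ioi 0) ∧
      remainderJ N ζ ν =
        (-1) ^ (N / 2) * (cos (Real.pi * ν) / Real.pi) * (Gamma N / 2 ^ N) * (1 / exp ζ ^ N) *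
          (terminantPi N (ζ + Real.log 2) +
            ∫ t : ℝ in Ioi 0, (t : ℂ)⁻¹ / (1 + (t : ℂ)) ^ N *
              regHypergeom (ν + 1 / 2) (-ν + 1 / 2) 0 (-(t : ℂ)) *
              terminantPi N (ζ + Real.log (2 * (1 + t))))) := by
  refine ⟨fun ζ hζ => ⟨integrableOn_terminantIntegrand hν hζ, remainderK_eq hN hν hζ⟩,
    fun ζ hζ => ?_⟩
  have i1 := integrableOn_terminantIntegrand hν (abs_im_add_half_pi_lt hζ)
  have i2 := integrableOn_terminantIntegrand hν (abs_im_sub_half_pi_lt hζ)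
  simp only [terminantPi_integrand_eq]
  refine ⟨(Integrable.add i1 i2).div_const 2, ?_⟩
  rw [integral_div, integral_add i1 i2, remainderJ_eq hN hν hζ]
  ring
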